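/- **Conventions.** $[\cdot]$ is the integer part and $a\prec b$ means $a(x)/b(x)\to0$ as $x\to\infty$. Let $\mathcal R$ be the set of real functions $a$ that are $C^3$ on some half-line $(c,\infty)$, $c\ge 0$, and for which the limits as $x\to\infty$ of $xa'(x)/a(x)$, $xa''(x)/a'(x)$ and $xa'''(x)/a''(x)$ exist in $\mathbb R$. Let $\mathcal T$ be the set of $a\in\mathcal R$ with either $\lim_{x\to\infty} xa'(x)/a(x)\in(0,1)$, or $\lim_{x\to\infty} xa'(x)/a(x)=1$ and $a'(x)\to0$ (eventually) monotonically. Let $\mathcal L_*$ be the set of functions $x\mapsto\gamma x+\ell$ with $\gamma,\ell\in\mathbb R$, $\gamma\neq0$. Let $d\ge1$ and, for $1\le i\le d$, let $X_i$ be a compact metric space with its Borel $\sigma$-algebra, $\mu_i$ a Borel probability measure on $X_i$ and $T_i\colon X_i\to X_i$ a measurable map preserving $\mu_i$. Let $\nu$ be a coupling of the spaces $(X_i,\mu_i)$, that is, a Borel probability measure on $X_1\times\cdots\times X_d$ with marginals $\mu_1,\dots,\mu_d$. Let $a_1,\dots,a_d$ be functions with $a_d\prec\cdots\prec a_1$,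 and suppose that for each $i$ the map $T_i$ is invertible or $a_i$ is eventually nonnegative (so that $T_i^{[a_i(n)]}$ makes sense for all large $n$). Write $\mathcal I(T)$ for the $\sigma$-algebra of $T$-invariant sets, $\mu_i=\int\mu_{[T_i],x}\,d\mu_i(x)$ for the disintegration of $\mu_i$ over $\mathcal I(T_i)$, and, for $\vec x=(x_1,\dots,x_d)$, $$\lambda_{N,\vec x}=\frac1N\sum_{n=0}^{N-1}\delta_{\left(T_1^{[a_1(n)]}x_1,\dots,T_d^{[a_d(n)]}x_d\right)},\qquad A_N(\vec x)=\frac1N\sum_{n=0}^{N-1}\prod_{i=1}^d f_i\big(T_i^{[a_i(n)]}x_i\big).$$ **A.** Suppose that $a_i\in\mathcal T$ for all $i$. Then: 1. For $\nu$-a.e. $\vec x$, $\lambda_{N,\vec x}\to\mu_{[T_1,\dots,T_d],\vec x}:=\bigotimes_{i=1}^d\mu_{[T_i],x_i}$ weak-$*$ as $N\to\infty$. 2. For all $f_i\in L^\infty(\mu_i)$, $A_N(\vec x)\to\prod_{i=1}^d\mathbb E(f_i|\mathcal I(T_i))(x_i)$ for $\nu$-a.e. $\vec x$. 3. In particular,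 if all $T_i$ act on and preserve the measure of one such space $(X,\mu)$ and $f_i\in L^\infty(\mu)$, then $\frac1N\sum_{n=0}^{N-1}\prod_{i=1}^d f_i(T_i^{[a_i(n)]}x)\to\prod_{i=1}^d\mathbb E(f_i|\mathcal I(T_i))(x)$ for $\mu$-a.e. $x$. 4. If, for some $i$, $T_i$ is continuous and $\mu_i$ is the only $T_i$-invariant Borel probability measure (that is, $(X_i,T_i)$ is uniquely ergodic), then $\frac1N\sum_{n=0}^{N-1}f(T_i^{[a_i(n)]}x)\to\int f\,d\mu_i$ for every continuous $f$ on $X_i$ and **every** $x\in X_i$. 5. If all $(X_i,T_i)$ are uniquely ergodic and the $f_i$ are continuous, then $A_N(\vec x)\to\prod_{i=1}^d\int f_i\,d\mu_i$ for $\nu$-a.e. $\vec x$. **B.** Suppose that $a_i\in\mathcal T\cup\mathcal L_*$ for all $i$ (so only $a_1$ can be linear), and let $f_i\in L^\infty(\mu_i)$. Then $A_N(\vec x)$ converges for $\nu$-a.e. $\vec x$. Moreover: 1. If $a_1(x)=\frac pq x+\ell$ with $p\in\mathbb Z\setminus\{0\}$, $q\in\mathbb N$, $q\ge1$, $\ell\in\mathbb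 R$ (and $\ell\ge0$ if $T_1$ is not invertible), the limit is, for $\nu$-a.e. $\vec x$, $$\frac1q\sum_{j=0}^{q-1}\mathbb E\Big(f_1\circ T_1^{[\frac{pj}q+\ell]}\,\Big|\,\mathcal I(T_1^p)\Big)(x_1)\cdot\prod_{i=2}^d\mathbb E(f_i|\mathcal I(T_i))(x_i).$$ 2. If $a_1(x)=\gamma x+\ell$ with $\gamma\in\mathbb R\setminus\mathbb Q$, $\ell\in\mathbb R$, the limit is, for $\nu$-a.e. $\vec x$, $F(x_1)\prod_{i=2}^d\mathbb E(f_i|\mathcal I(T_i))(x_i)$, where $$F=\sum_{m\in\mathbb Z}\exp\Big(2\pi i\frac{m\ell}\gamma\Big)\cdot\frac{\exp(-2\pi i\frac m\gamma)-1}{-2\pi i\frac m\gamma}\;P_mf_1,$$ the series converges unconditionally in $L^2(\mu_1)$, the quotient is read as $1$ for $m=0$, and $P_m$ is the orthogonal projection of $L^2(\mu_1)$ onto the eigenspace $\{g: g\circ T_1=\exp(2\pi i\frac m\gamma)\,g\}$. -/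

import Mathlib

open MeasureTheory ProbabilityTheory Filter Topology
open scoped ENNReal NNReal

noncomputable section

/-! ### Growth classes of real functions

Functions defined on a half-line `(c, ∞)` are represented by total functions `ℝ → ℝ`, whose values
outside the half-line are irrelevant. -/

/-- `a ≺ b`: `a x / b x → 0` as `x → ∞`. -/
def GrowsSlower (a b : ℝ → ℝ) : Prop :=
  Tendsto (fun x => a x / b x) atTop (𝓝 0)

/-- The class `ℛ` of functions that are `C³` on some half-line `(c, ∞)`, `c ≥ 0`, and for which
`x a'(x)/a(x)`, `x a''(x)/a'(x)`, `x a'''(x)/a''(x)` are defined for all large `x` and have finite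
limits as `x → ∞`. -/
def ClassR : Set (ℝ → ℝ) :=
  {a | (∃ c : ℝ, 0 ≤ c ∧ ContDiffOn ℝ 3 a (Set.Ioi c)) ∧
    (∀ᶠ x in atTop, a x ≠ 0 ∧ deriv a x ≠ 0 ∧ deriv (deriv a) x ≠ 0) ∧
    (∃ α : ℝ, Tendsto (fun x => x * deriv a x / a x) atTop (𝓝 α)) ∧
    (∃ β : ℝ, Tendsto (fun x => x * deriv (deriv a) x / deriv a x) atTop (𝓝 β)) ∧
    (∃ γ : ℝ, Tendsto (fun x => x * deriv (deriv (deriv a)) x / deriv (deriv a) x) atTop (𝓝 γ))}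

/-- `g x → 0` monotonically as `x → ∞`. -/
def TendstoZeroMonotonically (g : ℝ → ℝ) : Prop :=
  Tendsto g atTop (𝓝 0) ∧
    ∃ c : ℝ, MonotoneOn g (Set.Ioi c) ∨ AntitoneOn g (Set.Ioi c)

/-- The class `𝒯`: functions of `ℛ` for which `lim x a'(x)/a(x)` lies in `(0, 1)`, or equals `1`
with `a' → 0` monotonically. -/
def ClassT : Set (ℝ → ℝ) :=
  {a | a ∈ ClassR ∧
    ∃ α : ℝ, Tendsto (fun x => x * deriv a x / a x) atTop (𝓝 α) ∧
      (α ∈ Set.Ioo (0 : ℝ) 1 ∨ (α = 1 ∧ TendstoZeroMonotonically (deriv a)))}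

/-- The class `ℒ_*` of linear functions `x ↦ γ x + ℓ` with `γ ≠ 0`. -/
def ClassL : Set (ℝ → ℝ) :=
  {a | ∃ γ ℓ : ℝ, γ ≠ 0 ∧ a = fun x => γ * x + ℓ}

/-! ### Dynamics -/

open Classical in
/-- The iterate `T^k`, `k ∈ ℤ`: the integer power of the permutation `T` when `T` is bijective.
When `T` is not bijective only the iterates with `k ≥ 0` are meaningful (negative `k` give the
identity by convention). -/
def iter {X : Type*} (T : X → X) (k : ℤ) : X → X :=
  if h : Function.Bijective T then ⇑((Equiv.ofBijective T h : Equiv.Perm X) ^ k) else T^[k.toNat]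

/-- For `k ≥ 0` this is the usual iterate, whether or not `T` is invertible. -/
theorem iter_natCast {X : Type*} (T : X → X) (n : ℕ) : iter T (n : ℤ) = T^[n] := by
  unfold iter
  split_ifs with h
  · rw [zpow_natCast, Equiv.Perm.coe_pow]; rfl
  · simp

/-- The iterates `T^[a(n)]` make sense for all large `n`: `T` is invertible, or `a` is eventually
nonnegative. -/
def Admissible {X : Type*} (T : X → X) (a : ℝ → ℝ) : Prop :=
  Function.Bijective T ∨ ∀ᶠ t in atTop, 0 ≤ a t

/-- The Cesàro average `(1/N) ∑_{n<N} ∏ᵢ fᵢ (Tᵢ^[aᵢ(n)] xᵢ)`. -/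
def multAvg {d : ℕ} {X : Fin d → Type*} (a : Fin d → ℝ → ℝ) (T : ∀ i, X i → X i)
    (f : ∀ i, X i → ℂ) (x : ∀ i, X i) (N : ℕ) : ℂ :=
  (N : ℂ)⁻¹ * ∑ n ∈ Finset.range N, ∏ i, f i (iter (T i) ⌊a i (n : ℝ)⌋ (x i))

/-- The empirical measure
`λ_{N,x} = (1/N) ∑_{n<N} (T₁^[a₁(n)] × ⋯ × T_d^[a_d(n)]) δ_x`. -/
def empirical {d : ℕ} {X : Fin d → Type*} [∀ i, MeasurableSpace (X i)] (a : Fin d → ℝ → ℝ)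
    (T : ∀ i, X i → X i) (x : ∀ i, X i) (N : ℕ) : FiniteMeasure (∀ i, X i) :=
  ⟨(N : ℝ≥0)⁻¹ • ∑ n ∈ Finset.range N,
      Measure.dirac (fun i => iter (T i) ⌊a i (n : ℝ)⌋ (x i)), inferInstance⟩

/-- The fibre `μ_{[T],x}` of the disintegration of `μ` over the σ-algebra `ℐ(T)` of `T`-invariant
sets (the ergodic decomposition of `μ`). -/
def ergodicFibre {X : Type*} [MeasurableSpace X] [StandardBorelSpace X] (μ : Measure X)
    [IsFiniteMeasure μ] (T : X → X) (x : X) : Measure X :=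
  condExpKernel μ (MeasurableSpace.invariants T) x

instance {X : Type*} [MeasurableSpace X] [StandardBorelSpace X] (μ : Measure X)
    [IsProbabilityMeasure μ] (T : X → X) (x : X) : IsProbabilityMeasure (ergodicFibre μ T x) := by
  have : Nonempty X := ⟨x⟩
  unfold ergodicFibre
  infer_instance

/-- The measure `μ_{[T₁,…,T_d],x} = ⨂ᵢ μ_{[Tᵢ],xᵢ}`. -/
def prodErgodicFibre {d : ℕ} {X : Fin d → Type*} [∀ i, MeasurableSpace (X i)]
    [∀ i, StandardBorelSpace (X i)] (μ : ∀ i, Measure (X i)) [∀ i, IsProbabilityMeasure (μ i)]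
    (T : ∀ i, X i → X i) (x : ∀ i, X i) : FiniteMeasure (∀ i, X i) :=
  ⟨Measure.pi fun i => ergodicFibre (μ i) (T i) (x i), inferInstance⟩

/-- `ν` is a coupling of the probability spaces `(X i, μ i)`. -/
def IsCoupling {d : ℕ} {X : Fin d → Type*} [∀ i, MeasurableSpace (X i)]
    (μ : ∀ i, Measure (X i)) (ν : Measure (∀ i, X i)) : Prop :=
  IsProbabilityMeasure ν ∧ ∀ i, ν.map (fun x => x i) = μ i

/-- `(X, T)` is a uniquely ergodic topological system whose unique invariant Borel probability
measure is `μ`. -/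
def IsUniquelyErgodic {X : Type*} [TopologicalSpace X] [MeasurableSpace X] (T : X → X)
    (μ : Measure X) : Prop :=
  Continuous T ∧ IsProbabilityMeasure μ ∧ MeasurePreserving T μ μ ∧
    ∀ m : Measure X, IsProbabilityMeasure m → MeasurePreserving T m m → m = μ

/-! ### Eigenspaces and the limit function for an irrational leading coefficient -/

/-- The space of `g ∈ L²(μ)` with `g ∘ T = exp(2πiθ) g`. -/
def koopmanEigenspace {X : Type*} [MeasurableSpace X] {μ : Measure X} {T : X → X}
    (hT : MeasurePreserving T μ μ) (θ : ℝ) : Submodule ℂ (Lp ℂ 2 μ) :=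
  Module.End.eigenspace
    (Lp.compMeasurePreservingₗᵢ ℂ T hT).toContinuousLinearMap.toLinearMap
    (Complex.exp (2 * Real.pi * Complex.I * θ))

instance {X : Type*} [MeasurableSpace X] {μ : Measure X} {T : X → X}
    (hT : MeasurePreserving T μ μ) (θ : ℝ) : (koopmanEigenspace hT θ).HasOrthogonalProjection := by
  unfold koopmanEigenspace
  infer_instance

/-- The coefficient `exp(2πi mℓ/γ) · (exp(-2πi m/γ) - 1) / (-2πi m/γ)`, where the second factor is
read as its limit value `1` for `m = 0`. -/
def irrCoeff (γ ℓ : ℝ) (m : ℤ) : ℂ :=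
  if m = 0 then 1
  else Complex.exp (2 * Real.pi * Complex.I * (m * ℓ / γ)) *
    ((Complex.exp (-(2 * Real.pi * Complex.I * (m / γ))) - 1) /
      (-(2 * Real.pi * Complex.I * (m / γ))))

end

noncomputable section

/-! The argument is deterministic on a single good orbit. For almost every `x`, the averages of `(f
(T^[a(n)] x) - L) * b n` tend to `0` for every bounded `b` whose variation is `o(|a|)`; this is
`SlowLimit`. An orbit sampled along a function `a j` of the class `𝒯` changes only when the integer
part of `a j n` does, so its variation is `O(|a j|)`, which is `o(|a i|)` for `i < j`. Telescoping
the difference of the products (`isLittleO_sum_prod_sub`) therefore gives the multiple averages. The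
exceptional null sets concern one coordinate at a time, which is why any coupling is allowed.

Where `SlowLimit` comes from: by von Neumann's argument, `f` minus its projection to the fixed space
is, up to a small `L¹` error, a coboundary `h ∘ T - h` with `h` bounded, and the maximal ergodic
inequality makes this error small in mean along most orbits. So almost every orbit, minus its
conditional expectation, is an `AlmostCoboundary` (`ae_almostCoboundary_orbit`, stated with a twist
by a character for later use). This also contains Birkhoff's theorem.

For `a` in `𝒯` the integer part `κ` of `|a|`, up to rounding, stays at the level `m` for a time `c
m` with `c (m + 1) / c m → 1` and `c m = O(N / κ N)`. Grouping by levels and summing by parts bounds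
the sum of `(h (κ n + 1) - h (κ n)) * b n` by `sup ‖h‖` times the variation of `c m * b`: the
changes of `c` sum to `o(N)`, and those of `b` cost `O(N / κ N) * o(κ N)`. This is
`isLittleO_sum_coboundary_comp`; the axioms of `𝒯` enter only through `RegularGrowth`.

For a linear `a` the counter is `n` itself, and the sampled orbit minus its limit must be an almost
coboundary. By `AlmostCoboundary.of_blocks` it suffices to treat sums over bounded blocks. For slope
`p / q` blocks of length `q` reduce to the map `T^p`. For irrational `γ > 0` the blocks are the
level sets of the integer part of `γ n + ℓ`; for large `m` the `m`-th has `γ⁻¹ + B(z (m + 1)) - B(z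
m)` elements, with `B` the sawtooth and `z m = (ℓ - m) / γ`. Replacing `B` by a trigonometric
polynomial close to it in mean along the rotation leaves twisted orbits, each contributing an
eigenprojection, and the Fourier coefficients of `B` produce those of `F`.

Weak convergence is tested on a countable dense family of tensor products. Under unique ergodicity
coboundaries average to zero at every point, so every weak limit of empirical measures is invariant.
-/

/-- The sum of the increments of `b` up to `N`. -/
def totalVar (b : ℕ → ℂ) (N : ℕ) : ℝ := ∑ n ∈ Finset.range N, ‖b (n + 1) - b n‖

/-- The averages of `(u n - L) * b n` tend to `0` for each bounded `b` of variation `o(ρ)`. -/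
def SlowLimit (u : ℕ → ℂ) (L : ℂ) (ρ : ℕ → ℝ) : Prop :=
  ∀ b : ℕ → ℂ, (∃ C, ∀ n, ‖b n‖ ≤ C) → totalVar b =o[atTop] ρ →
    (fun N => ∑ n ∈ Finset.range N, (u n - L) * b n) =o[atTop] fun N : ℕ => (N : ℝ)

/-- `u` is a coboundary of a bounded sequence up to an error of small upper mean. -/
def AlmostCoboundary (u : ℕ → ℂ) : Prop :=
  ∀ ε > 0, ∃ h : ℕ → ℂ, (∃ C, ∀ n, ‖h n‖ ≤ C) ∧
    ∀ᶠ M : ℕ in atTop, ∑ m ∈ Finset.range M, ‖u m - (h (m + 1) - h m)‖ ≤ ε * M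

/-- `κ` is a counter whose level sets vary slowly in size and are of size `O(N / κ N)` up to `N`. -/
def RegularCounter (κ : ℕ → ℕ) : Prop :=
  ∃ τ : ℕ → ℕ, GaloisConnection τ κ ∧
    (∀ ε > 0, ∀ᶠ m in atTop, |((τ (m + 2) : ℝ) - τ (m + 1)) - (τ (m + 1) - τ m)| ≤
      ε * (τ (m + 1) - τ m)) ∧
    ∃ C, ∀ᶠ M in atTop, ∀ m ≤ M, ((τ (m + 1) : ℝ) - τ m) * M ≤ C * τ M

/-! ### Slowly varying weights and products of sequences -/

theorem totalVar_nonneg (b : ℕ → ℂ) (N : ℕ) : 0 ≤ totalVar b N :=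
  Finset.sum_nonneg fun _ _ => norm_nonneg _

theorem totalVar_mono (b : ℕ → ℂ) : Monotone (totalVar b) := fun _ _ h =>
  Finset.sum_le_sum_of_subset_of_nonneg (Finset.range_mono h) fun _ _ _ => norm_nonneg _

theorem norm_sub_le_totalVar (b : ℕ → ℂ) {m n : ℕ} (h : m ≤ n) :
    ‖b n - b m‖ ≤ totalVar b n - totalVar b m := by
  induction n, h using Nat.le_induction with
  | base => simp
  | succ n hn ih =>
    have : totalVar b (n + 1) = totalVar b n + ‖b (n + 1) - b n‖ := Finset.sum_range_succ _ _
    have h2 := norm_sub_le_norm_sub_add_norm_sub (b (n + 1)) (b n) (b m)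
    linarith

theorem totalVar_mul_le {b₁ b₂ : ℕ → ℂ} {C₁ C₂ : ℝ} (h₁ : ∀ n, ‖b₁ n‖ ≤ C₁)
    (h₂ : ∀ n, ‖b₂ n‖ ≤ C₂) (N : ℕ) :
    totalVar (fun n => b₁ n * b₂ n) N ≤ C₂ * totalVar b₁ N + C₁ * totalVar b₂ N := by
  unfold totalVar
  rw [Finset.mul_sum, Finset.mul_sum, ← Finset.sum_add_distrib]
  refine Finset.sum_le_sum fun n _ => ?_
  have : b₁ (n + 1) * b₂ (n + 1) - b₁ n * b₂ n =
    b₂ (n + 1) * (b₁ (n + 1) - b₁ n) + b₁ n * (b₂ (n + 1) - b₂ n) := by ring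
  rw [this]
  refine (norm_add_le _ _).trans ?_
  rw [norm_mul, norm_mul]
  gcongr
  · exact h₂ _
  · exact h₁ _

theorem bounded_finset_prod {ι : Type*} (s : Finset ι) {u : ι → ℕ → ℂ}
    (hb : ∀ i ∈ s, ∃ C, ∀ n, ‖u i n‖ ≤ C) : ∃ C, ∀ n, ‖∏ i ∈ s, u i n‖ ≤ C := by
  choose! C hC using hb
  refine ⟨∏ i ∈ s, C i, fun n => ?_⟩
  rw [norm_prod]
  exact Finset.prod_le_prod (fun _ _ => norm_nonneg _) fun i hi => hC i hi n

theorem totalVar_finset_prod_isLittleO {ι : Type*} (s : Finset ι) {u : ι → ℕ → ℂ} {ρ : ℕ → ℝ}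
    (hb : ∀ i ∈ s, ∃ C, ∀ n, ‖u i n‖ ≤ C) (hv : ∀ i ∈ s, totalVar (u i) =o[atTop] ρ) :
    totalVar (fun n => ∏ i ∈ s, u i n) =o[atTop] ρ := by
  classical
  induction s using Finset.induction_on with
  | empty =>
    have : totalVar (fun n => ∏ i ∈ (∅ : Finset ι), u i n) = fun _ => 0 := by
      ext N; simp [totalVar]
    rw [this]; exact Asymptotics.isLittleO_zero _ _
  | insert a s ha ih =>
    obtain ⟨C₁, h₁⟩ := hb a (by simp)
    obtain ⟨C₂, h₂⟩ := bounded_finset_prod s (u := u) fun i hi => hb i (by simp [hi])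
    have e₁ := ih (fun i hi => hb i (by simp [hi])) fun i hi => hv i (by simp [hi])
    have e₂ := hv a (by simp)
    simp only [Finset.prod_insert ha]
    refine Asymptotics.IsBigO.trans_isLittleO (Asymptotics.IsBigO.of_bound' ?_)
      ((e₂.const_mul_left C₂).add (e₁.const_mul_left C₁))
    refine Eventually.of_forall fun N => ?_
    rw [Real.norm_of_nonneg (totalVar_nonneg _ _)]
    exact (totalVar_mul_le h₁ h₂ N).trans (le_abs_self _)

/-- Averages of products of sequences of decreasing growth. -/
theorem isLittleO_sum_prod_sub {d : ℕ} {u : Fin d → ℕ → ℂ} {L : Fin d → ℂ} {ρ : Fin d → ℕ → ℝ}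
    (hS : ∀ i, SlowLimit (u i) (L i) (ρ i)) (hb : ∀ i, ∃ C, ∀ n, ‖u i n‖ ≤ C)
    (hv : ∀ i j, i < j → totalVar (u j) =o[atTop] ρ i) :
    (fun N => ∑ n ∈ Finset.range N, (∏ i, u i n - ∏ i, L i)) =o[atTop] fun N : ℕ => (N : ℝ) := by
  -- In the `i`-th term of the telescoping sum the faster factors are already constants, and the
  -- slower ones, `j > i`, form the test sequence for `SlowLimit`.
  have key : ∀ n, ∏ i, u i n - ∏ i, L i =
      ∑ i, (∏ j with j < i, L j) * ((u i n - L i) * ∏ j with i < j, u j n) := by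
    intro n
    have h := Finset.prod_add_ordered Finset.univ (fun i => u i n) (fun i => L i - u i n)
    simp only [add_sub_cancel] at h
    rw [h, sub_add_cancel_left, ← Finset.sum_neg_distrib]
    refine Finset.sum_congr rfl fun i _ => by ring
  simp only [key]
  have : (fun N => ∑ n ∈ Finset.range N,
      ∑ i, (∏ j with j < i, L j) * ((u i n - L i) * ∏ j with i < j, u j n)) =
      fun N => ∑ i, (∏ j with j < i, L j) *
        ∑ n ∈ Finset.range N, ((u i n - L i) * ∏ j with i < j, u j n) := by
    ext N
    rw [Finset.sum_comm]
    simp only [Finset.mul_sum]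
  rw [this]
  refine Asymptotics.IsLittleO.fun_sum fun i _ => Asymptotics.IsLittleO.const_mul_left ?_ _
  refine hS i _ (bounded_finset_prod _ fun j _ => hb j) ?_
  exact totalVar_finset_prod_isLittleO _ (fun j _ => hb j) fun j hj => hv i j (by simpa using hj)

theorem tendsto_average_of_isLittleO {u : ℕ → ℂ} {L : ℂ}
    (h : (fun N => ∑ n ∈ Finset.range N, (u n - L)) =o[atTop] fun N : ℕ => (N : ℝ)) :
    Tendsto (fun N : ℕ => (N : ℂ)⁻¹ * ∑ n ∈ Finset.range N, u n) atTop (𝓝 L) := by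
  have h1 : (fun N => ∑ n ∈ Finset.range N, (u n - L)) =o[atTop] fun N : ℕ => (N : ℂ) := by
    rw [← Asymptotics.isLittleO_norm_right]; simpa using h
  have h2 := h1.tendsto_div_nhds_zero
  rw [← tendsto_sub_nhds_zero_iff]
  refine h2.congr' ?_
  filter_upwards [eventually_ne_atTop 0] with N hN
  have : (N : ℂ) ≠ 0 := by exact_mod_cast hN
  simp only [Finset.sum_sub_distrib, Finset.sum_const, Finset.card_range, nsmul_eq_mul]
  field_simp

theorem isLittleO_natCast_iff {S : ℕ → ℂ} : (S =o[atTop] fun N : ℕ => (N : ℝ)) ↔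
    ∀ ε > 0, ∀ᶠ N in atTop, ‖S N‖ ≤ ε * N := by
  rw [Asymptotics.isLittleO_iff]
  simp

theorem isLittleO_const_natCast (c : ℂ) : (fun _ : ℕ => c) =o[atTop] fun N : ℕ => (N : ℝ) :=
  Asymptotics.isLittleO_const_left.2 (Or.inr
    (tendsto_norm_atTop_atTop.comp tendsto_natCast_atTop_atTop))

theorem sum_congr_isLittleO {u v : ℕ → ℂ} (h : u =ᶠ[atTop] v)
    (hu : (fun N => ∑ n ∈ Finset.range N, u n) =o[atTop] fun N : ℕ => (N : ℝ)) :
    (fun N => ∑ n ∈ Finset.range N, v n) =o[atTop] fun N : ℕ => (N : ℝ) := by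
  obtain ⟨K, hK⟩ := eventually_atTop.1 h
  have := hu.add (isLittleO_const_natCast (∑ n ∈ Finset.range K, (v n - u n)))
  refine this.congr' ?_ EventuallyEq.rfl
  filter_upwards [eventually_ge_atTop K] with N hN
  have e : ∑ n ∈ Finset.Ico K N, u n = ∑ n ∈ Finset.Ico K N, v n :=
    Finset.sum_congr rfl fun n hn => hK n (Finset.mem_Ico.1 hn).1
  rw [← Finset.sum_range_add_sum_Ico _ hN, ← Finset.sum_range_add_sum_Ico _ hN, e,
    Finset.sum_sub_distrib]
  ring

theorem SlowLimit.congr {u v : ℕ → ℂ} {L : ℂ} {ρ : ℕ → ℝ} (hu : SlowLimit u L ρ)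
    (h : u =ᶠ[atTop] v) : SlowLimit v L ρ := fun b hb hv =>
  sum_congr_isLittleO (by filter_upwards [h] with n hn; rw [hn]) (hu b hb hv)

theorem SlowLimit.congr_growth {u : ℕ → ℂ} {L : ℂ} {ρ ρ' : ℕ → ℝ} (hu : SlowLimit u L ρ)
    (h : ρ' =O[atTop] ρ) : SlowLimit u L ρ' := fun b hb hv =>
  hu b hb (hv.trans_isBigO h)

theorem totalVar_congr_isBigO {u v : ℕ → ℂ} (h : u =ᶠ[atTop] v) :
    ∃ K, ∀ N, totalVar v N ≤ totalVar u N + K := by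
  obtain ⟨K, hK⟩ := eventually_atTop.1 h
  refine ⟨totalVar v K, fun N => ?_⟩
  rcases le_total N K with hN | hN
  · have := totalVar_mono v hN
    have := totalVar_nonneg u N
    linarith
  · unfold totalVar
    rw [← Finset.sum_range_add_sum_Ico _ hN, ← Finset.sum_range_add_sum_Ico _ hN]
    have : ∑ k ∈ Finset.Ico K N, ‖v (k + 1) - v k‖ = ∑ k ∈ Finset.Ico K N, ‖u (k + 1) - u k‖ := by
      refine Finset.sum_congr rfl fun n hn => ?_
      have := (Finset.mem_Ico.1 hn).1
      rw [hK n this, hK (n + 1) (by omega)]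
    have := Finset.sum_nonneg (s := Finset.range K) fun n _ => norm_nonneg (u (n + 1) - u n)
    linarith

/-- The composition moves only where `κ` jumps; a move costs at most `2 * C`, and a jump raises `κ`
by at least `1`. -/
theorem totalVar_comp_le {g : ℕ → ℂ} {κ : ℕ → ℕ} {C : ℝ} (hg : ∀ n, ‖g n‖ ≤ C) (hκ : Monotone κ)
    (N : ℕ) : totalVar (g ∘ κ) N ≤ 2 * C * κ N := by
  have hC : 0 ≤ C := (norm_nonneg _).trans (hg 0)
  induction N with
  | zero => simp [totalVar]; positivity
  | succ N ih =>
    have e : totalVar (g ∘ κ) (N + 1) = totalVar (g ∘ κ) N + ‖g (κ (N + 1)) - g (κ N)‖ :=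
      Finset.sum_range_succ _ _
    rw [e]
    rcases (hκ N.le_succ).eq_or_lt with h | h
    · rw [h] at ih
      simp only [Nat.succ_eq_add_one] at h ⊢
      rw [h]; simpa [h] using ih
    · have h1 : (κ N : ℝ) + 1 ≤ κ (N + 1) := by exact_mod_cast h
      have h2 := (norm_sub_le (g (κ (N + 1))) (g (κ N))).trans (add_le_add (hg _) (hg _))
      nlinarith

/-! ### Almost coboundaries -/

theorem AlmostCoboundary.of_approx {u : ℕ → ℂ}
    (h : ∀ ε > 0, ∃ v, AlmostCoboundary v ∧
      ∀ᶠ M : ℕ in atTop, ∑ m ∈ Finset.range M, ‖u m - v m‖ ≤ ε * M) : AlmostCoboundary u := by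
  intro ε hε
  obtain ⟨v, hv, hM⟩ := h (ε / 2) (half_pos hε)
  obtain ⟨g, hg, hM'⟩ := hv (ε / 2) (half_pos hε)
  refine ⟨g, hg, ?_⟩
  filter_upwards [hM, hM'] with M h1 h2
  calc _ ≤ ∑ m ∈ Finset.range M, (‖u m - v m‖ + ‖v m - (g (m + 1) - g m)‖) :=
        Finset.sum_le_sum fun m _ => norm_sub_le_norm_sub_add_norm_sub _ _ _
    _ ≤ ε / 2 * M + ε / 2 * M := by rw [Finset.sum_add_distrib]; exact add_le_add h1 h2
    _ = ε * M := by ring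

theorem AlmostCoboundary.add {u v : ℕ → ℂ} (hu : AlmostCoboundary u) (hv : AlmostCoboundary v) :
    AlmostCoboundary fun m => u m + v m := by
  intro ε hε
  obtain ⟨h, ⟨C, hC⟩, hM⟩ := hu (ε / 2) (half_pos hε)
  obtain ⟨g, ⟨D, hD⟩, hM'⟩ := hv (ε / 2) (half_pos hε)
  refine ⟨fun m => h m + g m, ⟨C + D, fun n => (norm_add_le _ _).trans (add_le_add (hC n) (hD n))⟩,
    ?_⟩
  filter_upwards [hM, hM'] with M h1 h2
  calc _ ≤ ∑ m ∈ Finset.range M, (‖u m - (h (m + 1) - h m)‖ + ‖v m - (g (m + 1) - g m)‖) :=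
        Finset.sum_le_sum fun m _ => by
          refine le_trans (le_of_eq ?_) (norm_add_le _ _)
          congr 1; ring
    _ ≤ ε / 2 * M + ε / 2 * M := by rw [Finset.sum_add_distrib]; exact add_le_add h1 h2
    _ = ε * M := by ring

theorem AlmostCoboundary.const_mul {u : ℕ → ℂ} (hu : AlmostCoboundary u) (c : ℂ) :
    AlmostCoboundary fun m => c * u m := by
  intro ε hε
  obtain ⟨h, ⟨C, hC⟩, hM⟩ := hu (ε / (‖c‖ + 1)) (by positivity)
  refine ⟨fun m => c * h m, ⟨‖c‖ * C, fun n => by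
    rw [norm_mul]; exact mul_le_mul_of_nonneg_left (hC n) (norm_nonneg _)⟩, ?_⟩
  filter_upwards [hM] with M h1
  have : ∀ m, ‖c * u m - (c * h (m + 1) - c * h m)‖ = ‖c‖ * ‖u m - (h (m + 1) - h m)‖ := by
    intro m; rw [← norm_mul]; congr 1; ring
  simp only [this, ← Finset.mul_sum]
  calc _ ≤ (‖c‖ + 1) * (ε / (‖c‖ + 1) * M) := by gcongr; linarith
    _ = ε * M := by field_simp

theorem AlmostCoboundary.zero : AlmostCoboundary fun _ => 0 := fun ε hε =>
  ⟨fun _ => 0, ⟨0, by simp⟩, Eventually.of_forall fun M => by simp; positivity⟩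

theorem AlmostCoboundary.sum {ι : Type*} (s : Finset ι) {u : ι → ℕ → ℂ}
    (hu : ∀ i ∈ s, AlmostCoboundary (u i)) : AlmostCoboundary fun m => ∑ i ∈ s, u i m := by
  classical
  induction s using Finset.induction_on with
  | empty => simpa using AlmostCoboundary.zero
  | insert a s ha ih =>
    simp only [Finset.sum_insert ha]
    exact (hu a (by simp)).add (ih fun i hi => hu i (by simp [hi]))

theorem AlmostCoboundary.of_coboundary {h : ℕ → ℂ} (hb : ∃ C, ∀ n, ‖h n‖ ≤ C) :
    AlmostCoboundary fun m => h (m + 1) - h m := fun ε hε =>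
  ⟨h, hb, Eventually.of_forall fun M => by simp; positivity⟩

/-! ### Sums along regular counters -/

/-- The adjunction says that `τ m` is the first time at which `κ` has reached `m`, so consecutive
values of `τ` delimit the level sets of `κ`. -/
theorem GaloisConnection.eq_of_mem_Ico {τ κ : ℕ → ℕ} (hg : GaloisConnection τ κ) {m n : ℕ}
    (hn : n ∈ Finset.Ico (τ m) (τ (m + 1))) : κ n = m := by
  rw [Finset.mem_Ico] at hn
  have h1 := (hg m n).1 hn.1
  have h2 := (hg (m + 1) n).not.1 (by omega)
  omega

theorem GaloisConnection.sum_range {E : Type*} [AddCommMonoid E] {τ κ : ℕ → ℕ}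
    (hg : GaloisConnection τ κ) (G : ℕ → E) (M : ℕ) :
    ∑ n ∈ Finset.range (τ M), G n =
      ∑ m ∈ Finset.range M, ∑ n ∈ Finset.Ico (τ m) (τ (m + 1)), G n := by
  have h0 : τ 0 = 0 := Nat.le_zero.1 ((hg 0 0).2 (Nat.zero_le _))
  induction M with
  | zero => simp [h0]
  | succ M ih =>
    rw [Finset.sum_range_succ, ← ih, Finset.sum_range_add_sum_Ico _ (hg.monotone_l M.le_succ)]

theorem GaloisConnection.tendsto_atTop {τ κ : ℕ → ℕ} (hg : GaloisConnection τ κ) :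
    Tendsto κ atTop atTop :=
  Filter.tendsto_atTop.2 fun m => (eventually_ge_atTop (τ m)).mono fun n hn => (hg m n).1 hn

/-- Summation by parts: the increments pass from `h`, of which only boundedness is known, to the
weight `w`. -/
theorem norm_sum_mul_increment_le {h w : ℕ → ℂ} {H : ℝ} (hH : ∀ n, ‖h n‖ ≤ H) (M : ℕ) :
    ‖∑ m ∈ Finset.range M, w m * (h (m + 1) - h m)‖ ≤
      H * (‖w M‖ + ‖w 0‖ + ∑ m ∈ Finset.range M, ‖w (m + 1) - w m‖) := by
  have key : ∑ m ∈ Finset.range M, w m * (h (m + 1) - h m) =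
      w M * h M - w 0 * h 0 - ∑ m ∈ Finset.range M, h (m + 1) * (w (m + 1) - w m) := by
    induction M with
    | zero => simp
    | succ M ih => rw [Finset.sum_range_succ, Finset.sum_range_succ, ih]; ring
  rw [key]
  have h3 : ‖∑ m ∈ Finset.range M, h (m + 1) * (w (m + 1) - w m)‖ ≤
      H * ∑ m ∈ Finset.range M, ‖w (m + 1) - w m‖ := by
    rw [Finset.mul_sum]
    refine norm_sum_le_of_le _ fun m _ => ?_
    rw [norm_mul]
    exact mul_le_mul_of_nonneg_right (hH _) (norm_nonneg _)
  have h1 : ‖w M * h M‖ ≤ H * ‖w M‖ := by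
    rw [norm_mul, mul_comm]; exact mul_le_mul_of_nonneg_right (hH _) (norm_nonneg _)
  have h2 : ‖w 0 * h 0‖ ≤ H * ‖w 0‖ := by
    rw [norm_mul, mul_comm]; exact mul_le_mul_of_nonneg_right (hH _) (norm_nonneg _)
  have h4 := norm_sub_le (w M * h M - w 0 * h 0)
    (∑ m ∈ Finset.range M, h (m + 1) * (w (m + 1) - w m))
  have h5 := norm_sub_le (w M * h M) (w 0 * h 0)
  linarith

/-- On each level set `b` is frozen at its first value, which costs `2 * H * K` times the variation
of `b`. What remains is a sum of increments of `h` with weights (length of the level set) times `b`.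
Summing by parts leaves the variation of these weights, which splits into second differences of `τ`
and one more `H * K` times the variation of `b`. -/
theorem norm_sum_coboundary_le {τ κ : ℕ → ℕ} (hg : GaloisConnection τ κ) {h b : ℕ → ℂ}
    {H B K : ℝ} (hH : ∀ n, ‖h n‖ ≤ H) (hB : ∀ n, ‖b n‖ ≤ B) {M : ℕ}
    (hK : ∀ m ≤ M, (τ (m + 1) : ℝ) - τ m ≤ K) :
    ‖∑ n ∈ Finset.range (τ M), (h (κ n + 1) - h (κ n)) * b n‖ ≤
      3 * H * K * totalVar b (τ M) + H * B * (2 * K +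
        ∑ m ∈ Finset.range M, |((τ (m + 2) : ℝ) - τ (m + 1)) - (τ (m + 1) - τ m)|) := by
  have hH0 : 0 ≤ H := (norm_nonneg _).trans (hH 0)
  have hB0 : 0 ≤ B := (norm_nonneg _).trans (hB 0)
  have hτ : Monotone τ := hg.monotone_l
  have hc0 : ∀ m, (0 : ℝ) ≤ (τ (m + 1) : ℝ) - τ m := fun m =>
    sub_nonneg.2 (by exact_mod_cast hτ m.le_succ)
  have hV0 : ∀ m, 0 ≤ totalVar b (τ (m + 1)) - totalVar b (τ m) := fun m =>
    sub_nonneg.2 (totalVar_mono b (hτ m.le_succ))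
  have h0 : τ 0 = 0 := Nat.le_zero.1 ((hg 0 0).2 (Nat.zero_le _))
  have hVsum : ∑ m ∈ Finset.range M, (totalVar b (τ (m + 1)) - totalVar b (τ m)) =
      totalVar b (τ M) := by
    rw [Finset.sum_range_sub (fun m => totalVar b (τ m)), h0]; simp [totalVar]
  set w : ℕ → ℂ := fun m => ((τ (m + 1) : ℂ) - τ m) * b (τ m) with hw
  have hcn : ∀ m, ‖(τ (m + 1) : ℂ) - τ m‖ = (τ (m + 1) : ℝ) - τ m := fun m => by
    have : (τ (m + 1) : ℂ) - τ m = (((τ (m + 1) : ℝ) - τ m : ℝ) : ℂ) := by push_cast; rfl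
    rw [this, Complex.norm_real, Real.norm_of_nonneg (hc0 m)]
  have hwn : ∀ m ≤ M, ‖w m‖ ≤ K * B := fun m hm => by
    simp only [hw, norm_mul, hcn]
    exact mul_le_mul (hK m hm) (hB _) (norm_nonneg _) ((hc0 m).trans (hK m hm))
  have hblock : ∀ m < M, ‖∑ n ∈ Finset.Ico (τ m) (τ (m + 1)), (h (κ n + 1) - h (κ n)) * b n -
      w m * (h (m + 1) - h m)‖ ≤
        2 * H * K * (totalVar b (τ (m + 1)) - totalVar b (τ m)) := by
    intro m hm
    have e : w m * (h (m + 1) - h m) =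
        ∑ n ∈ Finset.Ico (τ m) (τ (m + 1)), (h (m + 1) - h m) * b (τ m) := by
      rw [Finset.sum_const, Nat.card_Ico, nsmul_eq_mul, Nat.cast_sub (hτ m.le_succ)]
      ring
    rw [e, ← Finset.sum_sub_distrib]
    calc _ ≤ ∑ n ∈ Finset.Ico (τ m) (τ (m + 1)),
          2 * H * (totalVar b (τ (m + 1)) - totalVar b (τ m)) := by
          refine norm_sum_le_of_le _ fun n hn => ?_
          have hn' := Finset.mem_Ico.1 hn
          rw [hg.eq_of_mem_Ico hn, ← mul_sub, norm_mul]
          refine mul_le_mul ?_ ?_ (norm_nonneg _) (by positivity)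
          · calc _ ≤ ‖h (m + 1)‖ + ‖h m‖ := norm_sub_le _ _
              _ ≤ 2 * H := by linarith [hH (m + 1), hH m]
          · have := norm_sub_le_totalVar b hn'.1
            have := totalVar_mono b hn'.2.le
            linarith
      _ = 2 * H * ((τ (m + 1) : ℝ) - τ m) * (totalVar b (τ (m + 1)) - totalVar b (τ m)) := by
          rw [Finset.sum_const, Nat.card_Ico, nsmul_eq_mul, Nat.cast_sub (hτ m.le_succ)]
          ring
      _ ≤ _ := by
          gcongr
          · exact hV0 m
          · exact hK m hm.le
  have hdw : ∀ m < M, ‖w (m + 1) - w m‖ ≤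
      |((τ (m + 2) : ℝ) - τ (m + 1)) - (τ (m + 1) - τ m)| * B +
        K * (totalVar b (τ (m + 1)) - totalVar b (τ m)) := by
    intro m hm
    have e : w (m + 1) - w m =
        ((((τ (m + 2) : ℝ) - τ (m + 1)) - (τ (m + 1) - τ m) : ℝ) : ℂ) * b (τ (m + 1)) +
        ((τ (m + 1) : ℂ) - τ m) * (b (τ (m + 1)) - b (τ m)) := by
      simp only [hw]; push_cast; ring
    rw [e]
    refine (norm_add_le _ _).trans (add_le_add ?_ ?_)
    · rw [norm_mul, Complex.norm_real, Real.norm_eq_abs]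
      exact mul_le_mul_of_nonneg_left (hB _) (abs_nonneg _)
    · rw [norm_mul, hcn]
      exact mul_le_mul (hK m hm.le) (norm_sub_le_totalVar b (hτ m.le_succ)) (norm_nonneg _)
        ((hc0 m).trans (hK m hm.le))
  have habel := norm_sum_mul_increment_le (w := w) hH M
  have hsum : ∑ m ∈ Finset.range M, ‖w (m + 1) - w m‖ ≤
      (∑ m ∈ Finset.range M, |((τ (m + 2) : ℝ) - τ (m + 1)) - (τ (m + 1) - τ m)|) * B +
        K * totalVar b (τ M) := by
    rw [← hVsum, Finset.sum_mul, Finset.mul_sum, ← Finset.sum_add_distrib]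
    exact Finset.sum_le_sum fun m hm => hdw m (Finset.mem_range.1 hm)
  have hdiff : ‖∑ n ∈ Finset.range (τ M), (h (κ n + 1) - h (κ n)) * b n -
      ∑ m ∈ Finset.range M, w m * (h (m + 1) - h m)‖ ≤ 2 * H * K * totalVar b (τ M) := by
    rw [hg.sum_range, ← Finset.sum_sub_distrib, ← hVsum, Finset.mul_sum]
    exact norm_sum_le_of_le _ fun m hm => hblock m (Finset.mem_range.1 hm)
  have h6 := norm_add_le (∑ n ∈ Finset.range (τ M), (h (κ n + 1) - h (κ n)) * b n -
      ∑ m ∈ Finset.range M, w m * (h (m + 1) - h m))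
      (∑ m ∈ Finset.range M, w m * (h (m + 1) - h m))
  rw [sub_add_cancel] at h6
  have h7 : H * (‖w M‖ + ‖w 0‖ + ∑ m ∈ Finset.range M, ‖w (m + 1) - w m‖) ≤
      H * (K * B + K * B + ((∑ m ∈ Finset.range M,
        |((τ (m + 2) : ℝ) - τ (m + 1)) - (τ (m + 1) - τ m)|) * B + K * totalVar b (τ M))) := by
    gcongr
    · exact hwn M le_rfl
    · exact hwn 0 (Nat.zero_le _)
  linarith

theorem GaloisConnection.le_and_lt {τ κ : ℕ → ℕ} (hg : GaloisConnection τ κ) (N : ℕ) :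
    τ (κ N) ≤ N ∧ N < τ (κ N + 1) :=
  ⟨(hg _ _).2 le_rfl, lt_of_not_ge fun h => by have := (hg _ _).1 h; omega⟩

/-- Apply the previous estimate with `M = κ N` and `K = D * N / κ N`. The variation term is `O(N / κ
N) * o(κ N)`, the second differences sum to `o(N)` by regularity, and `K` itself is `o(N)` because
`κ` tends to infinity. -/
theorem isLittleO_sum_coboundary_comp {κ : ℕ → ℕ} (hκ : RegularCounter κ) {h b : ℕ → ℂ}
    (hh : ∃ H, ∀ n, ‖h n‖ ≤ H) (hb : ∃ B, ∀ n, ‖b n‖ ≤ B)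
    (hv : totalVar b =o[atTop] fun N => (κ N : ℝ)) :
    (fun N => ∑ n ∈ Finset.range N, (h (κ n + 1) - h (κ n)) * b n) =o[atTop]
      fun N : ℕ => (N : ℝ) := by
  obtain ⟨τ, hg, hreg, C, hC⟩ := hκ
  obtain ⟨H, hH⟩ := hh
  obtain ⟨B, hB⟩ := hb
  have hH0 : 0 ≤ H := (norm_nonneg _).trans (hH 0)
  have hB0 : 0 ≤ B := (norm_nonneg _).trans (hB 0)
  have hκt := hg.tendsto_atTop
  set D : ℝ := |C| + 1
  have hD : 0 < D := by positivity
  have hC' : ∀ᶠ M in atTop, ∀ m ≤ M, ((τ (m + 1) : ℝ) - τ m) * M ≤ D * τ M := by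
    filter_upwards [hC] with M hM m hm
    refine (hM m hm).trans ?_
    gcongr
    linarith [le_abs_self C]
  rw [isLittleO_natCast_iff]
  intro ε hε
  -- The denominator adds up the coefficients of `η * N` in the final estimates; the `1` keeps it
  -- positive.
  set η : ℝ := ε / (3 * H * D + H * B + 4 * H * B * D + H * B + 1) with hη
  have hη0 : 0 < η := by positivity
  obtain ⟨m₀, hm₀⟩ := eventually_atTop.1 (hreg η hη0)
  -- The levels below `m₀`, where regularity is not yet available, contribute a constant, absorbed
  -- for large `N`.
  set R : ℝ := ∑ m ∈ Finset.range m₀, |((τ (m + 2) : ℝ) - τ (m + 1)) - (τ (m + 1) - τ m)|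
  have hτ : Monotone τ := hg.monotone_l
  have hc0 : ∀ m, (0 : ℝ) ≤ (τ (m + 1) : ℝ) - τ m := fun m =>
    sub_nonneg.2 (by exact_mod_cast hτ m.le_succ)
  have hsum : ∀ M, ∑ m ∈ Finset.range M, |((τ (m + 2) : ℝ) - τ (m + 1)) - (τ (m + 1) - τ m)| ≤
      R + η * τ M := by
    intro M
    have : ∑ m ∈ Finset.range M, |((τ (m + 2) : ℝ) - τ (m + 1)) - (τ (m + 1) - τ m)| ≤
        ∑ m ∈ Finset.range M, ((if m < m₀ then
          |((τ (m + 2) : ℝ) - τ (m + 1)) - (τ (m + 1) - τ m)| else 0) +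
          η * (τ (m + 1) - τ m)) := by
      refine Finset.sum_le_sum fun m _ => ?_
      split_ifs with hm
      · have := mul_nonneg hη0.le (hc0 m); linarith
      · simpa using hm₀ m (not_lt.1 hm)
    refine this.trans ?_
    rw [Finset.sum_add_distrib, ← Finset.mul_sum, Finset.sum_range_sub (fun m => (τ m : ℝ))]
    refine add_le_add ?_ ?_
    · rw [← Finset.sum_filter]
      refine Finset.sum_le_sum_of_subset_of_nonneg (fun m hm => ?_) fun _ _ _ => abs_nonneg _
      exact Finset.mem_range.2 (Finset.mem_filter.1 hm).2
    · have : (0 : ℝ) ≤ τ 0 := Nat.cast_nonneg _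
      nlinarith
  filter_upwards [hκt.eventually hC', hκt.eventually (eventually_ge_atTop 1),
    Asymptotics.isLittleO_iff.1 hv hη0,
    (tendsto_natCast_atTop_atTop (R := ℝ)).eventually_ge_atTop (R / η),
    ((tendsto_natCast_atTop_atTop (R := ℝ)).comp hκt).eventually_ge_atTop (1 / η)]
    with N h1 h2 h3 h4 h5
  obtain ⟨hN1, hN2⟩ := hg.le_and_lt N
  set M := κ N
  have hM0 : (0 : ℝ) < M := by exact_mod_cast h2
  have hN0 : (0 : ℝ) ≤ N := Nat.cast_nonneg _
  have hNτ : (τ M : ℝ) ≤ N := by exact_mod_cast hN1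
  have hKM : D * N / M * M = D * N := by field_simp
  have hK : ∀ m ≤ M, (τ (m + 1) : ℝ) - τ m ≤ D * N / M := fun m hm => by
    rw [le_div_iff₀ hM0]
    exact (h1 m hm).trans (by gcongr)
  have hV : totalVar b (τ M) ≤ η * M := by
    have := totalVar_mono b hN1
    rw [Real.norm_of_nonneg (totalVar_nonneg _ _), Real.norm_of_nonneg hM0.le] at h3
    exact this.trans h3
  have hKη : D * N / M ≤ η * (D * N) := by
    rw [div_le_iff₀ hM0]
    have : 1 ≤ η * M := by
      have := mul_le_mul_of_nonneg_left h5 hη0.le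
      simpa [mul_div_cancel₀ _ hη0.ne', hη0.ne'] using this
    nlinarith [mul_nonneg hD.le hN0]
  have hR : R ≤ η * N := by rwa [div_le_iff₀ hη0, mul_comm] at h4
  have hA := norm_sum_coboundary_le hg hH hB hK
  -- The level set containing `N` is incomplete; it is no longer than one level, hence negligible.
  have htail : ‖∑ n ∈ Finset.Ico (τ M) N, (h (κ n + 1) - h (κ n)) * b n‖ ≤
      2 * H * B * (D * N / M) := by
    calc _ ≤ ∑ n ∈ Finset.Ico (τ M) N, 2 * H * B := by
          refine norm_sum_le_of_le _ fun n _ => ?_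
          rw [norm_mul]
          refine mul_le_mul ?_ (hB n) (norm_nonneg _) (by positivity)
          calc _ ≤ ‖h (κ n + 1)‖ + ‖h (κ n)‖ := norm_sub_le _ _
            _ ≤ 2 * H := by linarith [hH (κ n + 1), hH (κ n)]
      _ = 2 * H * B * ((N : ℝ) - τ M) := by
          rw [Finset.sum_const, Nat.card_Ico, nsmul_eq_mul, Nat.cast_sub hN1]
          ring
      _ ≤ _ := by
          gcongr
          refine le_trans ?_ (hK M le_rfl)
          have : (N : ℝ) ≤ τ (M + 1) := by exact_mod_cast hN2.le
          linarith
  rw [← Finset.sum_range_add_sum_Ico _ hN1]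
  refine (norm_add_le _ _).trans ?_
  have hfirst : 3 * H * (D * N / M) * totalVar b (τ M) ≤ 3 * H * D * η * N := by
    calc _ ≤ 3 * H * (D * N / M) * (η * M) := by gcongr
      _ = 3 * H * η * (D * N / M * M) := by ring
      _ = _ := by rw [hKM]; ring
  have hsecond : H * B * (2 * (D * N / M) +
      ∑ m ∈ Finset.range M, |((τ (m + 2) : ℝ) - τ (m + 1)) - (τ (m + 1) - τ m)|) ≤
      H * B * (2 * (η * (D * N)) + (η * N + η * N)) := by
    gcongr
    refine (hsum M).trans (add_le_add hR ?_)
    gcongr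
  have hthird : 2 * H * B * (D * N / M) ≤ 2 * H * B * (η * (D * N)) := by gcongr
  have hε' : ε = η * (3 * H * D + H * B + 4 * H * B * D + H * B + 1) := by
    rw [hη]; field_simp
  have : 0 ≤ η * N := by positivity
  rw [hε']
  nlinarith

theorem sum_comp_le {κ τ : ℕ → ℕ} (hg : GaloisConnection τ κ) {e : ℕ → ℝ} (he : ∀ n, 0 ≤ e n)
    {M : ℕ} {K : ℝ} (hK : ∀ m ≤ M, (τ (m + 1) : ℝ) - τ m ≤ K) :
    ∑ n ∈ Finset.range (τ M), e (κ n) ≤ K * ∑ m ∈ Finset.range M, e m := by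
  rw [hg.sum_range, Finset.mul_sum]
  refine Finset.sum_le_sum fun m hm => ?_
  calc _ = ∑ n ∈ Finset.Ico (τ m) (τ (m + 1)), e m :=
        Finset.sum_congr rfl fun n hn => by rw [hg.eq_of_mem_Ico hn]
    _ = ((τ (m + 1) : ℝ) - τ m) * e m := by
        rw [Finset.sum_const, Nat.card_Ico, nsmul_eq_mul,
          Nat.cast_sub (hg.monotone_l m.le_succ)]
    _ ≤ _ := mul_le_mul_of_nonneg_right (hK m (Finset.mem_range.1 hm).le) (he m)

/-- Almost coboundaries along regular counters average to zero against slow sequences. -/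
theorem AlmostCoboundary.slowLimit_comp {u : ℕ → ℂ} (hu : AlmostCoboundary u) {κ : ℕ → ℕ}
    (hκ : RegularCounter κ) (L : ℂ) :
    SlowLimit (fun n => u (κ n) + L) L fun N => (κ N : ℝ) := by
  intro b hb hv
  simp only [add_sub_cancel_right]
  rw [isLittleO_natCast_iff]
  intro ε hε
  have hκ' := hκ
  obtain ⟨τ, hg, -, C, hC⟩ := hκ
  obtain ⟨B, hB⟩ := hb
  have hB0 : 0 ≤ B := (norm_nonneg _).trans (hB 0)
  set D : ℝ := |C| + 1
  have hD : 0 < D := by positivity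
  set η : ℝ := ε / (2 * (2 * D * B + 1)) with hη
  have hη0 : 0 < η := by positivity
  obtain ⟨h, hh, hM⟩ := hu η hη0
  have hco := isLittleO_natCast_iff.1
    (isLittleO_sum_coboundary_comp hκ' hh ⟨B, hB⟩ hv) (ε / 2) (half_pos hε)
  -- The error terms are nonnegative, so the last level set may be completed: the sum runs up to `τ
  -- (M + 1)` with `M = κ N`.
  have hκt := (tendsto_add_atTop_nat 1).comp hg.tendsto_atTop
  filter_upwards [hco, hκt.eventually hC, hκt.eventually hM,
    ((tendsto_natCast_atTop_atTop (R := ℝ)).comp hg.tendsto_atTop).eventually_ge_atTop (2 * D)]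
    with N h1 h2 h3 h4
  obtain ⟨hN1, hN2⟩ := hg.le_and_lt N
  set M := κ N
  simp only [Function.comp_apply, Nat.cast_add, Nat.cast_one] at h2 h3 h4
  change ∀ m ≤ M + 1, ((τ (m + 1) : ℝ) - τ m) * (M + 1) ≤ C * τ (M + 1) at h2
  have hM1 : (0 : ℝ) < (M : ℝ) + 1 := by positivity
  have h2' : ∀ m ≤ M + 1, ((τ (m + 1) : ℝ) - τ m) ≤ D * τ (M + 1) / (M + 1) := fun m hm => by
    rw [le_div_iff₀ hM1]
    refine (h2 m hm).trans ?_
    gcongr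
    linarith [le_abs_self C]
  -- The last level has length at most `D / (M + 1)` times `τ (M + 1)`, hence at most half of it
  -- since `M ≥ 2 * D`.
  have hτ2 : (τ (M + 1) : ℝ) ≤ 2 * N := by
    have := h2' M M.le_succ
    rw [le_div_iff₀ hM1] at this
    have h5 : (τ M : ℝ) ≤ N := by exact_mod_cast hN1
    have h6 : (0 : ℝ) ≤ τ (M + 1) := Nat.cast_nonneg _
    nlinarith
  have hE : ‖∑ n ∈ Finset.range N, (u (κ n) - (h (κ n + 1) - h (κ n))) * b n‖ ≤
      ε / 2 * N := by
    calc _ ≤ ∑ n ∈ Finset.range N, ‖u (κ n) - (h (κ n + 1) - h (κ n))‖ * B := by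
          refine norm_sum_le_of_le _ fun n _ => ?_
          rw [norm_mul]
          exact mul_le_mul_of_nonneg_left (hB n) (norm_nonneg _)
      _ ≤ ∑ n ∈ Finset.range (τ (M + 1)), ‖u (κ n) - (h (κ n + 1) - h (κ n))‖ * B :=
          Finset.sum_le_sum_of_subset_of_nonneg (Finset.range_mono hN2.le)
            fun _ _ _ => by positivity
      _ ≤ (D * τ (M + 1) / (M + 1) *
            ∑ m ∈ Finset.range (M + 1), ‖u m - (h (m + 1) - h m)‖) * B := by
          rw [← Finset.sum_mul]
          exact mul_le_mul_of_nonneg_right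
            (sum_comp_le hg (e := fun m => ‖u m - (h (m + 1) - h m)‖)
              (fun _ => norm_nonneg _) h2') hB0
      _ ≤ (D * (2 * N) / (M + 1) * (η * (M + 1))) * B := by gcongr
      _ = η * (2 * D * B) * N := by field_simp
      _ ≤ η * (2 * D * B + 1) * N := by gcongr; linarith
      _ = ε / 2 * N := by rw [hη]; field_simp
  have e : ∑ n ∈ Finset.range N, u (κ n) * b n =
      ∑ n ∈ Finset.range N, (u (κ n) - (h (κ n + 1) - h (κ n))) * b n +
      ∑ n ∈ Finset.range N, (h (κ n + 1) - h (κ n)) * b n := by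
    rw [← Finset.sum_add_distrib]
    exact Finset.sum_congr rfl fun n _ => by ring
  rw [e]
  refine (norm_add_le _ _).trans ?_
  linarith

theorem regularCounter_id : RegularCounter id :=
  ⟨id, GaloisConnection.id, fun ε hε => Eventually.of_forall fun m => by
    simp only [id]; push_cast; ring_nf; simpa using hε.le, 1, Eventually.of_forall fun M m _ => by
    simp⟩

theorem AlmostCoboundary.slowLimit {u : ℕ → ℂ} {L : ℂ} (hu : AlmostCoboundary fun n => u n - L) :
    SlowLimit u L fun N => (N : ℝ) := by
  simpa using hu.slowLimit_comp regularCounter_id L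

/-- Grouping terms into blocks of bounded length preserves almost coboundaries. -/
theorem AlmostCoboundary.of_blocks {τ κ : ℕ → ℕ} (hg : GaloisConnection τ κ) {u : ℕ → ℂ}
    (hu : ∃ C, ∀ n, ‖u n‖ ≤ C) {c A : ℕ} (hc : ∀ m, τ (m + 1) ≤ τ m + c)
    (hA : ∀ᶠ N in atTop, κ N ≤ A * N)
    (hV : AlmostCoboundary fun m => ∑ n ∈ Finset.Ico (τ m) (τ (m + 1)), u n) :
    AlmostCoboundary u := by
  intro ε hε
  obtain ⟨C, hC⟩ := hu
  have hC0 : 0 ≤ C := (norm_nonneg _).trans (hC 0)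
  obtain ⟨h, ⟨H, hH⟩, hM⟩ := hV (ε / (A + 1)) (by positivity)
  set e : ℕ → ℂ := fun m => ∑ n ∈ Finset.Ico (τ m) (τ (m + 1)), u n - (h (m + 1) - h m) with he
  -- The transfer function is the partial sum of `u` corrected by the errors of the completed
  -- blocks. It equals an incomplete block plus `h (κ n) - h 0`, hence is bounded, and its
  -- increments miss `u n` only by the errors of the blocks completed at step `n`.
  refine ⟨fun n => ∑ j ∈ Finset.range n, u j - ∑ m ∈ Finset.range (κ n), e m,
    ⟨c * C + 2 * H, fun n => ?_⟩, ?_⟩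
  · obtain ⟨h1, h2⟩ := hg.le_and_lt n
    have e1 : ∑ j ∈ Finset.range n, u j - ∑ m ∈ Finset.range (κ n), e m =
        ∑ j ∈ Finset.Ico (τ (κ n)) n, u j + (h (κ n) - h 0) := by
      rw [← Finset.sum_range_add_sum_Ico _ h1, hg.sum_range]
      simp only [he, Finset.sum_sub_distrib]
      rw [← Finset.sum_sub_distrib (s := Finset.range (κ n)) (f := fun m => h (m + 1)),
        Finset.sum_range_sub]
      ring
    beta_reduce
    rw [e1]
    have h3 : ‖∑ j ∈ Finset.Ico (τ (κ n)) n, u j‖ ≤ c * C := by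
      calc _ ≤ ∑ j ∈ Finset.Ico (τ (κ n)) n, C := norm_sum_le_of_le _ fun j _ => hC j
        _ = ((n - τ (κ n) : ℕ) : ℝ) * C := by simp
        _ ≤ _ := by
          gcongr
          have := hc (κ n)
          omega
    have h4 := norm_sub_le (h (κ n)) (h 0)
    have := norm_add_le (∑ j ∈ Finset.Ico (τ (κ n)) n, u j) (h (κ n) - h 0)
    linarith [hH (κ n), hH 0]
  · have hκ : Monotone κ := hg.monotone_u
    have hκt := hg.tendsto_atTop
    filter_upwards [hA, hκt.eventually hM] with N h1 h2
    have e2 : ∀ n, u n - (∑ j ∈ Finset.range (n + 1), u j - ∑ m ∈ Finset.range (κ (n + 1)), e m -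
        (∑ j ∈ Finset.range n, u j - ∑ m ∈ Finset.range (κ n), e m)) =
        ∑ m ∈ Finset.Ico (κ n) (κ (n + 1)), e m := by
      intro n
      rw [Finset.sum_range_succ, ← Finset.sum_range_add_sum_Ico e (hκ n.le_succ)]
      ring
    simp only [e2]
    have h3 : ∀ N, ∑ n ∈ Finset.range N, ‖∑ m ∈ Finset.Ico (κ n) (κ (n + 1)), e m‖ ≤
        ∑ m ∈ Finset.range (κ N), ‖e m‖ := by
      intro N
      induction N with
      | zero => simpa using Finset.sum_nonneg fun _ _ => norm_nonneg _
      | succ N ih =>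
        rw [Finset.sum_range_succ, ← Finset.sum_range_add_sum_Ico _ (hκ N.le_succ)]
        exact add_le_add ih (norm_sum_le _ _)
    refine (h3 N).trans (h2.trans ?_)
    calc ε / (A + 1) * (κ N : ℝ) ≤ ε / (A + 1) * (A * N) := by
          gcongr; exact_mod_cast h1
      _ ≤ ε / (A + 1) * ((A + 1) * N) := by gcongr; linarith
      _ = ε * N := by field_simp

/-! ### The maximal ergodic inequality -/

/-- The maximum of the first `n + 1` Birkhoff sums of `F`, starting with the empty one. -/
def birkhoffMax {X : Type*} (T : X → X) (F : X → ℝ) : ℕ → X → ℝ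
  | 0 => fun _ => 0
  | n + 1 => fun x => max 0 (F x + birkhoffMax T F n (T x))

section Maximal

variable {X : Type*} {T : X → X} {F : X → ℝ}

theorem birkhoffMax_nonneg (n : ℕ) (x : X) : 0 ≤ birkhoffMax T F n x := by
  cases n with
  | zero => exact le_rfl
  | succ n => exact le_max_left _ _

theorem birkhoffMax_le_succ (n : ℕ) : ∀ x, birkhoffMax T F n x ≤ birkhoffMax T F (n + 1) x := by
  induction n with
  | zero => exact fun x => birkhoffMax_nonneg 1 x
  | succ n ih => exact fun x => max_le_max le_rfl (add_le_add le_rfl (ih _))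

theorem sum_le_birkhoffMax (n : ℕ) : ∀ x,
    ∑ m ∈ Finset.range n, F (T^[m] x) ≤ birkhoffMax T F n x := by
  induction n with
  | zero => exact fun x => by simp [birkhoffMax]
  | succ n ih =>
    intro x
    rw [Finset.sum_range_succ', add_comm]
    refine le_trans ?_ (le_max_right _ _)
    simpa using ih (T x)

variable [MeasurableSpace X] {μ : Measure X}

theorem integrable_birkhoffMax (hT : MeasurePreserving T μ μ) (hF : Integrable F μ) (n : ℕ) :
    Integrable (birkhoffMax T F n) μ := by
  induction n with
  | zero => exact integrable_zero _ _ _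
  | succ n ih =>
    exact (integrable_zero _ _ _).sup (hF.add (hT.integrable_comp_of_integrable ih))

/-- Garsia's argument: where the maximum is positive it is not the empty sum, so the recursion gives
`F ≥ max - max ∘ T` there, while elsewhere `max - max ∘ T ≤ 0`. The integral of `max - max ∘ T`
vanishes by invariance. -/
theorem integral_indicator_birkhoffMax_nonneg (hT : MeasurePreserving T μ μ)
    (hF : Integrable F μ) (n : ℕ) :
    0 ≤ ∫ x, {x | 0 < birkhoffMax T F n x}.indicator F x ∂μ := by
  have hM := integrable_birkhoffMax hT hF n
  have hE : NullMeasurableSet {x | 0 < birkhoffMax T F n x} μ :=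
    nullMeasurableSet_lt aemeasurable_const hM.aemeasurable
  have hMT : Integrable (fun x => birkhoffMax T F n (T x)) μ := hT.integrable_comp_of_integrable hM
  have h0 : ∫ x, (birkhoffMax T F n x - birkhoffMax T F n (T x)) ∂μ = 0 := by
    rw [integral_sub hM hMT, sub_eq_zero]
    have h1 := integral_map (μ := μ) hT.measurable.aemeasurable
      (f := birkhoffMax T F n) (by rw [hT.map_eq]; exact hM.aestronglyMeasurable)
    rw [hT.map_eq] at h1
    exact h1
  refine h0.ge.trans ?_
  refine integral_mono (hM.sub hMT) (hF.indicator₀ hE) fun x => ?_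
  change birkhoffMax T F n x - birkhoffMax T F n (T x) ≤ _
  by_cases hx : 0 < birkhoffMax T F n x
  · rw [Set.indicator_of_mem (by exact hx)]
    cases n with
    | zero => exact absurd hx (lt_irrefl _)
    | succ n =>
      have h2 : birkhoffMax T F (n + 1) x = F x + birkhoffMax T F n (T x) := by
        rcases max_choice 0 (F x + birkhoffMax T F n (T x)) with h | h
        · exact absurd h (ne_of_gt hx)
        · exact h
      have := birkhoffMax_le_succ (T := T) (F := F) n (T x)
      linarith
  · rw [Set.indicator_of_notMem (by exact hx)]
    have := birkhoffMax_nonneg (T := T) (F := F) n (T x)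
    linarith

theorem measure_birkhoffMax_pos_le [IsFiniteMeasure μ] (hT : MeasurePreserving T μ μ) {g : X → ℝ}
    (hg : Integrable g μ) (hg0 : ∀ x, 0 ≤ g x) {α : ℝ} (hα : 0 < α) (n : ℕ) :
    μ {x | 0 < birkhoffMax T (fun x => g x - α) n x} ≤ ENNReal.ofReal ((∫ x, g x ∂μ) / α) := by
  have hF : Integrable (fun x => g x - α) μ := hg.sub (integrable_const _)
  have hE : NullMeasurableSet {x | 0 < birkhoffMax T (fun x => g x - α) n x} μ :=
    nullMeasurableSet_lt aemeasurable_const (integrable_birkhoffMax hT hF n).aemeasurable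
  have h1 := integral_indicator_birkhoffMax_nonneg hT hF n
  set E := {x | 0 < birkhoffMax T (fun x => g x - α) n x}
  have hI : Integrable (E.indicator fun _ => α) μ := (integrable_const _).indicator₀ hE
  have h2 : ∫ x, E.indicator (fun x => g x - α) x ∂μ ≤ ∫ x, (g x - E.indicator (fun _ => α) x) ∂μ := by
    refine integral_mono (hF.indicator₀ hE) (hg.sub hI) fun x => ?_
    by_cases hx : x ∈ E
    · simp [Set.indicator_of_mem hx]
    · simp [Set.indicator_of_notMem hx, hg0 x]
  have h3 : ∫ x, E.indicator (fun _ => α) x ∂μ = μ.real E * α := by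
    rw [integral_indicator₀ hE, setIntegral_const, smul_eq_mul]
  rw [integral_sub hg hI, h3] at h2
  rw [← ENNReal.ofReal_toReal (measure_ne_top μ E)]
  apply ENNReal.ofReal_le_ofReal
  rw [le_div_iff₀ hα]
  change μ.real E * α ≤ _
  linarith

/-- The maximal ergodic inequality. -/
theorem measure_exists_sum_gt_le [IsFiniteMeasure μ] (hT : MeasurePreserving T μ μ) {g : X → ℝ}
    (hg : Integrable g μ) (hg0 : ∀ x, 0 ≤ g x) {α : ℝ} (hα : 0 < α) :
    μ {x | ∃ M : ℕ, α * M < ∑ m ∈ Finset.range M, g (T^[m] x)} ≤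
      ENNReal.ofReal ((∫ x, g x ∂μ) / α) := by
  have hsub : {x | ∃ M : ℕ, α * M < ∑ m ∈ Finset.range M, g (T^[m] x)} ⊆
      ⋃ n, {x | 0 < birkhoffMax T (fun x => g x - α) n x} := by
    rintro x ⟨M, hM⟩
    refine Set.mem_iUnion.2 ⟨M, lt_of_lt_of_le ?_ (sum_le_birkhoffMax M x)⟩
    simp only [Finset.sum_sub_distrib, Finset.sum_const, Finset.card_range, nsmul_eq_mul]
    linarith
  refine (measure_mono hsub).trans ?_
  have hmono : Monotone fun n => {x | 0 < birkhoffMax T (fun x => g x - α) n x} :=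
    monotone_nat_of_le_succ fun n x hx => lt_of_lt_of_le hx (birkhoffMax_le_succ n x)
  rw [hmono.measure_iUnion]
  exact iSup_le fun n => measure_birkhoffMax_pos_le hT hg hg0 hα n

end Maximal

/-! ### The mean ergodic decomposition -/

section MeanErgodic

variable {X : Type*} [MeasurableSpace X] {μ : Measure X} {T : X → X}

/-- The Koopman operator twisted by `exp(-2πiθ)`. -/
def twistedKoopman (hT : MeasurePreserving T μ μ) (θ : ℝ) : Lp ℂ 2 μ →L[ℂ] Lp ℂ 2 μ :=
  Complex.exp (-(2 * Real.pi * Complex.I * θ)) •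
    (Lp.compMeasurePreservingₗᵢ ℂ T hT).toContinuousLinearMap

theorem norm_exp_neg_two_pi_I (θ : ℝ) : ‖Complex.exp (-(2 * Real.pi * Complex.I * θ))‖ = 1 := by
  have : -(2 * Real.pi * Complex.I * θ) = ((-(2 * Real.pi * θ) : ℝ) : ℂ) * Complex.I := by
    push_cast; ring
  rw [this, Complex.norm_exp_ofReal_mul_I]

theorem norm_twistedKoopman_apply (hT : MeasurePreserving T μ μ) (θ : ℝ) (g : Lp ℂ 2 μ) :
    ‖twistedKoopman hT θ g‖ = ‖g‖ := by
  change ‖Complex.exp (-(2 * Real.pi * Complex.I * θ)) • (Lp.compMeasurePreservingₗᵢ ℂ T hT g)‖ = _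
  rw [norm_smul, norm_exp_neg_two_pi_I, one_mul, LinearIsometry.norm_map]

theorem mem_koopmanEigenspace_iff (hT : MeasurePreserving T μ μ) (θ : ℝ) (g : Lp ℂ 2 μ) :
    g ∈ koopmanEigenspace hT θ ↔ twistedKoopman hT θ g = g := by
  unfold koopmanEigenspace
  rw [Module.End.mem_eigenspace_iff]
  change Lp.compMeasurePreservingₗᵢ ℂ T hT g = _ ↔
    Complex.exp (-(2 * Real.pi * Complex.I * θ)) • (Lp.compMeasurePreservingₗᵢ ℂ T hT g) = g
  rw [Complex.exp_neg, inv_smul_eq_iff₀ (Complex.exp_ne_zero _)]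

/-- A vector `x` orthogonal to the range of `U - 1` satisfies `⟪U x, x⟫ = ‖x‖²`; as `U` does not
increase norms, equality in Cauchy–Schwarz forces `U x = x`. -/
theorem koopmanEigenspace_orthogonal_le (hT : MeasurePreserving T μ μ) (θ : ℝ) :
    (koopmanEigenspace hT θ)ᗮ ≤
      (LinearMap.range ((twistedKoopman hT θ - 1 : Lp ℂ 2 μ →L[ℂ] Lp ℂ 2 μ) :
        Lp ℂ 2 μ →ₗ[ℂ] Lp ℂ 2 μ)).topologicalClosure := by
  rw [← Submodule.orthogonal_orthogonal_eq_closure]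
  refine Submodule.orthogonal_le fun x hx => ?_
  rw [mem_koopmanEigenspace_iff]
  refine eq_of_norm_le_re_inner_eq_norm_sq (𝕜 := ℂ) (norm_twistedKoopman_apply hT θ x).le ?_
  have h : inner ℂ (twistedKoopman hT θ x) x = inner ℂ x x := by
    rw [Submodule.mem_orthogonal] at hx
    have := hx _ ⟨x, rfl⟩
    simpa [inner_sub_left, sub_eq_zero] using this
  rw [h, inner_self_eq_norm_sq_to_K]
  norm_cast

theorem coeFn_twistedKoopman (hT : MeasurePreserving T μ μ) (θ : ℝ) (g : Lp ℂ 2 μ) :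
    twistedKoopman hT θ g =ᵐ[μ]
      fun x => Complex.exp (-(2 * Real.pi * Complex.I * θ)) * g (T x) := by
  change ⇑(Complex.exp (-(2 * Real.pi * Complex.I * θ)) •
    (Lp.compMeasurePreservingₗᵢ ℂ T hT g)) =ᵐ[μ] _
  filter_upwards [Lp.coeFn_smul (Complex.exp (-(2 * Real.pi * Complex.I * θ)))
    (Lp.compMeasurePreservingₗᵢ ℂ T hT g), Lp.coeFn_compMeasurePreserving g hT] with x h1 h2
  rw [h1, Pi.smul_apply, smul_eq_mul]
  congr 1

theorem ae_iterate_eigenfunction (hT : MeasurePreserving T μ μ) {θ : ℝ} {g : Lp ℂ 2 μ}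
    (hg : g ∈ koopmanEigenspace hT θ) : ∀ᵐ x ∂μ, ∀ m : ℕ,
      Complex.exp (-(2 * Real.pi * Complex.I * θ)) ^ m * g (T^[m] x) = g x := by
  have h1 : ∀ᵐ x ∂μ, Complex.exp (-(2 * Real.pi * Complex.I * θ)) * g (T x) = g x := by
    have := coeFn_twistedKoopman hT θ g
    rw [(mem_koopmanEigenspace_iff hT θ g).1 hg] at this
    exact this.mono fun x hx => hx.symm
  have h2 : ∀ᵐ x ∂μ, ∀ m : ℕ,
      Complex.exp (-(2 * Real.pi * Complex.I * θ)) * g (T (T^[m] x)) = g (T^[m] x) :=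
    ae_all_iff.2 fun m => (hT.iterate m).quasiMeasurePreserving.ae h1
  filter_upwards [h2] with x hx m
  induction m with
  | zero => simp
  | succ m ih =>
    rw [Function.iterate_succ_apply', pow_succ, mul_assoc, hx m, ih]

/-- The transfer function in `L²` is replaced by a simple function. It has to be bounded at every
point, since its values along single orbits serve as transfer sequences. -/
theorem exists_bounded_coboundary_approx [IsProbabilityMeasure μ] (hT : MeasurePreserving T μ μ)
    (θ : ℝ) {f : X → ℂ} (hf : MemLp f 2 μ) {ε : ℝ} (hε : 0 < ε) :
    ∃ h : X → ℂ, (∃ C, ∀ x, ‖h x‖ ≤ C) ∧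
      let e := fun x => f x - (koopmanEigenspace hT θ).starProjection (hf.toLp f) x -
        (Complex.exp (-(2 * Real.pi * Complex.I * θ)) * h (T x) - h x)
      Integrable e μ ∧ ∫ x, ‖e x‖ ∂μ ≤ ε := by
  set F := hf.toLp f
  set P := (koopmanEigenspace hT θ).starProjection F with hP
  have h1 : F - P ∈ (LinearMap.range ((twistedKoopman hT θ - 1 : Lp ℂ 2 μ →L[ℂ] Lp ℂ 2 μ) :
        Lp ℂ 2 μ →ₗ[ℂ] Lp ℂ 2 μ)).topologicalClosure :=
    koopmanEigenspace_orthogonal_le hT θ (Submodule.sub_starProjection_mem_orthogonal F)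
  obtain ⟨-, ⟨g, rfl⟩, hg⟩ := Metric.mem_closure_iff.1 h1 (ε / 2) (half_pos hε)
  rw [dist_eq_norm] at hg
  obtain ⟨s, hs, hsm⟩ := (Lp.memLp g).exists_simpleFunc_eLpNorm_sub_lt (by norm_num)
    (ε := ENNReal.ofReal (ε / 4)) (by simpa using (by positivity : 0 < ε / 4))
  set S := hsm.toLp s
  have hgS : ‖g - S‖ ≤ ε / 4 := by
    rw [Lp.norm_def]
    refine ENNReal.toReal_le_of_le_ofReal (by positivity) (le_trans (le_of_eq ?_) hs.le)
    refine eLpNorm_congr_ae ?_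
    filter_upwards [Lp.coeFn_sub g S, hsm.coeFn_toLp] with x h2 h3
    rw [h2, Pi.sub_apply, h3, Pi.sub_apply]
  obtain ⟨C, hC⟩ := s.exists_forall_norm_le
  refine ⟨s, ⟨C, hC⟩, ?_⟩
  intro e
  set E : Lp ℂ 2 μ := F - P - (twistedKoopman hT θ S - S) with hE
  have hEe : E =ᵐ[μ] e := by
    have hsT : ∀ᵐ x ∂μ, S (T x) = s (T x) := hT.quasiMeasurePreserving.ae hsm.coeFn_toLp
    filter_upwards [Lp.coeFn_sub (F - P) (twistedKoopman hT θ S - S), Lp.coeFn_sub F P,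
      Lp.coeFn_sub (twistedKoopman hT θ S) S, coeFn_twistedKoopman hT θ S, hf.coeFn_toLp,
      hsm.coeFn_toLp, hsT] with x a1 a2 a3 a4 a5 a6 a7
    rw [a1, Pi.sub_apply, a2, a3, Pi.sub_apply, Pi.sub_apply, a4, a5, a7, a6]
  have hnE : ‖E‖ ≤ ε := by
    have e1 : E = (F - P - (twistedKoopman hT θ g - g)) + (twistedKoopman hT θ (g - S) - (g - S)) := by
      rw [hE, map_sub]; abel
    rw [e1]
    have n1 := norm_add_le (F - P - (twistedKoopman hT θ g - g))
      (twistedKoopman hT θ (g - S) - (g - S))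
    have n2 := norm_sub_le (twistedKoopman hT θ (g - S)) (g - S)
    rw [norm_twistedKoopman_apply] at n2
    have n3 : ‖F - P - (twistedKoopman hT θ g - g)‖ < ε / 2 := hg
    linarith
  have hEi : Integrable E μ := (Lp.memLp E).integrable (by norm_num)
  refine ⟨hEi.congr hEe, ?_⟩
  have h4 : ∫ x, ‖e x‖ ∂μ = ∫ x, ‖E x‖ ∂μ :=
    integral_congr_ae (hEe.mono fun x hx => by simp only [hx])
  rw [h4, integral_norm_eq_lintegral_enorm hEi.aestronglyMeasurable, ← eLpNorm_one_eq_lintegral_enorm]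
  refine le_trans ?_ hnE
  rw [Lp.norm_def]
  exact ENNReal.toReal_mono (Lp.eLpNorm_ne_top E)
    (eLpNorm_le_eLpNorm_of_exponent_le (by norm_num) hEi.aestronglyMeasurable)

/-- Along almost every orbit, a twisted square-integrable observable differs from its projection to
the eigenspace by an almost coboundary. -/
theorem ae_almostCoboundary_orbit [IsProbabilityMeasure μ] (hT : MeasurePreserving T μ μ)
    (θ : ℝ) {f : X → ℂ} (hf : MemLp f 2 μ) :
    ∀ᵐ x ∂μ, AlmostCoboundary fun m =>
      Complex.exp (-(2 * Real.pi * Complex.I * θ)) ^ m * f (T^[m] x) -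
        (koopmanEigenspace hT θ).starProjection (hf.toLp f) x := by
  set lam := Complex.exp (-(2 * Real.pi * Complex.I * θ)) with hlam
  have hlam1 : ‖lam‖ = 1 := norm_exp_neg_two_pi_I θ
  set P := (koopmanEigenspace hT θ).starProjection (hf.toLp f)
  have hP := ae_iterate_eigenfunction hT
    (Submodule.starProjection_apply_mem (koopmanEigenspace hT θ) (hf.toLp f))
  -- For a fixed `ε` the bad set is shown to have measure at most `δ` for every `δ > 0`. The
  -- approximating `h` depends on `δ`, the bad set does not.
  have key : ∀ ε > 0, ∀ᵐ x ∂μ, ∃ h : ℕ → ℂ, (∃ C, ∀ n, ‖h n‖ ≤ C) ∧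
      ∀ M : ℕ, ∑ m ∈ Finset.range M, ‖lam ^ m * f (T^[m] x) - P x - (h (m + 1) - h m)‖ ≤
        ε * M := by
    intro ε hε
    rw [ae_iff]
    refine le_antisymm (le_of_forall_pos_le_add fun δ hδ => ?_) (zero_le)
    rw [zero_add]
    by_cases hδt : δ = ⊤
    · rw [hδt]; exact le_top
    have hδr : 0 < δ.toReal := ENNReal.toReal_pos hδ.ne' hδt
    -- An `L¹` error of `ε * δ` makes the bound of the maximal inequality at height `ε` equal to
    -- `δ`.
    obtain ⟨h, ⟨C, hC⟩, hei, he⟩ :=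
      exists_bounded_coboundary_approx hT θ hf (mul_pos hε hδr)
    set e := fun x => f x - P x - (lam * h (T x) - h x) with he_def
    have hmax := measure_exists_sum_gt_le hT hei.norm (fun x => norm_nonneg _) hε
    refine le_trans ?_ (hmax.trans ?_)
    · refine measure_mono_ae ?_
      filter_upwards [hP] with x hx hbad
      by_contra hgood
      refine hbad ⟨fun m => lam ^ m * h (T^[m] x), ⟨C, fun n => ?_⟩, fun M => ?_⟩
      · rw [norm_mul, norm_pow, hlam1, one_pow, one_mul]; exact hC _
      · have hg : ¬ ∃ M : ℕ, ε * M < ∑ m ∈ Finset.range M, ‖e (T^[m] x)‖ := hgood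
        push Not at hg
        refine le_trans (le_of_eq (Finset.sum_congr rfl fun m _ => ?_)) (hg M)
        -- The twist is compatible with the projection: `P x = lam ^ m * P (T^[m] x)`, so the whole
        -- error is `e` along the orbit times a number of modulus one.
        have : lam ^ m * f (T^[m] x) - P x -
            (lam ^ (m + 1) * h (T^[m + 1] x) - lam ^ m * h (T^[m] x)) =
            lam ^ m * e (T^[m] x) := by
          simp only [he_def]
          rw [Function.iterate_succ_apply']
          nth_rewrite 1 [← hx m]
          ring
        rw [this, norm_mul, norm_pow, hlam1, one_pow, one_mul]
    · rw [← ENNReal.ofReal_toReal hδt]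
      apply ENNReal.ofReal_le_ofReal
      rw [div_le_iff₀ hε, mul_comm]
      exact he
  have key' : ∀ᵐ x ∂μ, ∀ k : ℕ, ∃ h : ℕ → ℂ, (∃ C, ∀ n, ‖h n‖ ≤ C) ∧
      ∀ M : ℕ, ∑ m ∈ Finset.range M, ‖lam ^ m * f (T^[m] x) - P x - (h (m + 1) - h m)‖ ≤
        1 / ((k : ℝ) + 1) * M := ae_all_iff.2 fun k => key _ (by positivity)
  filter_upwards [key'] with x hx ε hε
  obtain ⟨k, hk⟩ := exists_nat_one_div_lt hε
  obtain ⟨h, hb, hM⟩ := hx k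
  exact ⟨h, hb, Eventually.of_forall fun M => (hM M).trans (by gcongr)⟩

/-! ### The conditional expectation on the invariant sets -/

/-- Almost everywhere invariance is upgraded to strict invariance: the limsup of a measurable
version along the orbit is unchanged by `T` at every point, and agrees almost everywhere with `g`.
-/
theorem aestronglyMeasurable_invariants_of_real {g : X → ℝ} (hT : MeasurePreserving T μ μ)
    (hg : AEMeasurable g μ) (h : ∀ᵐ x ∂μ, g (T x) = g x) :
    ∃ G : X → ℝ, Measurable[MeasurableSpace.invariants T] G ∧ g =ᵐ[μ] G := by
  refine ⟨fun x => limsup (fun n : ℕ => hg.mk g (T^[n] x)) atTop, ?_, ?_⟩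
  · rw [MeasurableSpace.measurable_invariants_dom]
    refine ⟨Measurable.limsup fun n => hg.measurable_mk.comp (hT.measurable.iterate n),
      fun s _ => ?_⟩
    congr 1
    ext x
    have := Filter.limsup_nat_add (fun n : ℕ => hg.mk g (T^[n] x)) 1
    simpa only [Function.comp_apply, Function.iterate_succ_apply] using this
  · have h2 : ∀ᵐ x ∂μ, ∀ n : ℕ, g (T (T^[n] x)) = g (T^[n] x) :=
      ae_all_iff.2 fun m => (hT.iterate m).quasiMeasurePreserving.ae h
    have h3 : ∀ᵐ x ∂μ, ∀ n : ℕ, g (T^[n] x) = hg.mk g (T^[n] x) :=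
      ae_all_iff.2 fun m => (hT.iterate m).quasiMeasurePreserving.ae hg.ae_eq_mk
    filter_upwards [h2, h3] with x hx hx'
    have h4 : ∀ n : ℕ, hg.mk g (T^[n] x) = g x := by
      intro n
      rw [← hx' n]
      induction n with
      | zero => rfl
      | succ n ih => rw [Function.iterate_succ_apply', hx n, ih]
    simp only [h4, limsup_const]

theorem aestronglyMeasurable_invariants {g : X → ℂ} (hT : MeasurePreserving T μ μ)
    (hg : AEStronglyMeasurable g μ) (h : ∀ᵐ x ∂μ, g (T x) = g x) :
    AEStronglyMeasurable[MeasurableSpace.invariants T] g μ := by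
  obtain ⟨G, hG, hGe⟩ := aestronglyMeasurable_invariants_of_real (g := fun x => (g x).re) hT
    (Complex.measurable_re.comp_aemeasurable hg.aemeasurable) (h.mono fun x hx => by rw [hx])
  obtain ⟨G', hG', hGe'⟩ := aestronglyMeasurable_invariants_of_real (g := fun x => (g x).im) hT
    (Complex.measurable_im.comp_aemeasurable hg.aemeasurable) (h.mono fun x hx => by rw [hx])
  refine ⟨fun x => (G x : ℂ) + G' x * Complex.I, ?_, ?_⟩
  · refine Measurable.stronglyMeasurable ?_
    exact (Complex.measurable_ofReal.comp hG).add
      ((Complex.measurable_ofReal.comp hG').mul_const _)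
  · filter_upwards [hGe, hGe'] with x h1 h2
    rw [← h1, ← h2, Complex.re_add_im]

/-- Indicators of invariant sets lie in the fixed space, so orthogonality of `f - P f` to them gives
the defining integrals of the conditional expectation. -/
theorem starProjection_zero_ae_eq_condExp [IsProbabilityMeasure μ] (hT : MeasurePreserving T μ μ)
    {f : X → ℂ} (hf : MemLp f 2 μ) :
    (koopmanEigenspace hT 0).starProjection (hf.toLp f) =ᵐ[μ]
      μ[f | MeasurableSpace.invariants T] := by
  set P := (koopmanEigenspace hT 0).starProjection (hf.toLp f) with hP
  have hPi : Integrable P μ := (Lp.memLp P).integrable (by norm_num)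
  refine ae_eq_condExp_of_forall_setIntegral_eq (MeasurableSpace.invariants_le T)
    (hf.integrable (by norm_num)) (fun s _ _ => hPi.integrableOn) (fun s hs hsμ => ?_) ?_
  · have hs' := (MeasurableSpace.measurableSet_invariants.1 hs)
    have hmem : indicatorConstLp 2 hs'.1 hsμ.ne (1 : ℂ) ∈ koopmanEigenspace hT 0 := by
      rw [mem_koopmanEigenspace_iff]
      refine Lp.ext ?_
      have h1 := (indicatorConstLp_coeFn (p := 2) (hs := hs'.1) (hμs := hsμ.ne) (c := (1 : ℂ)))
      filter_upwards [coeFn_twistedKoopman hT 0 (indicatorConstLp 2 hs'.1 hsμ.ne (1 : ℂ)), h1,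
        hT.quasiMeasurePreserving.ae h1] with x a1 a2 a3
      rw [a1, a2, a3]
      have : T x ∈ s ↔ x ∈ s := by
        conv_rhs => rw [← hs'.2]
        rfl
      by_cases hx : x ∈ s
      · simp [Set.indicator_of_mem hx, Set.indicator_of_mem (this.2 hx)]
      · simp [Set.indicator_of_notMem hx, Set.indicator_of_notMem (this.not.2 hx)]
    have horth := Submodule.sub_starProjection_mem_orthogonal (K := koopmanEigenspace hT 0)
      (hf.toLp f)
    rw [Submodule.mem_orthogonal] at horth
    have h2 := horth _ hmem
    rw [inner_sub_right, sub_eq_zero, L2.inner_indicatorConstLp_one,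
      L2.inner_indicatorConstLp_one] at h2
    rw [← hP] at h2
    rw [← h2]
    exact setIntegral_congr_ae hs'.1 (hf.coeFn_toLp.mono fun x hx _ => hx)
  · refine aestronglyMeasurable_invariants hT hPi.aestronglyMeasurable ?_
    have := ae_iterate_eigenfunction hT
      (Submodule.starProjection_apply_mem (koopmanEigenspace hT 0) (hf.toLp f))
    filter_upwards [this] with x hx
    simpa using hx 1

theorem ae_almostCoboundary_condExp [IsProbabilityMeasure μ] (hT : MeasurePreserving T μ μ)
    {f : X → ℂ} (hf : MemLp f 2 μ) :
    ∀ᵐ x ∂μ, AlmostCoboundary fun m =>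
      f (T^[m] x) - (μ[f | MeasurableSpace.invariants T]) x := by
  filter_upwards [ae_almostCoboundary_orbit hT 0 hf, starProjection_zero_ae_eq_condExp hT hf]
    with x h1 h2
  simpa [h2] using h1

end MeanErgodic

/-! ### Sublinear functions of regular growth -/

/-- Increasing functions to infinity of regular, sublinear growth. -/
def RegularGrowth (A : ℝ → ℝ) : Prop :=
  Tendsto A atTop atTop ∧ Tendsto (deriv A) atTop (𝓝 0) ∧
    ∃ x₀ K c : ℝ, 0 < x₀ ∧ 0 < c ∧ ∀ x > x₀, 0 < A x ∧ 0 < deriv A x ∧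
      DifferentiableAt ℝ (deriv A) x ∧ |deriv (deriv A) x| ≤ K * deriv A x / x ∧
      ∀ y ≥ x, c * A y / y ≤ deriv A x

theorem RegularGrowth.exists_strictMonoOn {A : ℝ → ℝ} (hA : RegularGrowth A) :
    ∃ x₀, 0 < x₀ ∧ StrictMonoOn A (Set.Ici x₀) ∧ ContinuousOn A (Set.Ici x₀) := by
  obtain ⟨-, -, x₀, K, c, hx₀, hc, h⟩ := hA
  have hd : ∀ x ∈ Set.Ici (x₀ + 1), 0 < deriv A x := fun x hx =>
    (h x (lt_of_lt_of_le (by linarith) (Set.mem_Ici.1 hx))).2.1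
  have hcont : ContinuousOn A (Set.Ici (x₀ + 1)) := fun x hx =>
    (differentiableAt_of_deriv_ne_zero (hd x hx).ne').continuousAt.continuousWithinAt
  exact ⟨x₀ + 1, by linarith, strictMonoOn_of_deriv_pos (convex_Ici _) hcont fun x hx =>
    hd x (interior_subset hx), hcont⟩

/-- The bound on the second derivative says that `log (deriv A)` has derivative at most `K / x` in
absolute value. -/
theorem abs_log_deriv_sub_le {A : ℝ → ℝ} {x₀ K : ℝ} (hx₀ : 0 < x₀)
    (h : ∀ x > x₀, 0 < deriv A x ∧ DifferentiableAt ℝ (deriv A) x ∧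
      |deriv (deriv A) x| ≤ K * deriv A x / x) {x y : ℝ} (hx : x₀ < x) (hxy : x ≤ y) :
    |Real.log (deriv A y) - Real.log (deriv A x)| ≤ K / x * (y - x) := by
  have hK : 0 ≤ K := by
    obtain ⟨h1, h2, h3⟩ := h x hx
    by_contra hK
    have : K * deriv A x / x < 0 :=
      div_neg_of_neg_of_pos (mul_neg_of_neg_of_pos (not_le.1 hK) h1) (hx₀.trans hx)
    linarith [abs_nonneg (deriv (deriv A) x)]
  have := Convex.norm_image_sub_le_of_norm_hasDerivWithin_le (f := fun z => Real.log (deriv A z))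
    (f' := fun z => deriv (deriv A) z / deriv A z) (s := Set.Icc x y) (x := x) (y := y)
    (C := K / x) (fun z hz => ?_) (fun z hz => ?_) (convex_Icc x y) (by simpa using hxy)
    (by simpa using hxy)
  · rwa [Real.norm_eq_abs, Real.norm_eq_abs, abs_of_nonneg (sub_nonneg.2 hxy)] at this
  · obtain ⟨h1, h2, h3⟩ := h z (hx.trans_le hz.1)
    exact (h2.hasDerivAt.log h1.ne').hasDerivWithinAt
  · obtain ⟨h1, h2, h3⟩ := h z (hx.trans_le hz.1)
    have hx0 : 0 < x := hx₀.trans hx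
    rw [Real.norm_eq_abs, abs_div, abs_of_pos h1, div_le_iff₀ h1]
    calc _ ≤ K * deriv A z / z := h3
      _ ≤ K * deriv A z / x := by
        gcongr
        exact hz.1
      _ = _ := by ring

/-- By the mean value theorem the gap after `s m` is `1 / deriv A (ξ m)`. So the gaps grow because
the derivative tends to `0`, their ratio tends to `1` because `log (deriv A)` hardly changes between
`ξ m` and `ξ (m + 1)`, and the comparison of `deriv A x` with `A y / y` for all `y ≥ x` bounds every
earlier gap by a multiple of `s M / M`. -/
theorem RegularGrowth.spacing {A : ℝ → ℝ} (hA : RegularGrowth A) {ρ : ℝ} {s : ℕ → ℝ}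
    {m₀ : ℕ} {x₀ : ℝ} (hx₀ : StrictMonoOn A (Set.Ici x₀)) (hs0 : ∀ m ≥ m₀, x₀ ≤ s m)
    (hs : ∀ m ≥ m₀, A (s m) = m + ρ) :
    Tendsto s atTop atTop ∧
    Tendsto (fun m => s (m + 1) - s m) atTop atTop ∧
    Tendsto (fun m => (s (m + 2) - s (m + 1)) / (s (m + 1) - s m)) atTop (𝓝 1) ∧
    ∃ C m₁, ∀ m ≥ m₁, ∀ M ≥ m, (s (m + 1) - s m) * M ≤ C * s M ∧ M ≤ C * s M := by
  obtain ⟨hAt, hA't, x₁, K, c, hx₁, hc, h⟩ := hA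
  have hst : Tendsto s atTop atTop := by
    rw [tendsto_atTop]
    intro y
    filter_upwards [eventually_ge_atTop m₀,
      (tendsto_natCast_atTop_atTop (R := ℝ)).eventually_gt_atTop (A (max y x₀) - ρ)] with m hm hm'
    have h1 : A (max y x₀) < A (s m) := by rw [hs m hm]; linarith
    exact (le_max_left _ _).trans
      ((hx₀.lt_iff_lt (le_max_right y x₀) (hs0 m hm)).1 h1).le
  have hmono : ∀ m ≥ m₀, s m < s (m + 1) := fun m hm =>
    (hx₀.lt_iff_lt (hs0 m hm) (hs0 (m + 1) (by omega))).1
      (by rw [hs m hm, hs (m + 1) (by omega)]; push_cast; linarith)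
  -- The threshold for `m` ensures both `c * (m + 1 + ρ) ≥ 2`, used in `hdouble`, and `m / 2 + 1 / 2
  -- ≤ m + ρ`, stated in `hMρ`.
  obtain ⟨m₂, hm₂⟩ := eventually_atTop.1
    ((hst.eventually_gt_atTop (x₁ + 1)).and ((eventually_ge_atTop m₀).and
      ((tendsto_natCast_atTop_atTop (R := ℝ)).eventually_ge_atTop (2 / c + 2 * |ρ| + 1))))
  have hmvt : ∀ m ≥ m₂, ∃ ξ, s m < ξ ∧ ξ < s (m + 1) ∧ deriv A ξ * (s (m + 1) - s m) = 1 := by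
    intro m hm
    have hdiff : ∀ x ≥ s m, DifferentiableAt ℝ A x := fun x hx =>
      differentiableAt_of_deriv_ne_zero (h x (by linarith [(hm₂ m hm).1])).2.1.ne'
    obtain ⟨ξ, hξ, hξ'⟩ := exists_deriv_eq_slope A (hmono m (hm₂ m hm).2.1)
      (fun x hx => (hdiff x hx.1).continuousAt.continuousWithinAt)
      (fun x hx => (hdiff x hx.1.le).differentiableWithinAt)
    refine ⟨ξ, hξ.1, hξ.2, ?_⟩
    have h2 := hmono m (hm₂ m hm).2.1
    rw [hξ', div_mul_cancel₀ _ (by linarith), hs m (hm₂ m hm).2.1,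
      hs (m + 1) (by have := (hm₂ m hm).2.1; omega)]
    push_cast; ring
  choose! ξ hξ1 hξ2 hξ3 using hmvt
  have hd : ∀ m ≥ m₂, s (m + 1) - s m = 1 / deriv A (ξ m) := fun m hm => by
    have := (h (ξ m) (by linarith [(hm₂ m hm).1, hξ1 m hm])).2.1
    rw [eq_div_iff this.ne', mul_comm, hξ3 m hm]
  have hξt : Tendsto ξ atTop atTop := tendsto_atTop_mono' atTop
    ((eventually_ge_atTop m₂).mono fun m hm => (hξ1 m hm).le) hst
  have hsmono : ∀ m ≥ m₂, ∀ M ≥ m, s m ≤ s M := by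
    intro m hm M hM
    induction M, hM using Nat.le_induction with
    | base => exact le_rfl
    | succ M hM ih => exact ih.trans (hmono M ((hm₂ m hm).2.1.trans hM)).le
  have hpos : ∀ m ≥ m₂, 0 < s m := fun m hm => by linarith [(hm₂ m hm).1]
  have hMρ : ∀ M ≥ m₂, (M : ℝ) / 2 + 1 / 2 ≤ M + ρ := fun M hM => by
    have h1 := (hm₂ M hM).2.2
    have h2 := neg_abs_le ρ
    have : 0 < 2 / c := by positivity
    linarith
  have hbd : ∀ m ≥ m₂, ∀ M ≥ m, (s (m + 1) - s m) * (c * (M + 1 + ρ)) ≤ s (M + 1) := by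
    intro m hm M hM
    have hy := hsmono (m + 1) (by omega) (M + 1) (by omega)
    have hξm := h (ξ m) (by linarith [(hm₂ m hm).1, hξ1 m hm])
    have h1 := hξm.2.2.2.2 (s (M + 1)) ((hξ2 m hm).le.trans hy)
    rw [hs (M + 1) (by have := (hm₂ m hm).2.1; omega)] at h1
    have hp := hpos (M + 1) (by omega)
    rw [div_le_iff₀ hp] at h1
    push_cast at h1
    have h2 := hξ3 m hm
    have h3 : 0 ≤ s (m + 1) - s m := (sub_pos.2 (hmono m (hm₂ m hm).2.1)).le
    calc _ ≤ (s (m + 1) - s m) * (deriv A (ξ m) * s (M + 1)) :=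
          mul_le_mul_of_nonneg_left h1 h3
      _ = (deriv A (ξ m) * (s (m + 1) - s m)) * s (M + 1) := by ring
      _ = s (M + 1) := by rw [h2, one_mul]
  have hdouble : ∀ m ≥ m₂, s (m + 1) ≤ 2 * s m := by
    intro m hm
    have h1 := hbd m hm m le_rfl
    have h2 : 2 ≤ c * (m + 1 + ρ) := by
      have h3 := (hm₂ m hm).2.2
      have h4 := neg_abs_le ρ
      have h6 := abs_nonneg ρ
      have h5 : 2 / c ≤ m + 1 + ρ := by linarith
      rwa [div_le_iff₀' hc] at h5
    have h3 : 0 ≤ s (m + 1) - s m := (sub_pos.2 (hmono m (hm₂ m hm).2.1)).le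
    nlinarith
  refine ⟨hst, ?_, ?_, ?_⟩
  · rw [tendsto_atTop]
    intro R
    have hR : 0 < 1 / (|R| + 1) := by positivity
    filter_upwards [(hA't.comp hξt).eventually_lt_const hR, eventually_ge_atTop m₂] with m h1 h2
    have h3 := (h (ξ m) (by linarith [(hm₂ m h2).1, hξ1 m h2])).2.1
    rw [hd m h2, le_div_iff₀ h3]
    simp only [Function.comp_apply] at h1
    rw [lt_div_iff₀ (by positivity)] at h1
    nlinarith [le_abs_self R]
  -- The distance between `ξ m` and `ξ (m + 1)` is `O(s m / m)` and the Lipschitz constant is `O(1 /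
  -- s m)`, so the logarithm of the ratio of consecutive gaps is `O(1 / m)`.
  · have hlog : Tendsto (fun m => Real.log (deriv A (ξ m)) - Real.log (deriv A (ξ (m + 1))))
        atTop (𝓝 0) := by
      have hlim : Tendsto (fun m : ℕ => |K| * (16 / (c * m))) atTop (𝓝 0) := by
        have h0 : Tendsto (fun m : ℕ => (c * m : ℝ)) atTop atTop :=
          tendsto_natCast_atTop_atTop.const_mul_atTop hc
        simpa using (h0.const_div_atTop 16).const_mul |K|
      refine squeeze_zero_norm' ?_ hlim
      filter_upwards [eventually_ge_atTop m₂, eventually_gt_atTop 0] with m hm hm0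
      have hm0' : (0 : ℝ) < m := by exact_mod_cast hm0
      have hξx : x₁ < ξ m := by linarith [(hm₂ m hm).1, hξ1 m hm]
      have hξξ : ξ m ≤ ξ (m + 1) := ((hξ2 m hm).trans (hξ1 (m + 1) (by omega))).le
      have h1 := abs_log_deriv_sub_le hx₁ (fun x hx =>
        ⟨(h x hx).2.1, (h x hx).2.2.1, (h x hx).2.2.2.1⟩) hξx hξξ
      rw [Real.norm_eq_abs, abs_sub_comm]
      refine h1.trans ?_
      have hsm := hpos m hm
      have e1 := hbd m hm (m + 1) (by omega)
      have e2 := hbd (m + 1) (by omega) (m + 1) (by omega)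
      have e3 := hdouble m hm
      have e4 := hdouble (m + 1) (by omega)
      have e5 := hMρ m hm
      have e6 : ξ (m + 1) - ξ m ≤ (s (m + 2) - s (m + 1)) + (s (m + 1) - s m) := by
        linarith [hξ1 m hm, hξ2 (m + 1) (by omega : m + 1 ≥ m₂)]
      have e7 : ((s (m + 2) - s (m + 1)) + (s (m + 1) - s m)) * (c * m / 2) ≤ 8 * s m := by
        have h0 : 0 ≤ (s (m + 2) - s (m + 1)) + (s (m + 1) - s m) := by
          have := hmono m (hm₂ m hm).2.1
          have := hmono (m + 1) (by have := (hm₂ m hm).2.1; omega)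
          simp only [add_assoc, Nat.reduceAdd] at this
          linarith
        push_cast at e1 e2
        simp only [add_assoc, Nat.reduceAdd] at e1 e2 e4
        have e8 : c * m / 2 ≤ c * (m + (1 + (1 + ρ))) := by nlinarith
        nlinarith
      have e9 : ξ (m + 1) - ξ m ≤ 16 * s m / (c * m) := by
        rw [le_div_iff₀ (by positivity)]
        have h0 : 0 ≤ c * m / 2 := by positivity
        nlinarith
      calc K / ξ m * (ξ (m + 1) - ξ m) ≤ |K| / s m * (16 * s m / (c * m)) := by
            have : 0 ≤ ξ (m + 1) - ξ m := sub_nonneg.2 hξξ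
            gcongr
            · exact le_abs_self K
            · exact (hξ1 m hm).le
        _ = |K| * (16 / (c * m)) := by field_simp
    have := (Real.continuous_exp.tendsto 0).comp hlog
    rw [Real.exp_zero] at this
    refine this.congr' ?_
    filter_upwards [eventually_ge_atTop m₂] with m hm
    have hp1 := (h (ξ m) (by linarith [(hm₂ m hm).1, hξ1 m hm])).2.1
    have hp2 := (h (ξ (m + 1)) (by
      linarith [(hm₂ (m + 1) (by omega)).1, hξ1 (m + 1) (by omega)])).2.1
    simp only [Function.comp_apply]
    rw [Real.exp_sub, Real.exp_log hp1, Real.exp_log hp2, hd m hm]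
    have := hd (m + 1) (by omega)
    simp only [add_assoc, Nat.reduceAdd] at this
    rw [this]
    field_simp
  · set Q : ℝ := deriv A (s m₂) / c with hQ
    have hs2 := h (s m₂) (by linarith [(hm₂ m₂ le_rfl).1])
    have hQ0 : 0 < Q := div_pos hs2.2.1 hc
    refine ⟨max (4 / c) (2 * Q), m₂, fun m hm M hM => ⟨?_, ?_⟩⟩
    · have h1 := hbd m hm M hM
      have h2 := hdouble M (hm.trans hM)
      have h3 := hMρ M (hm.trans hM)
      have h4 : 0 ≤ s (m + 1) - s m := (sub_pos.2 (hmono m (hm₂ m hm).2.1)).le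
      have h5 : (s (m + 1) - s m) * (c * (M / 2)) ≤ 2 * s M := by
        refine le_trans ?_ (h1.trans h2)
        gcongr
        linarith
      calc (s (m + 1) - s m) * M = ((s (m + 1) - s m) * (c * (M / 2))) * (2 / c) := by field_simp
        _ ≤ 2 * s M * (2 / c) := by gcongr
        _ = 4 / c * s M := by ring
        _ ≤ _ := mul_le_mul_of_nonneg_right (le_max_left _ _) (hpos M (hm.trans hM)).le
    · have h1 := hs2.2.2.2.2 (s M) (hsmono m₂ le_rfl M (hm.trans hM))
      have hp := hpos M (hm.trans hM)
      rw [hs M (by have := (hm₂ m hm).2.1; omega), div_le_iff₀ hp] at h1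
      have h3 := hMρ M (hm.trans hM)
      have h4 : (M : ℝ) + ρ ≤ Q * s M := by
        rw [hQ, div_mul_eq_mul_div, le_div_iff₀ hc]; linarith
      calc (M : ℝ) ≤ 2 * Q * s M := by linarith
        _ ≤ _ := mul_le_mul_of_nonneg_right (le_max_right _ _) hp.le

/-- Rounding the times `s m` to integers changes each gap by at most `2`, which is negligible
because the gaps tend to infinity. -/
theorem RegularGrowth.regularCounter_of_times {A : ℝ → ℝ} (hA : RegularGrowth A) {ρ : ℝ}
    {s : ℕ → ℝ} {m₀ : ℕ} {x₀ : ℝ} (hx₀ : StrictMonoOn A (Set.Ici x₀))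
    (hs0 : ∀ m ≥ m₀, x₀ ≤ s m) (hs : ∀ m ≥ m₀, A (s m) = m + ρ) {τ κ : ℕ → ℕ}
    (hg : GaloisConnection τ κ) (hτ : ∀ m ≥ m₀, |(τ m : ℝ) - s m| ≤ 1) : RegularCounter κ := by
  obtain ⟨h1, h2, h3, C, m₁, h4⟩ := hA.spacing hx₀ hs0 hs
  refine ⟨τ, hg, fun ε hε => ?_, ?_⟩
  · have h3' := (h3.sub_const 1).abs.eventually_lt_const
      (show |(1 : ℝ) - 1| < ε / 4 by simpa using hε)
    filter_upwards [h3', h2.eventually_ge_atTop (16 / ε), h2.eventually_ge_atTop 4,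
      eventually_ge_atTop m₀] with m a1 a2 a3 hm
    have t0 := abs_le.1 (hτ m hm)
    have t1 := abs_le.1 (hτ (m + 1) (by omega))
    have t2 := abs_le.1 (hτ (m + 2) (by omega))
    set d := s (m + 1) - s m
    have hd : 0 < d := by linarith
    have a4 : |(s (m + 2) - s (m + 1)) - d| ≤ ε / 4 * d := by
      have : (s (m + 2) - s (m + 1)) - d = ((s (m + 2) - s (m + 1)) / d - 1) * d := by
        field_simp
      rw [this, abs_mul, abs_of_pos hd]
      gcongr
    rw [div_le_iff₀ hε] at a2
    have a5 := abs_le.1 a4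
    have a6 : d / 2 ≤ (τ (m + 1) : ℝ) - τ m := by linarith
    have a7 : ε * (d / 2) ≤ ε * ((τ (m + 1) : ℝ) - τ m) := by gcongr
    rw [abs_le]
    constructor <;> nlinarith
  · set m₂ := max m₀ m₁
    refine ⟨2 * |C| + 4 * |C| + 2 * τ m₂ * |C|, ?_⟩
    filter_upwards [eventually_ge_atTop m₂, h1.eventually_ge_atTop 2] with M hM hs2 m hm
    have hMm := abs_le.1 (hτ M (le_trans (le_max_left _ _) hM))
    have hτ2 : s M ≤ 2 * τ M := by linarith
    have hτ0 : (0 : ℝ) ≤ τ M := Nat.cast_nonneg _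
    have hM2 : (M : ℝ) ≤ 2 * |C| * τ M := by
      have := (h4 m₂ (le_max_right _ _) M hM).2
      calc (M : ℝ) ≤ C * s M := this
        _ ≤ |C| * (2 * τ M) := by
          have := le_abs_self C
          have := abs_nonneg C
          nlinarith
        _ = _ := by ring
    -- Levels below `m₂`, not covered by the asymptotic bounds, have length at most `τ m₂`; for them
    -- `M = O(τ M)` suffices.
    rcases lt_or_ge m m₂ with h | h
    · have h5 : (τ (m + 1) : ℝ) - τ m ≤ τ m₂ := by
        have : (τ (m + 1) : ℝ) ≤ τ m₂ := by exact_mod_cast hg.monotone_l h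
        linarith [(Nat.cast_nonneg _ : (0 : ℝ) ≤ τ m)]
      calc _ ≤ (τ m₂ : ℝ) * M := by gcongr
        _ ≤ τ m₂ * (2 * |C| * τ M) := by gcongr
        _ ≤ _ := by
          have := abs_nonneg C
          have : 0 ≤ |C| * τ M := by positivity
          nlinarith
    · have h5 := (h4 m (le_trans (le_max_right _ _) h) M hm).1
      have t0 := abs_le.1 (hτ m (le_trans (le_max_left _ _) h))
      have t1 := abs_le.1 (hτ (m + 1) (le_trans (le_max_left _ _) (h.trans m.le_succ)))
      have h6 : (τ (m + 1) : ℝ) - τ m ≤ s (m + 1) - s m + 2 := by linarith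
      have h7 : C * s M ≤ |C| * (2 * τ M) := by
        have := le_abs_self C
        have := abs_nonneg C
        nlinarith
      calc _ ≤ (s (m + 1) - s m + 2) * M := by gcongr
        _ = (s (m + 1) - s m) * M + 2 * M := by ring
        _ ≤ |C| * (2 * τ M) + 2 * (2 * |C| * τ M) := by linarith
        _ ≤ _ := by
          have : 0 ≤ 2 * (τ m₂ : ℝ) * |C| * τ M := by positivity
          linarith

/-- The level times are controlled only from `m₀` on. Merging all levels up to `m₀` into one that
starts at time `0` makes the adjunction hold at every `m` and `n`, and leaves the counter unchanged
for large `n`. -/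
theorem RegularGrowth.exists_regularCounter_of_eventually {A : ℝ → ℝ} (hA : RegularGrowth A)
    {ρ : ℝ} {s : ℕ → ℝ} {m₀ : ℕ} {x₀ : ℝ} (hx₀ : StrictMonoOn A (Set.Ici x₀))
    (hs0 : ∀ m ≥ m₀, x₀ ≤ s m) (hs : ∀ m ≥ m₀, A (s m) = m + ρ) {k : ℕ → ℤ}
    (hk : Tendsto k atTop atTop) {τ : ℕ → ℕ}
    (hτk : ∀ m ≥ m₀, ∀ n : ℕ, τ m ≤ n ↔ x₀ ≤ n ∧ (m : ℤ) ≤ k n)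
    (hτ : ∀ m ≥ m₀, |(τ m : ℝ) - s m| ≤ 1) :
    ∃ κ, RegularCounter κ ∧ ∀ᶠ n in atTop, k n = κ n := by
  classical
  refine ⟨fun n => if x₀ ≤ n ∧ ((m₀ + 1 : ℕ) : ℤ) ≤ k n then (k n).toNat else m₀,
    hA.regularCounter_of_times (m₀ := m₀ + 1) (τ := fun m => if m ≤ m₀ then 0 else τ m) hx₀
      (fun m hm => hs0 m (by omega)) (fun m hm => hs m (by omega)) (fun m n => ?_)
      (fun m hm => ?_), ?_⟩
  · by_cases hm : m ≤ m₀
    · simp only [hm, if_true, zero_le, true_iff]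
      split_ifs with h
      · have := h.2; omega
      · exact hm
    · simp only [hm, if_false]
      rw [hτk m (by omega)]
      split_ifs with h
      · have := h.1; have := h.2
        constructor
        · rintro ⟨_, h2⟩; omega
        · intro h2; exact ⟨h.1, by omega⟩
      · constructor
        · rintro ⟨h1, h2⟩; exact absurd ⟨h1, by omega⟩ h
        · intro h2; omega
  · have : ¬ m ≤ m₀ := by omega
    simp only [this, if_false]
    exact hτ m (by omega)
  · filter_upwards [(tendsto_natCast_atTop_atTop (R := ℝ)).eventually_ge_atTop x₀,
      hk.eventually_ge_atTop ((m₀ + 1 : ℕ) : ℤ)] with n h1 h2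
    rw [if_pos ⟨h1, h2⟩]
    omega

theorem RegularGrowth.exists_times {A : ℝ → ℝ} (hA : RegularGrowth A) :
    ∃ x₀ : ℝ, 0 < x₀ ∧ StrictMonoOn A (Set.Ici x₀) ∧ ∃ m₀ : ℕ, ∀ m ≥ m₀, ∃ s, x₀ ≤ s ∧ A s = m := by
  obtain ⟨x₀, hx₀, hmono, hcont⟩ := hA.exists_strictMonoOn
  refine ⟨x₀, hx₀, hmono, ⌈A x₀⌉₊, fun m hm => ?_⟩
  have := isPreconnected_Ici.intermediate_value_Ici (Set.self_mem_Ici (a := x₀))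
    (le_principal_iff.2 (Ici_mem_atTop x₀)) hcont hA.1
  obtain ⟨s, hs, hs'⟩ := this (show A x₀ ≤ m from (Nat.le_ceil _).trans (Nat.cast_le.2 hm))
  exact ⟨s, hs, hs'⟩

theorem RegularGrowth.exists_floor_eq {A : ℝ → ℝ} (hA : RegularGrowth A) :
    ∃ κ, RegularCounter κ ∧ ∀ᶠ n : ℕ in atTop, ⌊A n⌋ = κ n := by
  obtain ⟨x₀, hx₀, hmono, m₀, h⟩ := hA.exists_times
  choose! s hs hs' using h
  refine hA.exists_regularCounter_of_eventually (ρ := 0) hmono hs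
    (fun m hm => by rw [hs' m hm, add_zero])
    (tendsto_floor_atTop.comp (hA.1.comp tendsto_natCast_atTop_atTop)) (τ := fun m => ⌈s m⌉₊)
    (fun m hm n => ?_) (fun m hm => ?_)
  · rw [Nat.ceil_le, Int.le_floor, Int.cast_natCast,
      ← hs' m hm]
    constructor
    · intro h1
      exact ⟨(hs m hm).trans h1, hmono.monotoneOn (hs m hm) ((hs m hm).trans h1) h1⟩
    · rintro ⟨h1, h2⟩
      exact (hmono.le_iff_le (hs m hm) h1).1 h2
  · have h0 : 0 ≤ s m := hx₀.le.trans (hs m hm)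
    rw [abs_le]
    constructor <;> linarith [Nat.le_ceil (s m), Nat.ceil_lt_add_one h0]

/-- This serves negative functions, through `⌊a⌋ = -⌈-a⌉`. The ceiling reaches `m` when `A` strictly
exceeds `m - 1`, whence the shift `ρ = -1` and the first integer time `⌊s (m - 1)⌋₊ + 1`. -/
theorem RegularGrowth.exists_ceil_eq {A : ℝ → ℝ} (hA : RegularGrowth A) :
    ∃ κ, RegularCounter κ ∧ ∀ᶠ n : ℕ in atTop, ⌈A n⌉ = κ n := by
  obtain ⟨x₀, hx₀, hmono, m₀, h⟩ := hA.exists_times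
  choose! s hs hs' using h
  refine hA.exists_regularCounter_of_eventually (ρ := -1) (m₀ := m₀ + 1) (s := fun m => s (m - 1))
    hmono (fun m hm => hs _ (by omega))
    (fun m hm => by rw [hs' (m - 1) (by omega), Nat.cast_sub (by omega)]; push_cast; ring)
    (tendsto_ceil_atTop.comp (hA.1.comp tendsto_natCast_atTop_atTop))
    (τ := fun m => ⌊s (m - 1)⌋₊ + 1) (fun m hm n => ?_) (fun m hm => ?_)
  · obtain ⟨m, rfl⟩ : ∃ l, m = l + 1 := ⟨m - 1, by omega⟩
    have hm' : m ≥ m₀ := by omega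
    have h0 : 0 ≤ s m := hx₀.le.trans (hs m hm')
    rw [Nat.add_sub_cancel, Nat.add_one_le_iff, Nat.floor_lt h0]
    have e : ((m + 1 : ℕ) : ℤ) ≤ ⌈A n⌉ ↔ A (s m) < A n := by
      rw [hs' m hm']
      push_cast
      rw [Int.add_one_le_iff, Int.lt_ceil, Int.cast_natCast]
    rw [e]
    constructor
    · intro h1
      exact ⟨(hs m hm').trans h1.le, hmono (hs m hm') ((hs m hm').trans h1.le) h1⟩
    · rintro ⟨h1, h2⟩
      exact (hmono.lt_iff_lt (hs m hm') h1).1 h2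
  · have h0 : 0 ≤ s (m - 1) := hx₀.le.trans (hs _ (by omega))
    push_cast
    rw [abs_le]
    constructor <;> linarith [Nat.floor_le h0, Nat.lt_floor_add_one (s (m - 1))]

/-! ### The class `𝒯` -/

theorem hasDerivAt_log_sub_mul_log {a : ℝ → ℝ} {x β : ℝ} (hx : 0 < x) (ha : 0 < a x)
    (hd : DifferentiableAt ℝ a x) :
    HasDerivAt (fun y => Real.log (a y) - β * Real.log y) ((x * deriv a x / a x - β) / x) x := by
  have h1 : HasDerivAt (fun y => Real.log (a y) - β * Real.log y)
      (deriv a x / a x - β * x⁻¹) x :=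
    (hd.hasDerivAt.log ha.ne').sub ((Real.hasDerivAt_log hx.ne').const_mul β)
  refine h1.congr_deriv ?_
  field_simp

/-- Since `x * a' / a` is the derivative of `log a` in the variable `log x`, a bound on it compares
`a` with the power `x ^ β`. -/
theorem antitoneOn_log_sub_mul_log {a : ℝ → ℝ} {x₀ β : ℝ} (hx₀ : 0 < x₀)
    (h : ∀ x ≥ x₀, 0 < a x ∧ DifferentiableAt ℝ a x ∧ x * deriv a x / a x ≤ β) :
    AntitoneOn (fun y => Real.log (a y) - β * Real.log y) (Set.Ici x₀) := by
  have hd : ∀ x ≥ x₀, HasDerivAt (fun y => Real.log (a y) - β * Real.log y)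
      ((x * deriv a x / a x - β) / x) x := fun x hx =>
    hasDerivAt_log_sub_mul_log (hx₀.trans_le hx) (h x hx).1 (h x hx).2.1
  refine antitoneOn_of_deriv_nonpos (convex_Ici _)
    (fun x hx => (hd x hx).continuousAt.continuousWithinAt)
    (fun x hx => (hd x (interior_subset hx)).differentiableAt.differentiableWithinAt)
    (fun x hx => ?_)
  have hx' : x ≥ x₀ := interior_subset hx
  rw [(hd x hx').deriv]
  exact div_nonpos_of_nonpos_of_nonneg (by linarith [(h x hx').2.2]) (hx₀.le.trans hx')

theorem monotoneOn_log_sub_mul_log {a : ℝ → ℝ} {x₀ β : ℝ} (hx₀ : 0 < x₀)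
    (h : ∀ x ≥ x₀, 0 < a x ∧ DifferentiableAt ℝ a x ∧ β ≤ x * deriv a x / a x) :
    MonotoneOn (fun y => Real.log (a y) - β * Real.log y) (Set.Ici x₀) := by
  have hd : ∀ x ≥ x₀, HasDerivAt (fun y => Real.log (a y) - β * Real.log y)
      ((x * deriv a x / a x - β) / x) x := fun x hx =>
    hasDerivAt_log_sub_mul_log (hx₀.trans_le hx) (h x hx).1 (h x hx).2.1
  refine monotoneOn_of_deriv_nonneg (convex_Ici _)
    (fun x hx => (hd x hx).continuousAt.continuousWithinAt)
    (fun x hx => (hd x (interior_subset hx)).differentiableAt.differentiableWithinAt)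
    (fun x hx => ?_)
  have hx' : x ≥ x₀ := interior_subset hx
  rw [(hd x hx').deriv]
  exact div_nonneg (by linarith [(h x hx').2.2]) (hx₀.le.trans hx')

/-- Comparison with powers: `a` grows at least like `x ^ (α / 2)`. If `α < 1`, then `a / x` decays
like a negative power and bounds the derivative; if `α = 1`, the decay of the derivative is part of
the definition of `𝒯`. -/
theorem regularGrowth_of_classT_of_pos {a : ℝ → ℝ} (ha : a ∈ ClassT)
    (hpos : ∀ᶠ x in atTop, 0 < a x) : RegularGrowth a := by
  obtain ⟨⟨⟨c₀, -, hC3⟩, hne, -, ⟨β, hβ⟩, -⟩, α, hα, hcase⟩ := ha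
  have hα0 : 0 < α := by
    rcases hcase with h | h
    · exact h.1
    · rw [h.1]; exact one_pos
  have hα1 : α ≤ 1 := by
    rcases hcase with h | h
    · exact h.2.le
    · exact h.1.le
  have hbasic : ∀ᶠ x in atTop, 0 < x ∧ 0 < a x ∧ 0 < deriv a x ∧ DifferentiableAt ℝ a x ∧
      DifferentiableAt ℝ (deriv a) x ∧ |deriv (deriv a) x| ≤ (|β| + 1) * deriv a x / x ∧
      α / 2 ≤ x * deriv a x / a x ∧ x * deriv a x / a x ≤ 2 := by
    filter_upwards [eventually_gt_atTop 0, hpos, hne, eventually_gt_atTop c₀,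
      hα.eventually_const_lt (half_lt_self hα0), hα.eventually_lt_const (hα1.trans_lt one_lt_two),
      hβ.abs.eventually_lt_const (lt_add_one _)] with x h1 h2 h3 h4 h5 h6 h7
    have hd : 0 < deriv a x := by
      have h8 : 0 < x * deriv a x / a x := lt_trans (by positivity) h5
      have h9 : 0 < x * deriv a x := by
        have := mul_pos h8 h2; rwa [div_mul_cancel₀ _ h2.ne'] at this
      exact (mul_pos_iff_of_pos_left h1).1 h9
    have hcd : ContDiffAt ℝ 3 a x := hC3.contDiffAt (Ioi_mem_nhds h4)
    refine ⟨h1, h2, hd, hcd.differentiableAt (by norm_num), ?_, ?_, h5.le, h6.le⟩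
    · have h10 : ContDiffOn ℝ 2 (deriv a) (Set.Ioi c₀) :=
        hC3.deriv_of_isOpen isOpen_Ioi (by norm_num)
      exact (h10.contDiffAt (Ioi_mem_nhds h4)).differentiableAt (by norm_num)
    · rw [abs_div, abs_mul, abs_of_pos h1, abs_of_pos hd, div_lt_iff₀ hd] at h7
      rw [le_div_iff₀ h1, mul_comm]
      exact h7.le
  obtain ⟨x₁, hx₁⟩ := eventually_atTop.1 hbasic
  have hx₁0 : 0 < x₁ := (hx₁ x₁ le_rfl).1
  refine ⟨?_, ?_, ?_⟩
  · have hm := monotoneOn_log_sub_mul_log (a := a) (β := α / 2) hx₁0 fun x hx =>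
      ⟨(hx₁ x hx).2.1, (hx₁ x hx).2.2.2.1, (hx₁ x hx).2.2.2.2.2.2.1⟩
    set R := Real.log (a x₁) - α / 2 * Real.log x₁
    have h1 : Tendsto (fun x => Real.exp (R + α / 2 * Real.log x)) atTop atTop :=
      Real.tendsto_exp_atTop.comp (tendsto_atTop_add_const_left _ _
        (Real.tendsto_log_atTop.const_mul_atTop (half_pos hα0)))
    refine tendsto_atTop_mono' _ ?_ h1
    filter_upwards [eventually_ge_atTop x₁] with x hx
    have h2 := hm (Set.self_mem_Ici) (show x ∈ Set.Ici x₁ from hx) hx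
    change R ≤ Real.log (a x) - α / 2 * Real.log x at h2
    rw [← Real.exp_log (hx₁ x hx).2.1]
    exact Real.exp_le_exp.2 (by linarith)
  · rcases hcase with h | h
    · set b := (1 + α) / 2 with hb
      have hb1 : b < 1 := by rw [hb]; linarith [h.2]
      have hαb : α < b := by rw [hb]; linarith [h.2]
      obtain ⟨x₂, hx₂⟩ := eventually_atTop.1 (hα.eventually_lt_const hαb)
      set x₃ := max x₁ x₂
      have hx₃0 : 0 < x₃ := hx₁0.trans_le (le_max_left _ _)
      have hm := antitoneOn_log_sub_mul_log (a := a) (β := b) hx₃0 fun x hx =>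
        ⟨(hx₁ x ((le_max_left _ _).trans hx)).2.1, (hx₁ x ((le_max_left _ _).trans hx)).2.2.2.1,
          (hx₂ x ((le_max_right _ _).trans hx)).le⟩
      set R := Real.log (a x₃) - b * Real.log x₃
      have h1 : Tendsto (fun x => 2 * Real.exp (R - (1 - b) * Real.log x)) atTop (𝓝 0) := by
        have h2 : Tendsto (fun x => R - (1 - b) * Real.log x) atTop atBot := by
          have := tendsto_neg_atTop_atBot.comp
            (Real.tendsto_log_atTop.const_mul_atTop (sub_pos.2 hb1))
          simpa [sub_eq_add_neg] using tendsto_atBot_add_const_left _ R this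
        simpa using (Real.tendsto_exp_atBot.comp h2).const_mul 2
      refine squeeze_zero_norm' ?_ h1
      filter_upwards [eventually_ge_atTop x₃] with x hx
      have hb' := hx₁ x ((le_max_left _ _).trans hx)
      rw [Real.norm_of_nonneg hb'.2.2.1.le]
      have h3 := hm (Set.self_mem_Ici) (show x ∈ Set.Ici x₃ from hx) hx
      change _ ≤ R at h3
      beta_reduce at h3
      have h4 : a x / x ≤ Real.exp (R - (1 - b) * Real.log x) := by
        rw [← Real.exp_log (div_pos hb'.2.1 hb'.1), Real.log_div hb'.2.1.ne' hb'.1.ne']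
        exact Real.exp_le_exp.2 (by linarith)
      have h5 := hb'.2.2.2.2.2.2.2
      rw [div_le_iff₀ hb'.2.1] at h5
      calc deriv a x = x * deriv a x / x := by field_simp [hb'.1.ne']
        _ ≤ 2 * a x / x := by gcongr; exact hb'.1.le
        _ = 2 * (a x / x) := by ring
        _ ≤ _ := by gcongr
    · exact h.2.1
  -- The derivative at `x` must dominate `a y / y` for all later `y`. For `α < 1` this holds because
  -- `a y / y` is eventually decreasing; for `α = 1` because the derivative itself is.
  · have hmono : ∃ x₂ ≥ x₁, ∀ x > x₂, ∀ y ≥ x, α / 2 * a y / y ≤ deriv a x := by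
      rcases hcase with h | h
      · obtain ⟨x₂, hx₂⟩ := eventually_atTop.1 (hα.eventually_lt_const h.2)
        set x₃ := max x₁ x₂
        have hx₃0 : 0 < x₃ := hx₁0.trans_le (le_max_left _ _)
        have hm := antitoneOn_log_sub_mul_log (a := a) (β := 1) hx₃0 fun x hx =>
          ⟨(hx₁ x ((le_max_left _ _).trans hx)).2.1, (hx₁ x ((le_max_left _ _).trans hx)).2.2.2.1,
            (hx₂ x ((le_max_right _ _).trans hx)).le⟩
        refine ⟨x₃, le_max_left _ _, fun x hx y hy => ?_⟩
        have bx := hx₁ x ((le_max_left _ _).trans hx.le)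
        have by' := hx₁ y (((le_max_left _ _).trans hx.le).trans hy)
        have h3 := hm (show x ∈ Set.Ici x₃ from hx.le) (show y ∈ Set.Ici x₃ from hx.le.trans hy) hy
        simp only [one_mul] at h3
        rw [← Real.log_div by'.2.1.ne' by'.1.ne', ← Real.log_div bx.2.1.ne' bx.1.ne',
          Real.log_le_log_iff (div_pos by'.2.1 by'.1) (div_pos bx.2.1 bx.1)] at h3
        have h5 := bx.2.2.2.2.2.2.1
        rw [le_div_iff₀ bx.2.1] at h5
        calc α / 2 * a y / y = α / 2 * (a y / y) := by ring
          _ ≤ α / 2 * (a x / x) := by gcongr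
          _ = α / 2 * a x / x := by ring
          _ ≤ x * deriv a x / x := by gcongr; exact bx.1.le
          _ = deriv a x := by field_simp [bx.1.ne']
      · obtain ⟨-, h0, x₂, hmon⟩ := h
        have hanti : AntitoneOn (deriv a) (Set.Ioi (max x₁ x₂)) := by
          rcases hmon with hmon | hmon
          -- A derivative increasing to `0` would be nonpositive, against its eventual positivity.
          · exfalso
            set y := max x₁ x₂ + 1
            have hy : 0 < deriv a y := (hx₁ y (by
              have := le_max_left x₁ x₂; simp only [y]; linarith)).2.2.1
            have : deriv a y ≤ 0 := by
              refine ge_of_tendsto h0 ((eventually_ge_atTop y).mono fun z hz => ?_)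
              have h2 : x₂ < y := by have := le_max_right x₁ x₂; simp only [y]; linarith
              exact hmon h2 (h2.trans_le hz) hz
            linarith
          · exact hmon.mono (Set.Ioi_subset_Ioi (le_max_right _ _))
        refine ⟨max x₁ x₂, le_max_left _ _, fun x hx y hy => ?_⟩
        have by' := hx₁ y (((le_max_left _ _).trans hx.le).trans hy)
        refine le_trans ?_ (hanti hx (lt_of_lt_of_le hx hy) hy)
        have h5 := by'.2.2.2.2.2.2.1
        rw [le_div_iff₀ by'.2.1] at h5
        rw [div_le_iff₀ by'.1]
        linarith
    obtain ⟨x₂, hx₂, hm⟩ := hmono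
    refine ⟨x₂, |β| + 1, α / 2, hx₁0.trans_le hx₂, half_pos hα0, fun x hx => ?_⟩
    have hb := hx₁ x (hx₂.trans hx.le)
    exact ⟨hb.2.1, hb.2.2.1, hb.2.2.2.2.1, hb.2.2.2.2.2.1, hm x hx⟩

theorem neg_mem_classT {a : ℝ → ℝ} (ha : a ∈ ClassT) : (fun x => -a x) ∈ ClassT := by
  have e1 : deriv (fun x => -a x) = fun x => -deriv a x := funext fun x => deriv.fun_neg
  have e2 : deriv (fun x => -deriv a x) = fun x => -deriv (deriv a) x :=
    funext fun x => deriv.fun_neg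
  have e3 : deriv (fun x => -deriv (deriv a) x) = fun x => -deriv (deriv (deriv a)) x :=
    funext fun x => deriv.fun_neg
  obtain ⟨⟨⟨c₀, hc₀, hC3⟩, hne, h1, h2, h3⟩, α, hα, hcase⟩ := ha
  refine ⟨⟨⟨c₀, hc₀, hC3.neg⟩, ?_, ?_, ?_, ?_⟩, α, ?_, ?_⟩
  · simpa only [e1, e2, neg_ne_zero] using hne
  · simpa only [e1, mul_neg, neg_div_neg_eq] using h1
  · simpa only [e1, e2, mul_neg, neg_div_neg_eq] using h2
  · simpa only [e1, e2, e3, mul_neg, neg_div_neg_eq] using h3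
  · simpa only [e1, mul_neg, neg_div_neg_eq] using hα
  · refine hcase.imp id fun ⟨h, h0, c, hm⟩ => ⟨h, ?_, c, ?_⟩
    · rw [e1]; simpa using h0.neg
    · rw [e1]
      rcases hm with hm | hm
      · exact Or.inr hm.neg
      · exact Or.inl hm.neg

/-- Being continuous without zeros near infinity, `a` has a constant sign there. -/
theorem regularGrowth_of_classT {a : ℝ → ℝ} (ha : a ∈ ClassT) :
    RegularGrowth a ∨ RegularGrowth fun x => -a x := by
  obtain ⟨c₀, -, hC3⟩ := ha.1.1
  obtain ⟨x₁, hx₁⟩ := eventually_atTop.1 (ha.1.2.1.and (eventually_gt_atTop c₀))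
  have hcont : ContinuousOn a (Set.Ici x₁) :=
    hC3.continuousOn.mono fun x hx => (hx₁ x hx).2
  have hzero : (0 : ℝ) ∉ a '' Set.Ici x₁ := by
    rintro ⟨x, hx, h0⟩; exact (hx₁ x hx).1.1 h0
  have hne := (hx₁ x₁ le_rfl).1.1
  rcases hne.lt_or_gt with h | h
  · right
    refine regularGrowth_of_classT_of_pos (neg_mem_classT ha) ?_
    filter_upwards [eventually_ge_atTop x₁] with x hx
    by_contra hcon
    exact hzero (isPreconnected_Ici.intermediate_value Set.self_mem_Ici
      (show x ∈ Set.Ici x₁ from hx) hcont ⟨h.le, by linarith⟩)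
  · left
    refine regularGrowth_of_classT_of_pos ha ?_
    filter_upwards [eventually_ge_atTop x₁] with x hx
    by_contra hcon
    exact hzero (isPreconnected_Ici.intermediate_value (show x ∈ Set.Ici x₁ from hx)
      Set.self_mem_Ici hcont ⟨by linarith, h.le⟩)

theorem RegularGrowth.isBigO_id {A : ℝ → ℝ} (hA : RegularGrowth A) : A =O[atTop] fun x => x := by
  obtain ⟨-, -, x₀, K, c, hx₀, hc, h⟩ := hA
  refine Asymptotics.IsBigO.of_bound (deriv A (x₀ + 1) / c) ?_
  filter_upwards [eventually_ge_atTop (x₀ + 1)] with y hy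
  have h1 := (h (x₀ + 1) (by linarith)).2.2.2.2 y hy
  have hy0 : 0 < y := by linarith
  rw [div_le_iff₀ hy0] at h1
  rw [Real.norm_of_nonneg (h y (by linarith)).1.le, Real.norm_of_nonneg hy0.le,
    div_mul_eq_mul_div, le_div_iff₀ hc]
  linarith

/-! ### Trigonometric approximation of the sawtooth along irrational rotations -/

theorem integral_fourier_unit (n : ℤ) :
    ∫ z : UnitAddCircle, fourier n z ∂AddCircle.haarAddCircle = if n = 0 then 1 else 0 := by
  split_ifs with h
  · simp [h]
  · exact integral_eq_zero_of_add_right_eq_neg (μ := AddCircle.haarAddCircle)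
      (fourier_add_half_inv_index h one_pos)

theorem fourierCoeff_finsupp (q : ℤ →₀ ℂ) (k : ℤ) :
    fourierCoeff (fun z : UnitAddCircle => q.sum fun j c => c * fourier j z) k = q k := by
  unfold fourierCoeff Finsupp.sum
  simp only [smul_eq_mul, Finset.mul_sum]
  rw [integral_finsetSum]
  · have : ∀ j, ∫ z : UnitAddCircle, fourier (-k) z * (q j * fourier j z) ∂AddCircle.haarAddCircle =
        if j = k then q j else 0 := by
      intro j
      have e : ∀ z : UnitAddCircle, fourier (-k) z * (q j * fourier j z) =
          q j * fourier (-k + j) z := fun z => by rw [fourier_add]; ring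
      simp only [e]
      rw [integral_const_mul, integral_fourier_unit]
      have : -k + j = 0 ↔ j = k := by omega
      simp only [this, mul_ite, mul_one, mul_zero]
    simp only [this, Finset.sum_ite_eq', Finsupp.mem_support_iff]
    split_ifs with h
    · rfl
    · exact (not_not.1 h).symm
  · intro j _
    exact ((map_continuous (fourier (-k))).mul (continuous_const.mul
      (map_continuous (fourier j)))).integrable_of_hasCompactSupport
        (HasCompactSupport.of_compactSpace _)

theorem fourier_sub_mul_coe (k : ℤ) (z₀ δ : ℝ) (m : ℕ) :
    fourier k ((z₀ - m * δ : ℝ) : UnitAddCircle) =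
      Complex.exp (2 * Real.pi * Complex.I * (k * z₀)) *
        Complex.exp (-(2 * Real.pi * Complex.I * ((k * δ : ℝ) : ℂ))) ^ m := by
  rw [fourier_coe_apply, ← Complex.exp_nat_mul, ← Complex.exp_add]
  congr 1
  push_cast
  ring

theorem exp_neg_ne_one_of_irrational {δ : ℝ} (hδ : Irrational δ) {k : ℤ} (hk : k ≠ 0) :
    Complex.exp (-(2 * Real.pi * Complex.I * ((k * δ : ℝ) : ℂ))) ≠ 1 := by
  rw [Ne, Complex.exp_eq_one_iff]
  rintro ⟨n, hn⟩
  have hpi : (2 * Real.pi * Complex.I : ℂ) ≠ 0 := by simp [Real.pi_ne_zero]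
  have h1 : (-(k * δ : ℝ) : ℂ) = n := by
    apply mul_left_cancel₀ hpi
    rw [mul_comm _ (n : ℂ), ← hn]; ring
  have h2 : -(k * δ) = (n : ℝ) := by exact_mod_cast h1
  exact (hδ.intCast_mul hk).ne_int (-n) (by push_cast; linarith)

/-- For `k ≠ 0` these are geometric sums with a ratio other than `1`, hence bounded; this is Weyl's
equidistribution criterion. -/
theorem tendsto_average_fourier {δ : ℝ} (hδ : Irrational δ) (z₀ : ℝ) (k : ℤ) :
    Tendsto (fun M : ℕ => (M : ℂ)⁻¹ * ∑ m ∈ Finset.range M,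
      fourier k ((z₀ - m * δ : ℝ) : UnitAddCircle)) atTop
      (𝓝 (∫ z : UnitAddCircle, fourier k z ∂AddCircle.haarAddCircle)) := by
  rw [integral_fourier_unit]
  split_ifs with h
  · refine tendsto_const_nhds.congr' ?_
    filter_upwards [eventually_ne_atTop 0] with M hM
    have : (M : ℂ) ≠ 0 := by exact_mod_cast hM
    simp [h, this]
  · set r := Complex.exp (-(2 * Real.pi * Complex.I * ((k * δ : ℝ) : ℂ))) with hr
    have hr1 : r ≠ 1 := exp_neg_ne_one_of_irrational hδ h
    have hrn : ‖r‖ = 1 := norm_exp_neg_two_pi_I _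
    simp only [fourier_sub_mul_coe, ← Finset.mul_sum, ← hr]
    have hb : ∀ M : ℕ, ‖∑ m ∈ Finset.range M, r ^ m‖ ≤ 2 / ‖r - 1‖ := by
      intro M
      rw [geom_sum_eq hr1, norm_div]
      gcongr
      calc _ ≤ ‖r ^ M‖ + ‖(1 : ℂ)‖ := norm_sub_le _ _
        _ = 2 := by rw [norm_pow, hrn]; norm_num
    have h0 : Tendsto (fun M : ℕ => (M : ℝ)⁻¹ *
        (‖Complex.exp (2 * Real.pi * Complex.I * (k * z₀))‖ * (2 / ‖r - 1‖))) atTop (𝓝 0) := by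
      simpa using tendsto_inv_atTop_nhds_zero_nat.mul_const
        (‖Complex.exp (2 * Real.pi * Complex.I * (k * z₀))‖ * (2 / ‖r - 1‖))
    refine squeeze_zero_norm (fun M => ?_) h0
    rw [norm_mul, norm_inv, norm_mul, Complex.norm_natCast]
    gcongr
    exact hb M

theorem tendsto_average_of_mem_span_fourier {δ : ℝ} (hδ : Irrational δ) (z₀ : ℝ)
    {P : C(UnitAddCircle, ℂ)}
    (hP : P ∈ Submodule.span ℂ (Set.range (fourier (T := 1)))) :
    Tendsto (fun M : ℕ => (M : ℂ)⁻¹ * ∑ m ∈ Finset.range M,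
      P ((z₀ - m * δ : ℝ) : UnitAddCircle)) atTop
      (𝓝 (∫ z : UnitAddCircle, P z ∂AddCircle.haarAddCircle)) := by
  have hint : ∀ P : C(UnitAddCircle, ℂ), Integrable P AddCircle.haarAddCircle := fun P =>
    (map_continuous P).integrable_of_hasCompactSupport (HasCompactSupport.of_compactSpace _)
  induction hP using Submodule.span_induction with
  | mem x hx =>
    obtain ⟨k, rfl⟩ := hx
    exact tendsto_average_fourier hδ z₀ k
  | zero => simp
  | add x y _ _ hx hy =>
    simp only [ContinuousMap.add_apply]
    rw [integral_add (hint x) (hint y)]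
    refine (hx.add hy).congr fun M => ?_
    rw [Finset.sum_add_distrib, mul_add]
  | smul c x _ hx =>
    simp only [ContinuousMap.smul_apply, smul_eq_mul]
    rw [integral_const_mul]
    refine (hx.const_mul c).congr fun M => ?_
    rw [← Finset.mul_sum]; ring

theorem exists_span_fourier_close (g : C(UnitAddCircle, ℂ)) {ε : ℝ} (hε : 0 < ε) :
    ∃ P ∈ Submodule.span ℂ (Set.range (fourier (T := 1))),
      ∀ z, ‖g z - P z‖ ≤ ε := by
  have h : g ∈ (Submodule.span ℂ (Set.range (fourier (T := 1)))).topologicalClosure := by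
    rw [span_fourier_closure_eq_top]; trivial
  obtain ⟨P, hP, hd⟩ := Metric.mem_closure_iff.1 h ε hε
  refine ⟨P, hP, fun z => ?_⟩
  rw [← dist_eq_norm]
  exact (ContinuousMap.dist_apply_le_dist z).trans hd.le

theorem periodizedBernoulli_one_coe {x : ℝ} (hx : x ∈ Set.Ico (0 : ℝ) 1) :
    periodizedBernoulli 1 (x : UnitAddCircle) = x - 1 / 2 := by
  unfold periodizedBernoulli
  rw [AddCircle.liftIco_coe_apply (by simpa using hx)]
  simp [bernoulliFun, Polynomial.bernoulli_one]

theorem norm_periodizedBernoulli_one_le (z : UnitAddCircle) :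
    |periodizedBernoulli 1 z| ≤ 1 / 2 := by
  obtain ⟨x, hx, rfl⟩ := AddCircle.coe_image_Ico_eq (1 : ℝ) 0 ▸ Set.mem_univ z
  rw [zero_add] at hx
  rw [periodizedBernoulli_one_coe hx, abs_le]
  constructor <;> linarith [hx.1, hx.2]

/-- Multiplying by `min 1 (‖z‖ / η)` removes the jump at `0`. The error is dominated by a continuous
function supported in the ball of radius `η`; its continuity is what lets equidistribution control
the error along the rotation. -/
theorem exists_continuous_approx_sawtooth {η : ℝ} (hη : 0 < η) :
    ∃ b g : C(UnitAddCircle, ℂ), (∀ z, ‖(periodizedBernoulli 1 z : ℂ) - b z‖ ≤ (g z).re) ∧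
      ∫ z, (g z).re ∂(AddCircle.haarAddCircle (T := 1)) ≤ 2 * η := by
  set φ : ℝ → ℂ := fun x => (((x - 1 / 2) * min 1 (‖(x : UnitAddCircle)‖ / η) : ℝ) : ℂ) with hφ
  have hc : Continuous (fun x : ℝ => ‖(x : UnitAddCircle)‖) :=
    continuous_norm.comp (AddCircle.continuous_mk' 1)
  have hφc : Continuous φ := by
    refine Complex.continuous_ofReal.comp ?_
    exact (continuous_id.sub continuous_const).mul (continuous_const.min (hc.div_const η))
  have h1 : ((1 : ℝ) : UnitAddCircle) = 0 := AddCircle.coe_period 1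
  have hb : Continuous (AddCircle.liftIco (1 : ℝ) 0 φ) :=
    AddCircle.liftIco_zero_continuous (by simp [hφ, h1]) hφc.continuousOn
  have hg : Continuous fun z : UnitAddCircle => ((1 - min 1 (‖z‖ / η) : ℝ) : ℂ) :=
    Complex.continuous_ofReal.comp
      (continuous_const.sub (continuous_const.min (continuous_norm.div_const η)))
  refine ⟨⟨_, hb⟩, ⟨_, hg⟩, fun z => ?_, ?_⟩
  · obtain ⟨x, hx, rfl⟩ := AddCircle.coe_image_Ico_eq (1 : ℝ) 0 ▸ Set.mem_univ z
    simp only [ContinuousMap.coe_mk, Complex.ofReal_re]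
    rw [AddCircle.liftIco_coe_apply hx]
    rw [zero_add] at hx
    rw [periodizedBernoulli_one_coe hx, hφ, ← Complex.ofReal_sub, Complex.norm_real,
      Real.norm_eq_abs]
    have h2 : (x - 1 / 2) - (x - 1 / 2) * min 1 (‖(x : UnitAddCircle)‖ / η) =
      (x - 1 / 2) * (1 - min 1 (‖(x : UnitAddCircle)‖ / η)) := by ring
    have h3 : 0 ≤ 1 - min 1 (‖(x : UnitAddCircle)‖ / η) := sub_nonneg.2 (min_le_left _ _)
    rw [h2, abs_mul, abs_of_nonneg h3]
    refine mul_le_of_le_one_left h3 ?_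
    rw [abs_le]
    constructor <;> linarith [hx.1, hx.2]
  · simp only [ContinuousMap.coe_mk, Complex.ofReal_re]
    have hm : MeasurableSet (Metric.closedBall (0 : UnitAddCircle) η) :=
      Metric.isClosed_closedBall.measurableSet
    have hvol : (AddCircle.haarAddCircle (T := 1)).real (Metric.closedBall (0 : UnitAddCircle) η) ≤
        2 * η := by
      have h4 := AddCircle.volume_closedBall (T := 1) (x := (0 : UnitAddCircle)) η
      rw [AddCircle.volume_eq_smul_haarAddCircle] at h4
      simp only [ENNReal.ofReal_one, one_smul] at h4
      rw [Measure.real, h4, ENNReal.toReal_ofReal (le_min zero_le_one (by positivity))]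
      exact min_le_right _ _
    refine le_trans ?_ hvol
    rw [← integral_indicator_one hm]
    refine integral_mono ?_ ((integrable_const (1 : ℝ)).indicator hm) fun z => ?_
    · exact (continuous_const.sub (continuous_const.min
        (continuous_norm.div_const η))).integrable_of_hasCompactSupport
          (HasCompactSupport.of_compactSpace _)
    · by_cases hz : z ∈ Metric.closedBall (0 : UnitAddCircle) η
      · rw [Set.indicator_of_mem hz]
        have : 0 ≤ min 1 (‖z‖ / η) := le_min zero_le_one (by positivity)
        simp only [Pi.one_apply]
        linarith
      · rw [Set.indicator_of_notMem hz]
        rw [mem_closedBall_zero_iff, not_le] at hz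
        have : 1 ≤ ‖z‖ / η := by rw [one_le_div hη]; exact hz.le
        rw [min_eq_left this, sub_self]

theorem exists_trig_approx_sawtooth {δ : ℝ} (hδ : Irrational δ) {ε : ℝ} (hε : 0 < ε) :
    ∃ q : ℤ →₀ ℂ, (∀ k : ℤ, ‖-1 / (2 * Real.pi * Complex.I * k) - q k‖ ≤ ε) ∧
      ∀ z₀ : ℝ, ∀ᶠ M : ℕ in atTop, ∑ m ∈ Finset.range M,
        ‖(periodizedBernoulli 1 ((z₀ - m * δ : ℝ) : UnitAddCircle) : ℂ) -
          q.sum fun k c => c * fourier k ((z₀ - m * δ : ℝ) : UnitAddCircle)‖ ≤ ε * M := by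
  -- Along the rotation the error is at most the real part of `P` plus `2 * η`, and the mean of that
  -- real part is eventually below `4 * η`: `6 * η` in total.
  set η := ε / 8 with hη
  have hη0 : 0 < η := by positivity
  obtain ⟨b, g, hbg, hg⟩ := exists_continuous_approx_sawtooth hη0
  obtain ⟨Q, hQ, hbQ⟩ := exists_span_fourier_close b hη0
  obtain ⟨P, hP, hgP⟩ := exists_span_fourier_close g hη0
  obtain ⟨q, hq⟩ := (Finsupp.mem_span_range_iff_exists_finsupp).1 hQ
  have hqQ : ∀ z, (q.sum fun k c => c * fourier k z) = Q z := fun z => by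
    rw [← hq]
    simp [Finsupp.sum]
  have hint : ∀ P : C(UnitAddCircle, ℂ), Integrable P (AddCircle.haarAddCircle (T := 1)) := fun P =>
    (map_continuous P).integrable_of_hasCompactSupport (HasCompactSupport.of_compactSpace _)
  have hBQ : ∀ z, ‖(periodizedBernoulli 1 z : ℂ) - Q z‖ ≤ (g z).re + η := fun z =>
    (norm_sub_le_norm_sub_add_norm_sub _ (b z) _).trans (add_le_add (hbg z) (hbQ z))
  have hgr : Integrable (fun z => (g z).re) (AddCircle.haarAddCircle (T := 1)) := (hint g).re
  refine ⟨q, fun k => ?_, fun z₀ => ?_⟩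
  · have hB : Integrable (fun z => (periodizedBernoulli 1 z : ℂ))
        (AddCircle.haarAddCircle (T := 1)) := by
      have hmeas : Measurable (periodizedBernoulli 1) := by
        have e : periodizedBernoulli 1 =
            fun z => ((AddCircle.measurableEquivIco (1 : ℝ) 0 z : Set.Ico (0 : ℝ) (0 + 1)) : ℝ) -
              1 / 2 := by
          ext z
          change bernoulliFun 1 ((AddCircle.equivIco (1 : ℝ) 0 z : Set.Ico (0 : ℝ) (0 + 1)) : ℝ) =
            ((AddCircle.equivIco (1 : ℝ) 0 z : Set.Ico (0 : ℝ) (0 + 1)) : ℝ) - 1 / 2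
          simp [bernoulliFun, Polynomial.bernoulli_one]
        rw [e]
        exact (measurable_subtype_coe.comp
          (AddCircle.measurableEquivIco (1 : ℝ) 0).measurable).sub_const _
      refine Integrable.of_bound (Complex.measurable_ofReal.comp hmeas).aestronglyMeasurable
        (1 / 2) (Eventually.of_forall fun z => ?_)
      rw [Complex.norm_real]
      exact norm_periodizedBernoulli_one_le z
    have h1 := fourierCoeff_bernoulli_eq (one_ne_zero) k
    simp only [Nat.factorial_one, Nat.cast_one, pow_one] at h1
    rw [← h1, ← fourierCoeff_finsupp q k]
    simp only [hqQ]
    unfold fourierCoeff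
    have hsm : ∀ u : UnitAddCircle → ℂ, Integrable u AddCircle.haarAddCircle →
        Integrable (fun z => fourier (-k) z • u z) AddCircle.haarAddCircle := fun u hu => by
      refine hu.bdd_mul (c := 1) (map_continuous (fourier (-k))).aestronglyMeasurable
        (Eventually.of_forall fun z => ?_)
      rw [fourier_apply, Circle.norm_coe]
    change ‖(∫ z, fourier (-k) z • (periodizedBernoulli 1 z : ℂ) ∂AddCircle.haarAddCircle) -
      ∫ z, fourier (-k) z • Q z ∂AddCircle.haarAddCircle‖ ≤ ε
    rw [← integral_sub (hsm _ hB) (hsm _ (hint Q))]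
    calc _ ≤ ∫ z, ((g z).re + η) ∂(AddCircle.haarAddCircle (T := 1)) := by
          refine norm_integral_le_of_norm_le (hgr.add (integrable_const _))
            (Eventually.of_forall fun z => ?_)
          rw [← smul_sub, norm_smul, fourier_apply, Circle.norm_coe, one_mul]
          exact hBQ z
      _ ≤ 2 * η + η := by
          rw [integral_add hgr (integrable_const _)]
          simpa using hg
      _ ≤ ε := by rw [hη]; linarith
  · have hlim := tendsto_average_of_mem_span_fourier hδ z₀ hP
    have hre : (∫ z, P z ∂(AddCircle.haarAddCircle (T := 1))).re ≤ 3 * η := by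
      have e : (∫ z, P z ∂(AddCircle.haarAddCircle (T := 1))).re =
          ∫ z, (P z).re ∂(AddCircle.haarAddCircle (T := 1)) := (integral_re (hint P)).symm
      rw [e]
      calc _ ≤ ∫ z, ((g z).re + η) ∂(AddCircle.haarAddCircle (T := 1)) := by
            refine integral_mono (hint P).re (hgr.add (integrable_const _)) fun z => ?_
            have h2 := (Complex.abs_re_le_norm _).trans (hgP z)
            rw [Complex.sub_re, abs_le] at h2
            simp only
            linarith [h2.1]
        _ ≤ 2 * η + η := by
            rw [integral_add hgr (integrable_const _)]
            simpa using hg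
        _ = 3 * η := by ring
    have hev := (Complex.continuous_re.continuousAt.tendsto.comp hlim).eventually_lt_const
      (show _ < 4 * η by linarith)
    filter_upwards [hev, eventually_gt_atTop 0] with M hM hM0
    have hM0' : (0 : ℝ) < M := by exact_mod_cast hM0
    have hM' : ∑ m ∈ Finset.range M, (P ((z₀ - m * δ : ℝ) : UnitAddCircle)).re ≤ 4 * η * M := by
      have e : ((M : ℂ)⁻¹ * ∑ m ∈ Finset.range M, P ((z₀ - m * δ : ℝ) : UnitAddCircle)).re =
          (M : ℝ)⁻¹ * ∑ m ∈ Finset.range M, (P ((z₀ - m * δ : ℝ) : UnitAddCircle)).re := by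
        have : ((M : ℂ)⁻¹) = (((M : ℝ)⁻¹ : ℝ) : ℂ) := by push_cast; rfl
        rw [this, Complex.re_ofReal_mul, Complex.re_sum]
      simp only [Function.comp_apply] at hM
      rw [e, inv_mul_lt_iff₀ hM0'] at hM
      linarith
    calc _ ≤ ∑ m ∈ Finset.range M, ((P ((z₀ - m * δ : ℝ) : UnitAddCircle)).re + 2 * η) := by
          refine Finset.sum_le_sum fun m _ => ?_
          rw [hqQ]
          have h2 := (Complex.abs_re_le_norm _).trans (hgP ((z₀ - m * δ : ℝ) : UnitAddCircle))
          rw [Complex.sub_re, abs_le] at h2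
          have h3 := hBQ ((z₀ - m * δ : ℝ) : UnitAddCircle)
          linarith [h2.2]
      _ ≤ 4 * η * M + M * (2 * η) := by
          rw [Finset.sum_add_distrib]
          simpa using hM'
      _ ≤ ε * M := by rw [hη]; nlinarith

/-! ### Expansions in eigenfunctions -/

section Expansion

variable {X : Type*} [MeasurableSpace X] {μ : Measure X} {T : X → X}

/-- An isometry has orthogonal eigenspaces for distinct eigenvalues of modulus one, and
irrationality of `δ` keeps the eigenvalues distinct. -/
theorem orthogonalFamily_koopmanEigenspace (hT : MeasurePreserving T μ μ) {δ : ℝ}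
    (hδ : Irrational δ) :
    OrthogonalFamily ℂ (fun m : ℤ => koopmanEigenspace hT (m * δ))
      fun m => (koopmanEigenspace hT (m * δ)).subtypeₗᵢ := by
  intro j k hjk v w
  simp only [Submodule.coe_subtypeₗᵢ, Submodule.coe_subtype]
  set U : Lp ℂ 2 μ →ₗᵢ[ℂ] Lp ℂ 2 μ := Lp.compMeasurePreservingₗᵢ ℂ T hT
  have hv : U v = Complex.exp (2 * Real.pi * Complex.I * ((j * δ : ℝ) : ℂ)) • (v : Lp ℂ 2 μ) :=
    Module.End.mem_eigenspace_iff.1 v.2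
  have hw : U w = Complex.exp (2 * Real.pi * Complex.I * ((k * δ : ℝ) : ℂ)) • (w : Lp ℂ 2 μ) :=
    Module.End.mem_eigenspace_iff.1 w.2
  have h := U.inner_map_map (v : Lp ℂ 2 μ) w
  rw [hv, hw, inner_smul_left, inner_smul_right, ← mul_assoc, ← Complex.exp_conj,
    ← Complex.exp_add] at h
  have e : (starRingEnd ℂ) (2 * Real.pi * Complex.I * ((j * δ : ℝ) : ℂ)) +
      2 * Real.pi * Complex.I * ((k * δ : ℝ) : ℂ) =
      -(2 * Real.pi * Complex.I * (((j - k : ℤ) * δ : ℝ) : ℂ)) := by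
    simp only [map_mul, Complex.conj_ofReal, Complex.conj_I, map_ofNat]
    push_cast; ring
  rw [e] at h
  have hne := exp_neg_ne_one_of_irrational hδ (sub_ne_zero.2 hjk)
  by_contra h0
  exact hne (mul_right_cancel₀ h0 (h.trans (one_mul _).symm))

theorem starProjection_mem (hT : MeasurePreserving T μ μ) (θ : ℝ) (f : Lp ℂ 2 μ) :
    (koopmanEigenspace hT θ).starProjection f ∈ koopmanEigenspace hT θ :=
  Submodule.starProjection_apply_mem _ _

theorem norm_sum_smul_sq (hT : MeasurePreserving T μ μ) {δ : ℝ} (hδ : Irrational δ)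
    (f : Lp ℂ 2 μ) (a : ℤ → ℂ) (s : Finset ℤ) :
    ‖∑ m ∈ s, a m • (koopmanEigenspace hT (m * δ)).starProjection f‖ ^ 2 =
      ∑ m ∈ s, ‖a m • (koopmanEigenspace hT (m * δ)).starProjection f‖ ^ 2 :=
  (orthogonalFamily_koopmanEigenspace hT hδ).norm_sum
    (fun m => ⟨a m • (koopmanEigenspace hT (m * δ)).starProjection f,
      Submodule.smul_mem _ _ (starProjection_mem hT _ f)⟩) s

/-- Bessel's inequality. With it, bounded coefficients give an unconditionally convergent series,
and uniformly close coefficients give close sums. -/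
theorem sum_norm_starProjection_sq_le (hT : MeasurePreserving T μ μ) {δ : ℝ} (hδ : Irrational δ)
    (f : Lp ℂ 2 μ) (s : Finset ℤ) :
    ∑ m ∈ s, ‖(koopmanEigenspace hT (m * δ)).starProjection f‖ ^ 2 ≤ ‖f‖ ^ 2 := by
  set p := ∑ m ∈ s, (koopmanEigenspace hT (m * δ)).starProjection f with hp
  have h1 : ‖p‖ ^ 2 = ∑ m ∈ s, ‖(koopmanEigenspace hT (m * δ)).starProjection f‖ ^ 2 := by
    simpa using norm_sum_smul_sq hT hδ f (fun _ => 1) s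
  have h2 : inner ℂ p f =
      ((∑ m ∈ s, ‖(koopmanEigenspace hT (m * δ)).starProjection f‖ ^ 2 : ℝ) : ℂ) := by
    rw [hp, sum_inner]
    push_cast
    refine Finset.sum_congr rfl fun m _ => ?_
    have h3 := Submodule.sub_starProjection_mem_orthogonal (K := koopmanEigenspace hT (m * δ)) f
    rw [Submodule.mem_orthogonal] at h3
    have h4 := h3 _ (starProjection_mem hT (m * δ) f)
    rw [inner_sub_right, sub_eq_zero, inner_self_eq_norm_sq_to_K] at h4
    exact h4
  have h5 : ‖p‖ ^ 2 ≤ ‖p‖ * ‖f‖ := by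
    have := norm_inner_le_norm (𝕜 := ℂ) p f
    rw [h2, ← h1, Complex.norm_real, Real.norm_of_nonneg (by positivity)] at this
    exact this
  rw [← h1]
  have h6 : ‖p‖ ≤ ‖f‖ := by
    rcases (norm_nonneg p).eq_or_lt with h | h
    · rw [← h]; exact norm_nonneg f
    · nlinarith
  gcongr

theorem norm_sum_smul_starProjection_le (hT : MeasurePreserving T μ μ) {δ : ℝ}
    (hδ : Irrational δ) (f : Lp ℂ 2 μ) {a : ℤ → ℂ} {C : ℝ} (ha : ∀ m, ‖a m‖ ≤ C) (s : Finset ℤ) :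
    ‖∑ m ∈ s, a m • (koopmanEigenspace hT (m * δ)).starProjection f‖ ≤ C * ‖f‖ := by
  have hC : 0 ≤ C := (norm_nonneg _).trans (ha 0)
  refine le_of_sq_le_sq ?_ (by positivity)
  rw [norm_sum_smul_sq hT hδ, mul_pow]
  calc _ ≤ ∑ m ∈ s, C ^ 2 * ‖(koopmanEigenspace hT (m * δ)).starProjection f‖ ^ 2 := by
        refine Finset.sum_le_sum fun m _ => ?_
        rw [norm_smul, mul_pow]
        gcongr
        exact ha m
    _ ≤ _ := by
        rw [← Finset.mul_sum]
        gcongr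
        exact sum_norm_starProjection_sq_le hT hδ f s

theorem summable_smul_starProjection (hT : MeasurePreserving T μ μ) {δ : ℝ}
    (hδ : Irrational δ) (f : Lp ℂ 2 μ) {a : ℤ → ℂ} {C : ℝ} (ha : ∀ m, ‖a m‖ ≤ C) :
    Summable fun m : ℤ => a m • (koopmanEigenspace hT (m * δ)).starProjection f := by
  have h := (orthogonalFamily_koopmanEigenspace hT hδ).summable_iff_norm_sq_summable
    (fun m => ⟨a m • (koopmanEigenspace hT (m * δ)).starProjection f,
      Submodule.smul_mem _ _ (starProjection_mem hT _ f)⟩)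
  refine h.2 (summable_of_sum_le (c := C ^ 2 * ‖f‖ ^ 2) (fun _ => by positivity) fun s => ?_)
  calc _ ≤ ∑ m ∈ s, C ^ 2 * ‖(koopmanEigenspace hT (m * δ)).starProjection f‖ ^ 2 := by
        refine Finset.sum_le_sum fun m _ => ?_
        change ‖a m • (koopmanEigenspace hT (m * δ)).starProjection f‖ ^ 2 ≤ _
        rw [norm_smul, mul_pow]
        gcongr
        exact ha m
    _ ≤ _ := by
        rw [← Finset.mul_sum]
        gcongr
        exact sum_norm_starProjection_sq_le hT hδ f s

theorem norm_irrCoeff_le {γ : ℝ} (hγ : 0 < γ) (ℓ : ℝ) (m : ℤ) : ‖irrCoeff γ ℓ m‖ ≤ max 1 γ := by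
  unfold irrCoeff
  split_ifs with h
  · simp
  · have e1 : ∀ x : ℝ, ‖Complex.exp (2 * Real.pi * Complex.I * x)‖ = 1 := fun x => by
      have : (2 * Real.pi * Complex.I * x : ℂ) = ((2 * Real.pi * x : ℝ) : ℂ) * Complex.I := by
        push_cast; ring
      rw [this, Complex.norm_exp_ofReal_mul_I]
    have h1 := e1 (m * ℓ / γ)
    have h2 := norm_exp_neg_two_pi_I (m / γ)
    push_cast at h1 h2
    rw [norm_mul, h1, one_mul, norm_div]
    have hm : (1 : ℝ) ≤ |(m : ℝ)| := by
      exact_mod_cast Int.one_le_abs h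
    have h3 : ‖-(2 * Real.pi * Complex.I * ((m : ℂ) / γ))‖ = 2 * Real.pi * (|(m : ℝ)| / γ) := by
      rw [norm_neg, norm_mul, norm_mul, norm_mul, Complex.norm_I, norm_div, Complex.norm_real,
        Complex.norm_real, Real.norm_of_nonneg hγ.le, Real.norm_of_nonneg Real.pi_pos.le]
      simp
    rw [h3]
    have h4 : ‖Complex.exp (-(2 * Real.pi * Complex.I * ((m : ℂ) / γ))) - 1‖ ≤ 2 := by
      refine (norm_sub_le _ _).trans ?_
      rw [h2]; norm_num
    refine le_trans ?_ (le_max_right _ _)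
    rw [div_le_iff₀ (by have := Real.pi_pos; positivity)]
    refine h4.trans ?_
    have h5 : γ * (2 * Real.pi * (|(m : ℝ)| / γ)) = 2 * Real.pi * |(m : ℝ)| := by field_simp
    rw [h5]
    nlinarith [Real.pi_gt_three]

/-- The coefficient of the eigenfunctions in the twisted averages with trigonometric weight `q`. -/
def trigCoeff (δ z₀ : ℝ) (q : ℤ → ℂ) (k : ℤ) : ℂ :=
  (if k = 0 then (δ : ℂ) else 0) + q k * (Complex.exp (2 * Real.pi * Complex.I * (k * z₀)) *
    (Complex.exp (-(2 * Real.pi * Complex.I * ((k * δ : ℝ) : ℂ))) - 1))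

/-- The numbers `-1 / (2πik)` are the Fourier coefficients of the sawtooth, so the coefficients of
`F`, divided by `γ`, are those of the weight counting the elements of a level set. -/
theorem mul_irrCoeff_eq {γ : ℝ} (hγ : 0 < γ) (ℓ : ℝ) (k : ℤ) :
    (γ⁻¹ : ℝ) * irrCoeff γ ℓ k = trigCoeff γ⁻¹ (ℓ * γ⁻¹)
      (fun k => -1 / (2 * Real.pi * Complex.I * k)) k := by
  unfold irrCoeff trigCoeff
  split_ifs with h
  · simp [h]
  · have hγ' : (γ : ℂ) ≠ 0 := by exact_mod_cast hγ.ne'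
    have hk : (k : ℂ) ≠ 0 := by exact_mod_cast h
    have hpi : (Real.pi : ℂ) ≠ 0 := by exact_mod_cast Real.pi_ne_zero
    have e1 : (2 * Real.pi * Complex.I * (k * ℓ / γ) : ℂ) =
        2 * Real.pi * Complex.I * (k * ((ℓ * γ⁻¹ : ℝ) : ℂ)) := by
      push_cast; ring
    have e2 : (-(2 * Real.pi * Complex.I * (k / γ)) : ℂ) =
        -(2 * Real.pi * Complex.I * ((k * γ⁻¹ : ℝ) : ℂ)) := by
      push_cast; ring
    rw [e1, e2]
    push_cast
    have hI := Complex.I_ne_zero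
    field_simp
    ring

theorem norm_trigCoeff_sub_le {δ z₀ : ℝ} {q q' : ℤ → ℂ} {ε : ℝ} (h : ∀ k, ‖q k - q' k‖ ≤ ε)
    (k : ℤ) : ‖trigCoeff δ z₀ q k - trigCoeff δ z₀ q' k‖ ≤ 2 * ε := by
  have e : trigCoeff δ z₀ q k - trigCoeff δ z₀ q' k =
      (q k - q' k) * (Complex.exp (2 * Real.pi * Complex.I * (k * z₀)) *
        (Complex.exp (-(2 * Real.pi * Complex.I * ((k * δ : ℝ) : ℂ))) - 1)) := by
    unfold trigCoeff; ring
  have h1 : ‖Complex.exp (2 * Real.pi * Complex.I * (k * z₀))‖ = 1 := by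
    have : (2 * Real.pi * Complex.I * (k * z₀) : ℂ) =
        ((2 * Real.pi * (k * z₀) : ℝ) : ℂ) * Complex.I := by
      push_cast; ring
    rw [this, Complex.norm_exp_ofReal_mul_I]
  have h2 : ‖Complex.exp (-(2 * Real.pi * Complex.I * ((k * δ : ℝ) : ℂ))) - 1‖ ≤ 2 := by
    refine (norm_sub_le _ _).trans ?_
    rw [norm_exp_neg_two_pi_I]; norm_num
  have hε : 0 ≤ ε := (norm_nonneg _).trans (h 0)
  rw [e, norm_mul, norm_mul, h1, one_mul, mul_comm 2 ε]
  exact mul_le_mul (h k) h2 (norm_nonneg _) hε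

/-- The trigonometric weight with increments of `q` along the rotation. -/
def trigWeight (δ z₀ : ℝ) (q : ℤ →₀ ℂ) (m : ℕ) : ℂ :=
  δ + ((q.sum fun k c => c * fourier k ((z₀ - (m + 1 : ℕ) * δ : ℝ) : UnitAddCircle)) -
    q.sum fun k c => c * fourier k ((z₀ - m * δ : ℝ) : UnitAddCircle))

theorem trigWeight_eq (δ z₀ : ℝ) (q : ℤ →₀ ℂ) (m : ℕ) :
    trigWeight δ z₀ q m = ∑ k ∈ insert 0 q.support, trigCoeff δ z₀ q k *
      Complex.exp (-(2 * Real.pi * Complex.I * ((k * δ : ℝ) : ℂ))) ^ m := by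
  unfold trigWeight trigCoeff
  simp only [fourier_sub_mul_coe, add_mul, ite_mul, zero_mul]
  rw [Finset.sum_add_distrib, Finset.sum_ite_eq', if_pos (Finset.mem_insert_self _ _),
    Finsupp.sum_of_support_subset q (Finset.subset_insert 0 q.support) _ (by simp),
    Finsupp.sum_of_support_subset q (Finset.subset_insert 0 q.support) _ (by simp),
    ← Finset.sum_sub_distrib]
  congr 1
  · simp
  · exact Finset.sum_congr rfl fun k _ => by rw [pow_succ]; ring

theorem ae_almostCoboundary_trigWeight [IsProbabilityMeasure μ] (hT : MeasurePreserving T μ μ)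
    {f : X → ℂ} (hf : MemLp f 2 μ) (δ z₀ : ℝ) (q : ℤ →₀ ℂ) :
    ∀ᵐ x ∂μ, AlmostCoboundary fun m => trigWeight δ z₀ q m * f (T^[m] x) -
      (∑ k ∈ insert 0 q.support, trigCoeff δ z₀ q k •
        (koopmanEigenspace hT (k * δ)).starProjection (hf.toLp f) : Lp ℂ 2 μ) x := by
  have h1 : ∀ᵐ x ∂μ, ∀ k : ℤ, AlmostCoboundary fun m =>
      Complex.exp (-(2 * Real.pi * Complex.I * ((k * δ : ℝ) : ℂ))) ^ m * f (T^[m] x) -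
        (koopmanEigenspace hT (k * δ)).starProjection (hf.toLp f) x :=
    ae_all_iff.2 fun k => ae_almostCoboundary_orbit hT (k * δ) hf
  have h2 : ∀ᵐ x ∂μ, ∀ k : ℤ,
      (trigCoeff δ z₀ q k • (koopmanEigenspace hT (k * δ)).starProjection (hf.toLp f) :
        Lp ℂ 2 μ) x =
      trigCoeff δ z₀ q k * (koopmanEigenspace hT (k * δ)).starProjection (hf.toLp f) x :=
    ae_all_iff.2 fun k => Lp.coeFn_smul _ _
  filter_upwards [h1, h2, Lp.coeFn_finsetSum (insert 0 q.support) fun k : ℤ =>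
    (trigCoeff δ z₀ q k • (koopmanEigenspace hT (k * δ)).starProjection (hf.toLp f) :
      Lp ℂ 2 μ)] with x a1 a2 a3
  have h3 := AlmostCoboundary.sum (insert 0 q.support) fun k _ =>
    (a1 k).const_mul (trigCoeff δ z₀ q k)
  convert h3 using 2 with m
  rw [a3, Finset.sum_apply, trigWeight_eq, Finset.sum_mul, ← Finset.sum_sub_distrib]
  refine Finset.sum_congr rfl fun k _ => ?_
  rw [a2]; ring

theorem exists_ae_norm_le_of_memLp_top {f : X → ℂ} (hf : MemLp f ∞ μ) :
    ∃ C : ℝ, ∀ᵐ x ∂μ, ‖f x‖ ≤ C := by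
  refine ⟨(eLpNormEssSup f μ).toReal, ?_⟩
  have hlt : eLpNormEssSup f μ ≠ ∞ := by
    have := hf.eLpNorm_lt_top.ne
    rwa [eLpNorm_exponent_top] at this
  filter_upwards [ae_le_eLpNormEssSup (f := f) (μ := μ)] with x hx
  rw [← toReal_enorm]
  exact ENNReal.toReal_mono hlt hx

theorem ae_forall_iterate_norm_le (hT : MeasurePreserving T μ μ) {f : X → ℂ}
    (hf : MemLp f ∞ μ) : ∃ C, ∀ᵐ x ∂μ, ∀ m : ℕ, ‖f (T^[m] x)‖ ≤ C := by
  obtain ⟨C, hC⟩ := exists_ae_norm_le_of_memLp_top hf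
  exact ⟨C, ae_all_iff.2 fun m => (hT.iterate m).quasiMeasurePreserving.ae hC⟩

/-- The weighted ergodic averages with the weights `δ + B₁(z_{m+1}) - B₁(z_m)`. -/
theorem exists_hasSum_ae_almostCoboundary [IsProbabilityMeasure μ] (hT : MeasurePreserving T μ μ)
    {f : X → ℂ} (hf : MemLp f ∞ μ) {γ : ℝ} (hγ : 0 < γ) (hirr : Irrational γ) (ℓ : ℝ) :
    ∃ F : Lp ℂ 2 μ,
      HasSum (fun m : ℤ => irrCoeff γ ℓ m •
        (koopmanEigenspace hT ((m : ℝ) / γ)).starProjection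
          ((hf.mono_exponent le_top).toLp f)) F ∧
      ∀ᵐ x ∂μ, AlmostCoboundary fun m : ℕ =>
        ((γ⁻¹ : ℝ) + ((periodizedBernoulli 1 ((ℓ * γ⁻¹ - (m + 1 : ℕ) * γ⁻¹ : ℝ) : UnitAddCircle) : ℂ) -
          (periodizedBernoulli 1 ((ℓ * γ⁻¹ - m * γ⁻¹ : ℝ) : UnitAddCircle) : ℂ))) *
            (f (T^[m] x) - F x) := by
  set hf2 : MemLp f 2 μ := hf.mono_exponent le_top
  set δ := γ⁻¹ with hδdef
  have hδ : Irrational δ := hirr.inv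
  set z₀ := ℓ * δ
  simp only [div_eq_mul_inv, ← hδdef]
  obtain ⟨F, hF⟩ := summable_smul_starProjection hT hδ (hf2.toLp f) (norm_irrCoeff_le hγ ℓ)
  refine ⟨F, hF, ?_⟩
  -- The same polynomial must be close to the sawtooth in its coefficients, for convergence in `L²`,
  -- and in mean along the rotation, for the orbit sums.
  choose q hq hqz using fun n : ℕ =>
    exists_trig_approx_sawtooth hδ (ε := 1 / ((n : ℝ) + 1)) (by positivity)
  set H : ℕ → Lp ℂ 2 μ := fun n => ∑ k ∈ insert 0 (q n).support, trigCoeff δ z₀ (q n) k •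
        (koopmanEigenspace hT (k * δ)).starProjection (hf2.toLp f) with hH
  have hδF : HasSum (fun k : ℤ => trigCoeff δ z₀ (fun k => -1 / (2 * Real.pi * Complex.I * k)) k •
      (koopmanEigenspace hT (k * δ)).starProjection (hf2.toLp f)) ((δ : ℂ) • F) := by
    convert hF.const_smul (δ : ℂ) using 2 with k
    rw [smul_smul, mul_irrCoeff_eq hγ]
  have hHsum : ∀ n, HasSum (fun k : ℤ => trigCoeff δ z₀ (q n) k •
      (koopmanEigenspace hT (k * δ)).starProjection (hf2.toLp f)) (H n) := fun n => by
    refine hasSum_sum_of_ne_finset_zero fun k hk => ?_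
    rw [Finset.mem_insert, not_or, Finsupp.notMem_support_iff] at hk
    simp [trigCoeff, hk.1, hk.2]
  have hdist : ∀ n, ‖H n - (δ : ℂ) • F‖ ≤ 2 * (1 / ((n : ℝ) + 1)) * ‖hf2.toLp f‖ := by
    intro n
    have h1 := (hHsum n).sub hδF
    simp only [← sub_smul] at h1
    refine le_of_tendsto (h1.norm) (Eventually.of_forall fun s => ?_)
    refine norm_sum_smul_starProjection_le hT hδ (hf2.toLp f) (fun k => ?_) s
    refine norm_trigCoeff_sub_le (fun k => ?_) k
    rw [norm_sub_rev]
    exact hq n k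
  have hHt : Tendsto H atTop (𝓝 ((δ : ℂ) • F)) := by
    rw [tendsto_iff_norm_sub_tendsto_zero]
    refine squeeze_zero (fun _ => norm_nonneg _) hdist ?_
    have := (tendsto_one_div_add_atTop_nhds_zero_nat (𝕜 := ℝ)).const_mul 2
    simpa using this.mul_const ‖hf2.toLp f‖
  -- Convergence in `L²` gives convergence almost everywhere along a subsequence. This suffices,
  -- since `AlmostCoboundary.of_approx` needs only one good approximant for each `ε`.
  obtain ⟨ns, hns, hae⟩ := (tendstoInMeasure_of_tendsto_Lp hHt).exists_seq_tendsto_ae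
  obtain ⟨C, hC⟩ := ae_forall_iterate_norm_le hT hf
  have hAC : ∀ᵐ x ∂μ, ∀ n, AlmostCoboundary fun m => trigWeight δ z₀ (q n) m * f (T^[m] x) - H n x :=
    ae_all_iff.2 fun n => ae_almostCoboundary_trigWeight hT hf2 δ z₀ (q n)
  filter_upwards [hae, hC, hAC, Lp.coeFn_smul (δ : ℂ) F] with x hx hxC hxA hxF
  rw [hxF, Pi.smul_apply, smul_eq_mul] at hx
  set B : ℕ → ℂ := fun m => (periodizedBernoulli 1 ((z₀ - m * δ : ℝ) : UnitAddCircle) : ℂ) with hB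
  have hBb : ∀ m, ‖B m‖ ≤ 1 / 2 := fun m => by
    rw [hB, Complex.norm_real]; exact norm_periodizedBernoulli_one_le _
  change AlmostCoboundary fun m => ((δ : ℂ) + (B (m + 1) - B m)) * (f (T^[m] x) - F x)
  -- The weight is the constant `δ` plus a bounded coboundary, so the constant `F x` may be put
  -- under the weight.
  have hcob : AlmostCoboundary fun m => -F x * (B (m + 1) - B m) :=
    (AlmostCoboundary.of_coboundary ⟨_, hBb⟩).const_mul _
  have hmain : AlmostCoboundary fun m =>
      ((δ : ℂ) + (B (m + 1) - B m)) * f (T^[m] x) - δ * F x := by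
    refine AlmostCoboundary.of_approx fun ε hε => ?_
    have hC0 : 0 ≤ C := (norm_nonneg _).trans (hxC 0)
    have hsmall : ∀ᶠ j in atTop, 1 / ((ns j : ℝ) + 1) < ε / (6 * (C + 1)) :=
      ((tendsto_one_div_add_atTop_nhds_zero_nat (𝕜 := ℝ)).comp
        hns.tendsto_atTop).eventually_lt_const (by positivity)
    have hclose : ∀ᶠ j in atTop, ‖H (ns j) x - δ * F x‖ < ε / 2 := by
      have := (tendsto_iff_norm_sub_tendsto_zero.1 hx).eventually_lt_const (half_pos hε)
      exact this
    obtain ⟨j, hj1, hj2⟩ := (hsmall.and hclose).exists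
    refine ⟨_, hxA (ns j), ?_⟩
    set n := ns j
    set Q : ℕ → ℂ := fun m =>
      (q n).sum fun k c => c * fourier k ((z₀ - m * δ : ℝ) : UnitAddCircle) with hQ
    have hev := hqz n z₀
    filter_upwards [hev, (tendsto_add_atTop_nat 1).eventually hev, eventually_ge_atTop 1]
      with M h1 h2 hM1
    change ∑ m ∈ Finset.range M, ‖B m - Q m‖ ≤ _ at h1
    change ∑ m ∈ Finset.range (M + 1), ‖B m - Q m‖ ≤ _ at h2
    have h3 : ∑ m ∈ Finset.range M, ‖B (m + 1) - Q (m + 1)‖ ≤ 1 / ((n : ℝ) + 1) * (2 * M) := by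
      rw [Finset.sum_range_succ'] at h2
      have hM1' : (1 : ℝ) ≤ M := by exact_mod_cast hM1
      calc _ ≤ 1 / ((n : ℝ) + 1) * ((M + 1 : ℕ) : ℝ) := by linarith [norm_nonneg (B 0 - Q 0)]
        _ ≤ _ := by push_cast; gcongr; linarith
    calc _ ≤ ∑ m ∈ Finset.range M, (C * (‖B (m + 1) - Q (m + 1)‖ + ‖B m - Q m‖) + ε / 2) := by
          refine Finset.sum_le_sum fun m _ => ?_
          have e : ((δ : ℂ) + (B (m + 1) - B m)) * f (T^[m] x) - δ * F x -
              (trigWeight δ z₀ (q n) m * f (T^[m] x) - H n x) =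
              f (T^[m] x) * ((B (m + 1) - Q (m + 1)) - (B m - Q m)) + (H n x - δ * F x) := by
            simp only [trigWeight, hQ]; ring
          rw [e]
          refine (norm_add_le _ _).trans (add_le_add ?_ hj2.le)
          rw [norm_mul]
          exact mul_le_mul (hxC m) (norm_sub_le _ _) (norm_nonneg _) hC0
      _ ≤ C * (1 / ((n : ℝ) + 1) * (2 * M) + 1 / ((n : ℝ) + 1) * M) + ε / 2 * M := by
          rw [Finset.sum_add_distrib, ← Finset.mul_sum, Finset.sum_add_distrib]
          have : ∑ _m ∈ Finset.range M, ε / 2 = ε / 2 * M := by simp [mul_comm]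
          rw [this]
          gcongr
      _ = (C * (1 / ((n : ℝ) + 1))) * (3 * M) + ε / 2 * M := by ring
      _ ≤ ((C + 1) * (ε / (6 * (C + 1)))) * (3 * M) + ε / 2 * M := by
          gcongr
          linarith
      _ = ε * M := by field_simp; ring
  convert hmain.add hcob using 2 with m
  ring

end Expansion

/-! ### Integer iterates -/

section Iter

variable {X : Type*} {T : X → X}

theorem iter_of_bijective (hT : Function.Bijective T) (k : ℤ) :
    iter T k = ⇑((Equiv.ofBijective T hT : Equiv.Perm X) ^ k) := by
  unfold iter
  rw [dif_pos hT]

theorem iter_of_not_bijective (hT : ¬ Function.Bijective T) (k : ℤ) : iter T k = T^[k.toNat] := by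
  unfold iter
  rw [dif_neg hT]

theorem iter_add (hT : Function.Bijective T) (j k : ℤ) (x : X) :
    iter T (j + k) x = iter T j (iter T k x) := by
  simp only [iter_of_bijective hT, zpow_add, Equiv.Perm.mul_apply]

theorem iter_one (T : X → X) : iter T 1 = T := by
  simpa using iter_natCast T 1

theorem iter_zero (T : X → X) : iter T 0 = id := by
  simpa using iter_natCast T 0

theorem iter_neg_one_apply (hT : Function.Bijective T) (x : X) : iter T (-1) (T x) = x := by
  have := iter_add hT (-1) 1 x
  rw [iter_one, neg_add_cancel, iter_zero] at this
  exact this.symm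

theorem apply_iter_neg_one (hT : Function.Bijective T) (x : X) : T (iter T (-1) x) = x := by
  have := iter_add hT 1 (-1) x
  rw [iter_one, add_neg_cancel, iter_zero] at this
  exact this.symm

theorem iter_mul_natCast (hT : Function.Bijective T) (p : ℤ) (n : ℕ) :
    iter T (p * n) = (iter T p)^[n] := by
  rw [iter_of_bijective hT, iter_of_bijective hT, zpow_mul, zpow_natCast, Equiv.Perm.coe_pow]

theorem iter_neg_natCast (hT : Function.Bijective T) (n : ℕ) :
    iter T (-(n : ℤ)) = (iter T (-1))^[n] := by
  rw [← iter_mul_natCast hT, neg_one_mul]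

theorem iter_add_mul {p c : ℤ} (h : Function.Bijective T ∨ (0 ≤ p ∧ 0 ≤ c)) (n : ℕ) (x : X) :
    iter T (c + p * n) x = iter T c ((iter T p)^[n] x) := by
  rcases h with h | ⟨hp, hc⟩
  · rw [iter_add h, iter_mul_natCast h]
  · obtain ⟨p, rfl⟩ := Int.eq_ofNat_of_zero_le hp
    obtain ⟨c, rfl⟩ := Int.eq_ofNat_of_zero_le hc
    have e : (c : ℤ) + p * n = ((c + p * n : ℕ) : ℤ) := by push_cast; rfl
    rw [e, iter_natCast, iter_natCast, iter_natCast, Function.iterate_add_apply,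
      Function.iterate_mul]

variable [MeasurableSpace X] {μ : Measure X}

theorem measurePreserving_iter_neg_one [StandardBorelSpace X] (hT : MeasurePreserving T μ μ)
    (hb : Function.Bijective T) : MeasurePreserving (iter T (-1)) μ μ := by
  have hm : Measurable (iter T (-1)) := by
    intro s hs
    have e : iter T (-1) ⁻¹' s = T '' s := by
      ext x
      constructor
      · exact fun hx => ⟨_, hx, apply_iter_neg_one hb x⟩
      · rintro ⟨y, hy, rfl⟩
        rw [Set.mem_preimage, iter_neg_one_apply hb]; exact hy
    rw [e]
    -- Lusin–Souslin: on standard Borel spaces an injective measurable map sends measurable sets to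
    -- measurable sets.
    exact (hT.measurable.measurableEmbedding hb.1).measurableSet_image.2 hs
  refine ⟨hm, ?_⟩
  conv_lhs => rw [← hT.map_eq]
  rw [Measure.map_map hm hT.measurable]
  have : iter T (-1) ∘ T = id := funext (iter_neg_one_apply hb)
  rw [this, Measure.map_id]

theorem measurePreserving_iter [StandardBorelSpace X] (hT : MeasurePreserving T μ μ) (k : ℤ) :
    MeasurePreserving (iter T k) μ μ := by
  by_cases hb : Function.Bijective T
  · rcases Int.eq_nat_or_neg k with ⟨n, rfl | rfl⟩
    · rw [iter_natCast]; exact hT.iterate n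
    · rw [iter_neg_natCast hb]; exact (measurePreserving_iter_neg_one hT hb).iterate n
  · rw [iter_of_not_bijective hb]; exact hT.iterate _

theorem exists_ae_forall_iter_norm_le [StandardBorelSpace X] (hT : MeasurePreserving T μ μ)
    {f : X → ℂ} (hf : MemLp f ∞ μ) : ∃ C, ∀ᵐ x ∂μ, ∀ k : ℤ, ‖f (iter T k x)‖ ≤ C := by
  obtain ⟨C, hC⟩ := exists_ae_norm_le_of_memLp_top hf
  exact ⟨C, ae_all_iff.2 fun k => (measurePreserving_iter hT k).quasiMeasurePreserving.ae hC⟩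

theorem invariants_iter_neg_one 
    (hb : Function.Bijective T) :
    MeasurableSpace.invariants (iter T (-1)) = MeasurableSpace.invariants T := by
  ext s
  rw [MeasurableSpace.measurableSet_invariants, MeasurableSpace.measurableSet_invariants]
  refine and_congr_right fun _ => ?_
  constructor
  · intro h
    conv_lhs => rw [← h]
    rw [← Set.preimage_comp]
    have : iter T (-1) ∘ T = id := funext (iter_neg_one_apply hb)
    rw [this, Set.preimage_id]
  · intro h
    conv_lhs => rw [← h]
    rw [← Set.preimage_comp]
    have : T ∘ iter T (-1) = id := funext (apply_iter_neg_one hb)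
    rw [this, Set.preimage_id]

end Iter

/-! ### Linear functions with irrational slope -/

theorem AlmostCoboundary.congr {u v : ℕ → ℂ} (hu : AlmostCoboundary u) (h : u =ᶠ[atTop] v) :
    AlmostCoboundary v := by
  refine AlmostCoboundary.of_approx fun ε hε => ⟨u, hu, ?_⟩
  obtain ⟨K, hK⟩ := eventually_atTop.1 h
  filter_upwards [eventually_ge_atTop K, (tendsto_natCast_atTop_atTop (R := ℝ)).eventually_ge_atTop
    ((∑ m ∈ Finset.range K, ‖v m - u m‖) / ε)] with M hM hM'
  rw [← Finset.sum_range_add_sum_Ico _ hM]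
  have : ∑ m ∈ Finset.Ico K M, ‖v m - u m‖ = 0 := Finset.sum_eq_zero fun m hm => by
    rw [hK m (Finset.mem_Ico.1 hm).1, sub_self, norm_zero]
  rw [this, add_zero]
  rwa [div_le_iff₀' hε] at hM'

theorem AlmostCoboundary.of_shift {u : ℕ → ℂ} (K : ℕ) (hu : AlmostCoboundary fun n => u (n + K)) :
    AlmostCoboundary u := by
  intro ε hε
  obtain ⟨h, ⟨C, hC⟩, hM⟩ := hu (ε / 2) (half_pos hε)
  refine ⟨fun n => h (n - K), ⟨C, fun n => hC _⟩, ?_⟩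
  set R := ∑ m ∈ Finset.range K, ‖u m - (h (m + 1 - K) - h (m - K))‖
  filter_upwards [eventually_ge_atTop K, (tendsto_sub_atTop_nat K).eventually hM,
    (tendsto_natCast_atTop_atTop (R := ℝ)).eventually_ge_atTop (R / (ε / 2))] with M h1 h2 h3
  rw [← Finset.sum_range_add_sum_Ico _ h1, Finset.sum_Ico_eq_sum_range]
  have e : ∑ i ∈ Finset.range (M - K), ‖u (K + i) - (h (K + i + 1 - K) - h (K + i - K))‖ =
      ∑ i ∈ Finset.range (M - K), ‖u (i + K) - (h (i + 1) - h i)‖ := by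
    refine Finset.sum_congr rfl fun i _ => ?_
    have e1 : K + i + 1 - K = i + 1 := by omega
    have e2 : K + i - K = i := by omega
    rw [e1, e2, add_comm K i]
  rw [e]
  rw [div_le_iff₀' (half_pos hε)] at h3
  have h4 : ((M - K : ℕ) : ℝ) ≤ M := by exact_mod_cast Nat.sub_le _ _
  have h5 : ε / 2 * ((M - K : ℕ) : ℝ) ≤ ε / 2 * M := by gcongr
  linarith

theorem periodizedBernoulli_one_eq_fract (y : ℝ) :
    periodizedBernoulli 1 (y : UnitAddCircle) = Int.fract y - 1 / 2 := by
  have : (y : UnitAddCircle) = (Int.fract y : ℝ) := by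
    have h : y = Int.fract y + (⌊y⌋ : ℤ) • (1 : ℝ) := by
      rw [zsmul_one]; exact (Int.fract_add_floor y).symm
    conv_lhs => rw [h]
    rw [AddCircle.coe_add, AddCircle.coe_zsmul, AddCircle.coe_period, smul_zero, add_zero]
  rw [this, periodizedBernoulli_one_coe ⟨Int.fract_nonneg y, Int.fract_lt_one y⟩]

theorem ceil_neg_eq_periodizedBernoulli (y : ℝ) :
    (⌈-y⌉ : ℝ) = periodizedBernoulli 1 (y : UnitAddCircle) + 1 / 2 - y := by
  rw [periodizedBernoulli_one_eq_fract, Int.ceil_neg, Int.cast_neg, ← Int.self_sub_floor]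
  ring

/-- The level `0` starts at time `0`, because the natural floor truncates negative values. -/
theorem galoisConnection_floor_linear {γ : ℝ} (hγ : 0 < γ) (ℓ : ℝ) :
    GaloisConnection (fun m : ℕ => if m = 0 then 0 else ⌈((m : ℝ) - ℓ) * γ⁻¹⌉₊)
      fun n : ℕ => ⌊γ * n + ℓ⌋₊ := by
  intro m n
  by_cases hm : m = 0
  · simp [hm]
  · simp only [hm, if_false]
    rw [Nat.ceil_le, Nat.le_floor_iff' hm, ← div_eq_mul_inv, div_le_iff₀ hγ]
    constructor <;> intro h <;> linarith

theorem AlmostCoboundary.comp_floor_linear {v : ℕ → ℂ} {C : ℝ} (hv : ∀ n, ‖v n‖ ≤ C) {γ : ℝ}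
    (hγ : 0 < γ) (ℓ : ℝ)
    (h : AlmostCoboundary fun m : ℕ =>
        ((γ⁻¹ : ℝ) + ((periodizedBernoulli 1 ((ℓ * γ⁻¹ - (m + 1 : ℕ) * γ⁻¹ : ℝ) : UnitAddCircle) : ℂ) -
          (periodizedBernoulli 1 ((ℓ * γ⁻¹ - m * γ⁻¹ : ℝ) : UnitAddCircle) : ℂ))) * v m) :
    AlmostCoboundary fun n => v ⌊γ * n + ℓ⌋₊ := by
  have hg := galoisConnection_floor_linear hγ ℓ
  set τ : ℕ → ℕ := fun m : ℕ => if m = 0 then 0 else ⌈((m : ℝ) - ℓ) * γ⁻¹⌉₊ with hτ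
  set κ : ℕ → ℕ := fun n : ℕ => ⌊γ * n + ℓ⌋₊ with hκ
  have hγ' : 0 < γ⁻¹ := inv_pos.2 hγ
  -- In `c` the summand `τ 1` accounts for the level `0` and the rest bounds all later levels. If `γ
  -- > 1` some levels are empty, and the `κ N` blocks up to `N` are counted by `A`.
  refine AlmostCoboundary.of_blocks hg (u := fun n => v (κ n)) ⟨C, fun n => hv _⟩
    (c := τ 1 + ⌈γ⁻¹⌉₊ + 1) (A := ⌈γ⌉₊ + ⌈|ℓ|⌉₊) (fun m => ?_) ?_ ?_
  · by_cases hm : m = 0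
    · subst hm; simp only [zero_add]; omega
    · have h1 : τ (m + 1) = ⌈((m : ℝ) - ℓ) * γ⁻¹ + γ⁻¹⌉₊ := by
        simp only [hτ, Nat.add_one_ne_zero, if_false]
        congr 1; push_cast; ring
      have h2 : τ m = ⌈((m : ℝ) - ℓ) * γ⁻¹⌉₊ := by simp only [hτ, hm, if_false]
      rw [h1, h2]
      have := Nat.ceil_add_le (((m : ℝ) - ℓ) * γ⁻¹) γ⁻¹
      omega
  · filter_upwards [eventually_ge_atTop 1] with n hn
    simp only [hκ]
    refine Nat.floor_le_of_le ?_
    have hn' : (1 : ℝ) ≤ n := by exact_mod_cast hn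
    push_cast
    have h1 := Nat.le_ceil γ
    have h2 := (le_abs_self ℓ).trans (Nat.le_ceil |ℓ|)
    have h3 : (0 : ℝ) ≤ (⌈|ℓ|⌉₊ : ℝ) := Nat.cast_nonneg _
    nlinarith
  · refine h.congr ?_
    filter_upwards [eventually_ge_atTop 1, eventually_ge_atTop ⌈ℓ⌉₊] with m hm hmℓ
    have hℓm : ℓ ≤ m := (Nat.le_ceil ℓ).trans (by exact_mod_cast hmℓ)
    have e : ∑ n ∈ Finset.Ico (τ m) (τ (m + 1)), v (κ n) =
        ((τ (m + 1) : ℂ) - τ m) * v m := by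
      rw [Finset.sum_congr rfl fun n hn => by rw [hg.eq_of_mem_Ico hn], Finset.sum_const,
        Nat.card_Ico, nsmul_eq_mul, Nat.cast_sub (hg.monotone_l m.le_succ)]
    rw [e]
    -- Once `j ≥ ℓ` the natural ceiling is the integer one, so `τ j` is `(j - ℓ) / γ` corrected by
    -- the sawtooth.
    have hτm : ∀ j : ℕ, m ≤ j → (τ j : ℝ) =
        periodizedBernoulli 1 ((ℓ * γ⁻¹ - j * γ⁻¹ : ℝ) : UnitAddCircle) + 1 / 2 -
          (ℓ * γ⁻¹ - j * γ⁻¹) := by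
      intro j hj
      rw [← ceil_neg_eq_periodizedBernoulli]
      have hj0 : j ≠ 0 := by omega
      have hj1 : ℓ ≤ j := hℓm.trans (by exact_mod_cast hj)
      simp only [hτ, hj0, if_false]
      have e2 : -(ℓ * γ⁻¹ - j * γ⁻¹) = ((j : ℝ) - ℓ) * γ⁻¹ := by ring
      rw [e2, natCast_ceil_eq_intCast_ceil (mul_nonneg (sub_nonneg.2 hj1) hγ'.le)]
    congr 1
    have h3 : (τ (m + 1) : ℝ) - τ m = γ⁻¹ +
        (periodizedBernoulli 1 ((ℓ * γ⁻¹ - (m + 1 : ℕ) * γ⁻¹ : ℝ) : UnitAddCircle) -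
          periodizedBernoulli 1 ((ℓ * γ⁻¹ - m * γ⁻¹ : ℝ) : UnitAddCircle)) := by
      rw [hτm m le_rfl, hτm (m + 1) m.le_succ]
      push_cast; ring
    have h4 := congrArg (fun r : ℝ => (r : ℂ)) h3
    push_cast at h4 ⊢
    exact h4.symm

section Linear

variable {X : Type*} [MeasurableSpace X] {μ : Measure X} {T : X → X}

theorem exists_hasSum_ae_almostCoboundary_of_pos [IsProbabilityMeasure μ]
    (hT : MeasurePreserving T μ μ) {f : X → ℂ} (hf : MemLp f ∞ μ) {γ : ℝ} (hγ : 0 < γ)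
    (hirr : Irrational γ) (ℓ : ℝ) :
    ∃ F : Lp ℂ 2 μ,
      HasSum (fun m : ℤ => irrCoeff γ ℓ m •
        (koopmanEigenspace hT ((m : ℝ) / γ)).starProjection
          ((hf.mono_exponent le_top).toLp f)) F ∧
      ∀ᵐ x ∂μ, AlmostCoboundary fun n : ℕ => f (iter T ⌊γ * n + ℓ⌋ x) - F x := by
  obtain ⟨F, hF, hae⟩ := exists_hasSum_ae_almostCoboundary hT hf hγ hirr ℓ
  refine ⟨F, hF, ?_⟩
  obtain ⟨C, hC⟩ := ae_forall_iterate_norm_le hT hf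
  filter_upwards [hae, hC] with x h1 h2
  refine (AlmostCoboundary.comp_floor_linear (C := C + ‖F x‖) (fun n => (norm_sub_le _ _).trans
    (add_le_add (h2 n) le_rfl)) hγ ℓ h1).congr ?_
  have ht : Tendsto (fun n : ℕ => γ * n + ℓ) atTop atTop :=
    tendsto_atTop_add_const_right _ _ (tendsto_natCast_atTop_atTop.const_mul_atTop hγ)
  filter_upwards [ht.eventually_ge_atTop 0] with n hn
  rw [← Int.natCast_floor_eq_floor hn, iter_natCast]

/-- Off the integers `⌊y⌋ = -⌊1 - y⌋`, so sampling `T` along `γ n + ℓ` is sampling its inverse along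
`-γ n + (1 - ℓ)`; the formula for the limit is consistent with this. -/
theorem irrCoeff_neg (γ ℓ : ℝ) (hγ : γ ≠ 0) (m : ℤ) :
    irrCoeff (-γ) (1 - ℓ) m = irrCoeff γ ℓ m := by
  unfold irrCoeff
  split_ifs with h
  · rfl
  · have hγ' : (γ : ℂ) ≠ 0 := by exact_mod_cast hγ
    have hm : (m : ℂ) ≠ 0 := by exact_mod_cast h
    have hpi : (Real.pi : ℂ) ≠ 0 := by exact_mod_cast Real.pi_ne_zero
    have hI := Complex.I_ne_zero
    have e1 : (2 * Real.pi * Complex.I * (m * ((1 - ℓ : ℝ) : ℂ) / ((-γ : ℝ) : ℂ)) : ℂ) =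
        2 * Real.pi * Complex.I * (m * ℓ / γ) + -(2 * Real.pi * Complex.I * (m / γ)) := by
      push_cast; field_simp; ring
    have e2 : (-(2 * Real.pi * Complex.I * (m / ((-γ : ℝ) : ℂ))) : ℂ) =
        2 * Real.pi * Complex.I * (m / γ) := by
      push_cast; field_simp
    rw [e1, e2, Complex.exp_add, mul_assoc]
    congr 1
    have e3 : Complex.exp (-(2 * Real.pi * Complex.I * (m / γ))) *
        Complex.exp (2 * Real.pi * Complex.I * (m / γ)) = 1 := by
      rw [← Complex.exp_add, neg_add_cancel, Complex.exp_zero]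
    rw [← mul_div_assoc, mul_sub, e3, mul_one, div_neg, ← neg_div, neg_sub]

theorem koopmanEigenspace_eq_of_inverse {S : X → X} (hT : MeasurePreserving T μ μ)
    (hS : MeasurePreserving S μ μ) (hTS : ∀ x, T (S x) = x) (hST : ∀ x, S (T x) = x) (θ : ℝ) :
    koopmanEigenspace hS (-θ) = koopmanEigenspace hT θ := by
  have key : ∀ {T S : X → X} (hT : MeasurePreserving T μ μ) (hS : MeasurePreserving S μ μ)
      (_ : ∀ x, T (S x) = x) (g : Lp ℂ 2 μ),
      Lp.compMeasurePreservingₗᵢ ℂ S hS (Lp.compMeasurePreservingₗᵢ ℂ T hT g) = g := by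
    intro T S hT hS hTS g
    refine Lp.ext ?_
    have h1 := Lp.coeFn_compMeasurePreserving (Lp.compMeasurePreservingₗᵢ ℂ T hT g) hS
    have h2 := hS.quasiMeasurePreserving.ae (Lp.coeFn_compMeasurePreserving g hT)
    filter_upwards [h1, h2] with x h1 h2
    refine h1.trans ?_
    rw [Function.comp_apply]
    refine h2.trans ?_
    rw [Function.comp_apply, hTS]
  have le : ∀ {T S : X → X} (hT : MeasurePreserving T μ μ) (hS : MeasurePreserving S μ μ)
      (_ : ∀ x, T (S x) = x) (θ : ℝ), koopmanEigenspace hT θ ≤ koopmanEigenspace hS (-θ) := by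
    intro T S hT hS hTS θ g hg
    have h1 : Lp.compMeasurePreservingₗᵢ ℂ T hT g =
        Complex.exp (2 * Real.pi * Complex.I * θ) • g := Module.End.mem_eigenspace_iff.1 hg
    refine Module.End.mem_eigenspace_iff.2 ?_
    change Lp.compMeasurePreservingₗᵢ ℂ S hS g = _
    have h2 := key hT hS hTS g
    rw [h1, map_smul] at h2
    have e : (2 * Real.pi * Complex.I * ((-θ : ℝ) : ℂ) : ℂ) =
        -(2 * Real.pi * Complex.I * θ) := by push_cast; ring
    rw [e, Complex.exp_neg, eq_inv_smul_iff₀ (Complex.exp_ne_zero _)]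
    exact h2
  refine le_antisymm ?_ (le hT hS hTS θ)
  simpa using le hS hT hST (-θ)

theorem starProjection_congr {E : Type*} [NormedAddCommGroup E] [InnerProductSpace ℂ E]
    {K K' : Submodule ℂ E} [K.HasOrthogonalProjection] [K'.HasOrthogonalProjection] (h : K = K') :
    K.starProjection = K'.starProjection := by
  subst h; rfl

theorem exists_hasSum_ae_almostCoboundary_iter [StandardBorelSpace X] [IsProbabilityMeasure μ]
    (hT : MeasurePreserving T μ μ) {f : X → ℂ} (hf : MemLp f ∞ μ) {γ : ℝ}
    (hirr : Irrational γ) (ℓ : ℝ) (hadm : Function.Bijective T ∨ 0 < γ) :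
    ∃ F : Lp ℂ 2 μ,
      HasSum (fun m : ℤ => irrCoeff γ ℓ m •
        (koopmanEigenspace hT ((m : ℝ) / γ)).starProjection
          ((hf.mono_exponent le_top).toLp f)) F ∧
      ∀ᵐ x ∂μ, AlmostCoboundary fun n : ℕ => f (iter T ⌊γ * n + ℓ⌋ x) - F x := by
  rcases hirr.ne_zero.lt_or_gt with hγ | hγ
  · have hb : Function.Bijective T := hadm.resolve_right hγ.not_gt
    have hS := measurePreserving_iter_neg_one hT hb
    obtain ⟨F, hF, hae⟩ := exists_hasSum_ae_almostCoboundary_of_pos hS hf (γ := -γ)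
      (neg_pos.2 hγ) hirr.neg (1 - ℓ)
    refine ⟨F, ?_, ?_⟩
    · convert hF using 2 with m
      rw [irrCoeff_neg γ ℓ hγ.ne]
      have e : (m : ℝ) / -γ = -((m : ℝ) / γ) := by rw [div_neg]
      rw [starProjection_congr (K := koopmanEigenspace hS ((m : ℝ) / -γ))
        (K' := koopmanEigenspace hT ((m : ℝ) / γ)) (by
          rw [e]; exact koopmanEigenspace_eq_of_inverse hT hS (apply_iter_neg_one hb)
            (iter_neg_one_apply hb) _)]
    · filter_upwards [hae] with x hx
      refine hx.congr ?_
      have ht : Tendsto (fun n : ℕ => -γ * n + (1 - ℓ)) atTop atTop :=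
        tendsto_atTop_add_const_right _ _
          (tendsto_natCast_atTop_atTop.const_mul_atTop (neg_pos.2 hγ))
      -- As `γ` is irrational, `γ n + ℓ` is an integer for at most one `n`.
      have hinj : ∀ᶠ n : ℕ in atTop, ∀ z : ℤ, γ * n + ℓ ≠ z := by
        by_cases hex : ∃ (n₀ : ℕ) (z₀ : ℤ), γ * n₀ + ℓ = z₀
        · obtain ⟨n₀, z₀, h0⟩ := hex
          filter_upwards [eventually_gt_atTop n₀] with n hn z hz
          have h1 : γ * ((n : ℤ) - n₀ : ℤ) = ((z - z₀ : ℤ) : ℝ) := by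
            push_cast; linarith
          have h2 : ((n : ℤ) - n₀ : ℤ) ≠ 0 := by omega
          exact (hirr.mul_intCast h2).ne_int _ h1
        · push Not at hex
          exact Eventually.of_forall fun n z => hex n z
      filter_upwards [ht.eventually_ge_atTop 0, hinj] with n hn hz
      have e : ⌊-γ * n + (1 - ℓ)⌋ = -⌊γ * n + ℓ⌋ := by
        rw [Int.floor_eq_iff]
        have h1 := Int.floor_le (γ * n + ℓ)
        have h2 := Int.lt_floor_add_one (γ * n + ℓ)
        have h3 := lt_of_le_of_ne h1 (hz _).symm
        push_cast
        constructor <;> linarith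
      congr 2
      have e2 : iter (iter T (-1)) ⌊-γ * n + (1 - ℓ)⌋ = iter T ⌊γ * n + ℓ⌋ := by
        obtain ⟨k, hk⟩ := Int.eq_ofNat_of_zero_le (Int.floor_nonneg.2 hn)
        rw [hk, iter_natCast, ← iter_neg_natCast hb, ← hk, e, neg_neg]
      rw [e2]
  · exact exists_hasSum_ae_almostCoboundary_of_pos hT hf hγ hirr ℓ

/-! ### Linear functions with rational slope -/

/-- The sum over a block of length `q` is the sum of one almost coboundary per residue; the mean of
the `E j` is subtracted from every term because a block has `q` terms. -/
theorem AlmostCoboundary.of_residues {u : ℕ → ℂ} {C : ℝ} (hu : ∀ n, ‖u n‖ ≤ C) {q : ℕ}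
    (hq : q ≠ 0) {v : ℕ → ℕ → ℂ} {E : ℕ → ℂ} (huv : ∀ m, ∀ j, u (q * m + j) = v j m)
    (h : ∀ j, AlmostCoboundary fun m => v j m - E j) :
    AlmostCoboundary fun n => u n - (q : ℂ)⁻¹ * ∑ j ∈ Finset.range q, E j := by
  have hg : GaloisConnection (fun m => q * m) fun n => n / q := fun m n => by
    rw [Nat.le_div_iff_mul_le (Nat.pos_of_ne_zero hq), mul_comm]
  refine AlmostCoboundary.of_blocks hg
    ⟨C + ‖(q : ℂ)⁻¹ * ∑ j ∈ Finset.range q, E j‖, fun n => (norm_sub_le _ _).trans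
    (add_le_add (hu _) le_rfl)⟩ (c := q) (A := 1) (fun m => by rw [mul_add, mul_one])
    (Eventually.of_forall fun N => by rw [one_mul]; exact Nat.div_le_self _ _) ?_
  have hsum := AlmostCoboundary.sum (Finset.range q) fun j _ => h j
  refine hsum.congr (Eventually.of_forall fun m => ?_)
  beta_reduce
  have e : q * (m + 1) - q * m = q := by rw [mul_add, mul_one]; omega
  rw [Finset.sum_Ico_eq_sum_range, e, Finset.sum_sub_distrib, Finset.sum_sub_distrib,
    Finset.sum_const, Finset.card_range, nsmul_eq_mul, ← mul_assoc,
    mul_inv_cancel₀ (by exact_mod_cast hq), one_mul]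
  simp only [huv]

theorem almostCoboundary_rational_of_iterates {X : Type*} {T : X → X} {f : X → ℂ} {p : ℤ} {q : ℕ}
    (hq : q ≠ 0) {ℓ : ℝ} (hadm : Function.Bijective T ∨ (0 ≤ p ∧ 0 ≤ ℓ)) {x : X} {C : ℝ}
    (hC : ∀ k : ℤ, ‖f (iter T k x)‖ ≤ C) {E : ℤ → ℂ}
    (h : ∀ k : ℤ, AlmostCoboundary fun m => f (iter T k ((iter T p)^[m] x)) - E k) :
    AlmostCoboundary fun n : ℕ => f (iter T ⌊(p : ℝ) / q * n + ℓ⌋ x) -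
      (q : ℂ)⁻¹ * ∑ j ∈ Finset.range q, E ⌊(p : ℝ) * j / q + ℓ⌋ := by
  have hq0 : (0 : ℝ) < q := by exact_mod_cast Nat.pos_of_ne_zero hq
  refine AlmostCoboundary.of_residues (C := C) (u := fun n : ℕ => f (iter T ⌊(p : ℝ) / q * n + ℓ⌋ x))
    (fun n => hC _) hq
    (v := fun j m => f (iter T ⌊(p : ℝ) * j / q + ℓ⌋ ((iter T p)^[m] x)))
    (E := fun j : ℕ => E ⌊(p : ℝ) * j / q + ℓ⌋) (fun m j => ?_) (fun j => h _)
  have hc : Function.Bijective T ∨ (0 ≤ p ∧ 0 ≤ ⌊(p : ℝ) * j / q + ℓ⌋) :=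
    hadm.imp id fun h => ⟨h.1, Int.floor_nonneg.2
      (add_nonneg (div_nonneg (mul_nonneg (by exact_mod_cast h.1) (Nat.cast_nonneg _)) hq0.le)
        h.2)⟩
  have e2 : (p : ℝ) / q * ((q * m + j : ℕ) : ℝ) + ℓ =
      ((p : ℝ) * j / q + ℓ) + ((p * m : ℤ) : ℝ) := by
    push_cast; field_simp; ring
  have e3 := iter_add_mul hc m x
  rw [e2, Int.floor_add_intCast, e3]

theorem ae_almostCoboundary_rational [StandardBorelSpace X] [IsProbabilityMeasure μ]
    (hT : MeasurePreserving T μ μ) {f : X → ℂ} (hf : MemLp f ∞ μ) {p : ℤ} {q : ℕ} (hq : q ≠ 0)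
    {ℓ : ℝ} (hadm : Function.Bijective T ∨ (0 ≤ p ∧ 0 ≤ ℓ)) :
    ∀ᵐ x ∂μ, AlmostCoboundary fun n : ℕ => f (iter T ⌊(p : ℝ) / q * n + ℓ⌋ x) -
      (q : ℂ)⁻¹ * ∑ j ∈ Finset.range q,
        (μ[fun y => f (iter T ⌊(p : ℝ) * j / q + ℓ⌋ y) |
          MeasurableSpace.invariants (iter T p)]) x := by
  have hfj : ∀ k : ℤ, MemLp (fun y => f (iter T k y)) 2 μ := fun k =>
    (hf.mono_exponent le_top).comp_measurePreserving (measurePreserving_iter hT k)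
  have hae : ∀ᵐ x ∂μ, ∀ k : ℤ, AlmostCoboundary fun m =>
      f (iter T k ((iter T p)^[m] x)) -
        (μ[fun y => f (iter T k y) | MeasurableSpace.invariants (iter T p)]) x := by
    rw [ae_all_iff]
    intro k
    have h1 := ae_almostCoboundary_condExp (measurePreserving_iter hT p) (hfj k)
    exact h1
  obtain ⟨C, hC⟩ := exists_ae_forall_iter_norm_le hT hf
  filter_upwards [hae, hC] with x h1 h2
  exact almostCoboundary_rational_of_iterates hq hadm h2 (E := fun k =>
    (μ[fun y => f (iter T k y) | MeasurableSpace.invariants (iter T p)]) x) h1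

theorem ae_exists_almostCoboundary_rational [StandardBorelSpace X] [IsProbabilityMeasure μ]
    (hT : MeasurePreserving T μ μ) {f : X → ℂ} (hf : MemLp f ∞ μ) {p : ℤ} {q : ℕ} (hq : q ≠ 0)
    {ℓ : ℝ} (hadm : Function.Bijective T ∨ 0 < p) :
    ∀ᵐ x ∂μ, ∃ G : ℂ, AlmostCoboundary fun n : ℕ => f (iter T ⌊(p : ℝ) / q * n + ℓ⌋ x) - G := by
  rcases hadm with hb | hp
  · filter_upwards [ae_almostCoboundary_rational hT hf (p := p) hq (ℓ := ℓ) (Or.inl hb)] with x hx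
    exact ⟨_, hx⟩
  -- Without an inverse, a negative `ℓ` is repaired by starting at `n = q * r`, which raises `ℓ` by
  -- `p * r ≥ |ℓ|`.
  · set r := ⌈|ℓ|⌉₊
    have hp1 : (1 : ℝ) ≤ p := by exact_mod_cast hp
    have hℓ : 0 ≤ ℓ + p * r := by
      have h1 := Nat.le_ceil |ℓ|
      have h2 := neg_abs_le ℓ
      have h3 : (0 : ℝ) ≤ r := Nat.cast_nonneg _
      nlinarith
    filter_upwards [ae_almostCoboundary_rational hT hf (p := p) hq (ℓ := ℓ + p * r)
      (Or.inr ⟨hp.le, hℓ⟩)] with x hx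
    refine ⟨(q : ℂ)⁻¹ * ∑ j ∈ Finset.range q,
        (μ[fun y => f (iter T ⌊(p : ℝ) * j / q + (ℓ + p * r)⌋ y) |
          MeasurableSpace.invariants (iter T p)]) x,
      AlmostCoboundary.of_shift (q * r) (hx.congr (Eventually.of_forall fun n => ?_))⟩
    have e : (p : ℝ) / q * n + (ℓ + p * r) = (p : ℝ) / q * ((n + q * r : ℕ) : ℝ) + ℓ := ?_
    · beta_reduce
      rw [e]
    have hq0 : (q : ℝ) ≠ 0 := by exact_mod_cast hq
    push_cast
    field_simp
    ring

end Linear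

/-! ### Functions of the class `𝒯` -/

/-- Both signs of `a` are reduced to forward iterates of one map `S` along a regular counter; for
negative `a`, admissibility forces `T` to be invertible and `S` is its inverse. -/
theorem exists_iterate_eq_of_classT {X : Type*} {T : X → X} {a : ℝ → ℝ} (ha : a ∈ ClassT)
    (hadm : Admissible T a) :
    ∃ (S : X → X) (κ : ℕ → ℕ), RegularCounter κ ∧
      (S = T ∨ (Function.Bijective T ∧ S = iter T (-1))) ∧
      (∀ᶠ n : ℕ in atTop, iter T ⌊a n⌋ = S^[κ n] ∧ |(κ n : ℝ) - (|a n|)| ≤ 1) ∧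
      Tendsto (fun n : ℕ => |a n|) atTop atTop := by
  rcases regularGrowth_of_classT ha with h | h
  · obtain ⟨κ, hκ, he⟩ := h.exists_floor_eq
    have ht : Tendsto (fun n : ℕ => a n) atTop atTop := h.1.comp tendsto_natCast_atTop_atTop
    refine ⟨T, κ, hκ, Or.inl rfl, ?_, tendsto_abs_atTop_atTop.comp ht⟩
    filter_upwards [he, ht.eventually_ge_atTop 0] with n h1 h2
    refine ⟨by rw [h1, iter_natCast], ?_⟩
    have h3 : (κ n : ℝ) = ⌊a n⌋ := by rw [h1, Int.cast_natCast]
    rw [abs_of_nonneg h2, h3, abs_le]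
    constructor <;> linarith [Int.floor_le (a n), Int.lt_floor_add_one (a n)]
  · have hneg : Tendsto (fun t => -a t) atTop atTop := h.1
    have hb : Function.Bijective T := by
      refine hadm.resolve_right fun h0 => ?_
      obtain ⟨t, h1, h2⟩ := (h0.and (hneg.eventually_gt_atTop 0)).exists
      linarith
    obtain ⟨κ, hκ, he⟩ := h.exists_ceil_eq
    have ht : Tendsto (fun n : ℕ => -a n) atTop atTop := hneg.comp tendsto_natCast_atTop_atTop
    refine ⟨iter T (-1), κ, hκ, Or.inr ⟨hb, rfl⟩, ?_, ?_⟩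
    · filter_upwards [he, ht.eventually_ge_atTop 0] with n h1 h2
      rw [Int.ceil_neg] at h1
      refine ⟨by rw [← iter_neg_natCast hb, ← h1, neg_neg], ?_⟩
      have h3 : (κ n : ℝ) = -⌊a n⌋ := by
        have := congrArg (fun z : ℤ => (z : ℝ)) h1
        push_cast at this
        exact this.symm
      rw [abs_of_nonpos (show a n ≤ 0 by linarith), h3, abs_le]
      constructor <;> linarith [Int.floor_le (a n), Int.lt_floor_add_one (a n)]
    · simpa only [Function.comp_def, abs_neg] using tendsto_abs_atTop_atTop.comp ht

theorem isBigO_of_abs_sub_le {κ : ℕ → ℕ} {a : ℕ → ℝ} (h : ∀ᶠ n in atTop, |(κ n : ℝ) - (|a n|)| ≤ 1)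
    (ht : Tendsto (fun n => |a n|) atTop atTop) :
    (fun n => (κ n : ℝ)) =O[atTop] (fun n => |a n|) ∧
      (fun n => |a n|) =O[atTop] fun n => (κ n : ℝ) := by
  constructor
  · refine Asymptotics.IsBigO.of_bound 2 ?_
    filter_upwards [h, ht.eventually_ge_atTop 1] with n h1 h2
    rw [Real.norm_of_nonneg (Nat.cast_nonneg _), Real.norm_of_nonneg (abs_nonneg _)]
    linarith [(abs_le.1 h1).2]
  · refine Asymptotics.IsBigO.of_bound 2 ?_
    filter_upwards [h, ht.eventually_ge_atTop 2] with n h1 h2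
    rw [Real.norm_of_nonneg (Nat.cast_nonneg _), Real.norm_of_nonneg (abs_nonneg _)]
    linarith [(abs_le.1 h1).1]

theorem totalVar_orbit_isBigO {X : Type*} {T : X → X} {a : ℝ → ℝ} (ha : a ∈ ClassT)
    (hadm : Admissible T a) {f : X → ℂ} {x : X} {C : ℝ} (hC : ∀ k : ℤ, ‖f (iter T k x)‖ ≤ C) :
    totalVar (fun n => f (iter T ⌊a n⌋ x)) =O[atTop] fun n : ℕ => |a n| := by
  obtain ⟨S, κ, ⟨τ, hg, -⟩, hS, hev, ht⟩ := exists_iterate_eq_of_classT ha hadm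
  have hO := (isBigO_of_abs_sub_le (hev.mono fun n hn => hn.2) ht).1
  have hCS : ∀ m : ℕ, ‖f (S^[m] x)‖ ≤ C := fun m => by
    rcases hS with rfl | ⟨hb, rfl⟩
    · rw [← iter_natCast]; exact hC _
    · rw [← iter_neg_natCast hb]; exact hC _
  obtain ⟨K, hK⟩ := totalVar_congr_isBigO (u := (fun m => f (S^[m] x)) ∘ κ)
    (v := fun n => f (iter T ⌊a n⌋ x)) (by filter_upwards [hev] with n hn; simp [hn.1])
  have h1 : (fun N => 2 * C * (κ N : ℝ) + K) =O[atTop] fun n : ℕ => |a n| :=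
    (hO.const_mul_left _).add (Asymptotics.isLittleO_const_left.2 (Or.inr
      (tendsto_norm_atTop_atTop.comp ht))).isBigO
  refine Asymptotics.IsBigO.trans (Asymptotics.IsBigO.of_bound' (Eventually.of_forall fun N => ?_))
    h1
  rw [Real.norm_of_nonneg (totalVar_nonneg _ _)]
  refine le_trans ?_ (le_abs_self _)
  have := totalVar_comp_le hCS hg.monotone_u N
  linarith [hK N]

theorem ae_slowLimit_of_classT {X : Type*} [MeasurableSpace X] [StandardBorelSpace X]
    {μ : Measure X} [IsProbabilityMeasure μ] {T : X → X} (hT : MeasurePreserving T μ μ)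
    {a : ℝ → ℝ} (ha : a ∈ ClassT) (hadm : Admissible T a) {f : X → ℂ} (hf : MemLp f ∞ μ) :
    ∀ᵐ x ∂μ, SlowLimit (fun n => f (iter T ⌊a n⌋ x))
      ((μ[f | MeasurableSpace.invariants T]) x) fun n => |a n| := by
  obtain ⟨S, κ, hκ, hS, hev, ht⟩ := exists_iterate_eq_of_classT ha hadm
  have hO := (isBigO_of_abs_sub_le (hev.mono fun n hn => hn.2) ht).2
  have hSmp : MeasurePreserving S μ μ ∧
      MeasurableSpace.invariants S = MeasurableSpace.invariants T := by
    rcases hS with rfl | ⟨hb, rfl⟩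
    · exact ⟨hT, rfl⟩
    · exact ⟨measurePreserving_iter_neg_one hT hb, invariants_iter_neg_one hb⟩
  have h1 := ae_almostCoboundary_condExp hSmp.1 (hf.mono_exponent (q := ∞) (p := 2) le_top)
  rw [hSmp.2] at h1
  filter_upwards [h1] with x hx
  refine ((hx.slowLimit_comp hκ _).congr_growth hO).congr ?_
  filter_upwards [hev] with n hn
  rw [hn.1, sub_add_cancel]

/-- Coboundaries average to zero along functions of the class `𝒯`, at every point. -/
theorem tendsto_average_coboundary_of_classT {X : Type*} {T : X → X} {a : ℝ → ℝ}
    (ha : a ∈ ClassT) (hadm : Admissible T a) {h : X → ℂ} {C : ℝ} (hC : ∀ x, ‖h x‖ ≤ C) (x : X) :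
    Tendsto (fun N : ℕ => (N : ℂ)⁻¹ * ∑ n ∈ Finset.range N,
      (h (T (iter T ⌊a n⌋ x)) - h (iter T ⌊a n⌋ x))) atTop (𝓝 0) := by
  obtain ⟨S, κ, hκ, hS, hev, ht⟩ := exists_iterate_eq_of_classT ha hadm
  refine tendsto_average_of_isLittleO ?_
  simp only [sub_zero]
  have key : ∀ g : ℕ → ℂ, (∀ m, ‖g m‖ ≤ C) →
      (fun N => ∑ n ∈ Finset.range N, (g (κ n + 1) - g (κ n))) =o[atTop]
        fun N : ℕ => (N : ℝ) := by
    intro g hg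
    have := isLittleO_sum_coboundary_comp hκ (h := g) (b := fun _ => 1) ⟨C, hg⟩ ⟨1, by simp⟩ (by
      have : totalVar (fun _ => (1 : ℂ)) = fun _ => 0 := by ext N; simp [totalVar]
      rw [this]; exact Asymptotics.isLittleO_zero _ _)
    simpa using this
  rcases hS with rfl | ⟨hb, rfl⟩
  · refine sum_congr_isLittleO ?_ (key (fun m => h (S^[m] x)) fun m => hC _)
    filter_upwards [hev] with n hn
    rw [hn.1, Function.iterate_succ_apply']
  -- For the inverse map one step of the counter undoes one application of `T`, so the increments
  -- are those of `h ∘ T - h` with the opposite sign.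
  · have h1 := key (fun m => h (T ((iter T (-1))^[m] x))) fun m => hC _
    have h2 := h1.neg_left
    simp only [← Finset.sum_neg_distrib] at h2
    refine sum_congr_isLittleO ?_ h2
    filter_upwards [hev] with n hn
    rw [hn.1, Function.iterate_succ_apply', apply_iter_neg_one hb, neg_sub]

/-! ### Weak limits of empirical measures -/

open scoped BoundedContinuousFunction

/-- The empirical measure `(1/N) ∑_{n<N} δ_{y n}`. -/
def averageDirac {E : Type*} [MeasurableSpace E] (y : ℕ → E) (N : ℕ) : FiniteMeasure E :=
  ⟨(N : ℝ≥0)⁻¹ • ∑ n ∈ Finset.range N, Measure.dirac (y n), inferInstance⟩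

theorem integral_averageDirac {E F : Type*} [MeasurableSpace E] [NormedAddCommGroup F]
    [NormedSpace ℝ F] [CompleteSpace F] (y : ℕ → E) (N : ℕ) {f : E → F} (hf : StronglyMeasurable f) :
    ∫ z, f z ∂(averageDirac y N : Measure E) =
      (N : ℝ)⁻¹ • ∑ n ∈ Finset.range N, f (y n) := by
  change ∫ z, f z ∂((N : ℝ≥0)⁻¹ • ∑ n ∈ Finset.range N, Measure.dirac (y n)) = _
  rw [integral_smul_nnreal_measure, integral_finsetSum_measure]
  · simp only [integral_dirac' f _ hf]
    rw [NNReal.smul_def]; simp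
  · intro n _
    exact integrable_dirac' hf (by simp)

/-- Measures of bounded mass on a compact space form a compact set, so each ultrafilter has a limit
and only the limits need to be identified. -/
theorem tendsto_averageDirac {E : Type*} [TopologicalSpace E] [CompactSpace E] [T2Space E]
    [PolishSpace E] [MeasurableSpace E] [BorelSpace E] {y : ℕ → E} {m : FiniteMeasure E}
    (h : ∀ U : Ultrafilter ℕ, ↑U ≤ (atTop : Filter ℕ) → ∀ π : Measure E, IsProbabilityMeasure π →
      (∀ f : E →ᵇ ℝ, Tendsto (fun N : ℕ => (N : ℝ)⁻¹ * ∑ n ∈ Finset.range N, f (y n)) U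
        (𝓝 (∫ z, f z ∂π))) → π = m) :
    Tendsto (averageDirac y) atTop (𝓝 m) := by
  rw [tendsto_iff_ultrafilter]
  intro U hU
  have hint : ∀ (f : E →ᵇ ℝ) (N : ℕ), ∫ z, f z ∂(averageDirac y N : Measure E) =
      (N : ℝ)⁻¹ * ∑ n ∈ Finset.range N, f (y n) := fun f N => by
    rw [integral_averageDirac y N f.continuous.stronglyMeasurable, smul_eq_mul]
  have hone : ∀ N : ℕ, N ≠ 0 → (averageDirac y N : Measure E) Set.univ = 1 := fun N hN => by
    change ((N : ℝ≥0)⁻¹ • ∑ n ∈ Finset.range N, Measure.dirac (y n)) Set.univ = 1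
    have hN0 : (N : ℝ≥0) ≠ 0 := by exact_mod_cast hN
    simp [ENNReal.smul_def, ENNReal.coe_inv hN0]
    rw [ENNReal.inv_mul_cancel (by exact_mod_cast hN) (by simp)]
  -- At `N = 0` the average is the zero measure, so only an inequality holds for all `N`; the mass
  -- of the limit is `1` because `U` lives at infinity.
  have hmass : ∀ N, (averageDirac y N).mass ≤ 1 := fun N => by
    rw [← ENNReal.coe_le_coe, FiniteMeasure.ennreal_mass]
    rcases eq_or_ne N 0 with rfl | hN
    · change (((0 : ℕ) : ℝ≥0)⁻¹ • ∑ n ∈ Finset.range 0, Measure.dirac (y n)) Set.univ ≤ _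
      simp
    · rw [hone N hN]; simp
  have hK := isCompact_setOfPred_finiteMeasure_le_of_compactSpace (E := E) 1
  obtain ⟨π, -, hπ⟩ := hK.ultrafilter_le_nhds
    (U.map (averageDirac y)) (by
      rw [le_principal_iff]; exact mem_map.2 (Eventually.of_forall hmass))
  have hπ' : Tendsto (averageDirac y) U (𝓝 π) := hπ
  have h1 := FiniteMeasure.tendsto_iff_forall_integral_tendsto.1 hπ'
  have hprob : IsProbabilityMeasure (π : Measure E) := by
    have h2 := h1 1
    have h3 : ∀ᶠ N in (U : Filter ℕ), ∫ z, (1 : E →ᵇ ℝ) z ∂(averageDirac y N : Measure E) = 1 := by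
      filter_upwards [hU (eventually_ne_atTop 0)] with N hN
      simp [Measure.real, hone N hN]
    have h4 := tendsto_nhds_unique (h2.congr' h3) tendsto_const_nhds
    refine ⟨?_⟩
    have h5 : (π : Measure E).real Set.univ = 1 := by simpa using h4
    rwa [measureReal_def, ENNReal.toReal_eq_one_iff] at h5
  have := h U hU π hprob fun f => by simpa only [hint] using h1 f
  have e : π = m := Subtype.ext this
  rwa [e] at hπ'


/-- Integration against a finite measure is continuous for the uniform norm. -/
theorem continuous_integral_continuousMap {K : Type*} [TopologicalSpace K] [CompactSpace K]
    [MeasurableSpace K] [OpensMeasurableSpace K] (π : Measure K) [IsFiniteMeasure π] :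
    Continuous fun g : C(K, ℝ) => ∫ z, g z ∂π := by
  have hi : ∀ g : C(K, ℝ), Integrable g π := fun g =>
    (BoundedContinuousFunction.mkOfCompact g).integrable π
  refine (LipschitzWith.of_dist_le_mul (K := (π Set.univ).toNNReal) fun g h => ?_).continuous
  rw [dist_eq_norm, ← integral_sub (hi g) (hi h), mul_comm, dist_eq_norm]
  refine norm_integral_le_of_norm_le_const (Eventually.of_forall fun z => ?_)
  exact (g - h).norm_coe_le_norm z

section Pi

variable {ι : Type*} [Fintype ι] {X : ι → Type*} [∀ i, MetricSpace (X i)]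
  [∀ i, CompactSpace (X i)] [∀ i, MeasurableSpace (X i)] [∀ i, BorelSpace (X i)]

theorem ext_of_integral_prod {π π' : Measure (∀ i, X i)} [IsFiniteMeasure π] [IsFiniteMeasure π']
    (h : ∀ f : ∀ i, C(X i, ℝ), ∫ z, ∏ i, f i (z i) ∂π = ∫ z, ∏ i, f i (z i) ∂π') : π = π' := by
  -- The factor `()` brings the measure to the form "product indexed by `ι`, times one more space"
  -- to which the uniqueness theorem applies.
  have hm : Measurable fun z : ∀ i, X i => (z, ()) := by fun_prop
  have key : π.map (fun z => (z, ())) = π'.map fun z => (z, ()) := by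
    refine Measure.ext_of_integral_prod_mul_boundedContinuousFunction fun f g => ?_
    rw [integral_map hm.aemeasurable, integral_map hm.aemeasurable]
    · simp only [integral_mul_const]
      congr 1
      exact h fun i => (f i).toContinuousMap
    all_goals
      refine Continuous.aestronglyMeasurable ?_
      fun_prop
  have := congrArg (Measure.map Prod.fst) key
  rw [Measure.map_map measurable_fst hm, Measure.map_map measurable_fst hm] at this
  simpa [Function.comp_def] using this

/-- For a weak limit `π`, both integrals depend continuously on the tuple of test functions, so
agreement on `D` extends to all tuples, and tensor products determine a measure. -/
theorem tendsto_averageDirac_pi {y : ℕ → ∀ i, X i} {m : ∀ i, Measure (X i)}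
    [∀ i, IsProbabilityMeasure (m i)] {D : Set (∀ i, C(X i, ℝ))} (hD : Dense D)
    (h : ∀ f ∈ D, Tendsto (fun N : ℕ => (N : ℝ)⁻¹ * ∑ n ∈ Finset.range N, ∏ i, f i (y n i)) atTop
      (𝓝 (∏ i, ∫ z, f i z ∂m i))) :
    Tendsto (averageDirac y) atTop (𝓝 ⟨Measure.pi m, inferInstance⟩) := by
  refine tendsto_averageDirac fun U hU π hπ hlim => ?_
  change π = Measure.pi m
  refine ext_of_integral_prod fun f => ?_
  rw [integral_fintype_prod_eq_prod (μ := m) fun i => ⇑(f i)]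
  have hc1 : Continuous fun f : ∀ i, C(X i, ℝ) => ∫ z, ∏ i, f i (z i) ∂π := by
    have h1 : Continuous fun f : ∀ i, C(X i, ℝ) =>
        ∏ i, (f i).comp ⟨fun z : ∀ i, X i => z i, continuous_apply i⟩ :=
      continuous_finsetProd _ fun i _ =>
        (ContinuousMap.continuous_precomp _).comp (continuous_apply i)
    refine ((continuous_integral_continuousMap π).comp h1).congr fun f => ?_
    simp [ContinuousMap.prod_apply]
  have hc2 : Continuous fun f : ∀ i, C(X i, ℝ) => ∏ i, ∫ z, f i z ∂m i :=
    continuous_finsetProd _ fun i _ =>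
      (continuous_integral_continuousMap (m i)).comp (continuous_apply i)
  refine congrFun (hc1.ext_on hD hc2 fun f hf => ?_) f
  refine tendsto_nhds_unique (f := fun N : ℕ => (N : ℝ)⁻¹ * ∑ n ∈ Finset.range N, ∏ i, f i (y n i))
    (l := U) ?_ ((h f hf).mono_left hU)
  have := hlim (BoundedContinuousFunction.mkOfCompact
    (∏ i, (f i).comp ⟨fun z : ∀ i, X i => z i, continuous_apply i⟩))
  simpa [ContinuousMap.prod_apply] using this

end Pi

/-- In a uniquely ergodic system the averages along a function of the class `𝒯` converge at every
point. -/
theorem IsUniquelyErgodic.tendsto_average {X : Type*} [MetricSpace X] [CompactSpace X]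
    [MeasurableSpace X] [BorelSpace X] {T : X → X} {μ : Measure X} (h : IsUniquelyErgodic T μ)
    {a : ℝ → ℝ} (ha : a ∈ ClassT) (hadm : Admissible T a) (f : C(X, ℂ)) (x : X) :
    Tendsto (fun N : ℕ => (N : ℂ)⁻¹ * ∑ n ∈ Finset.range N, f (iter T ⌊a n⌋ x)) atTop
      (𝓝 (∫ y, f y ∂μ)) := by
  obtain ⟨hTc, hμ, hT, huniq⟩ := h
  have key : Tendsto (averageDirac fun n : ℕ => iter T ⌊a n⌋ x) atTop
      (𝓝 (⟨μ, inferInstance⟩ : FiniteMeasure X)) := by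
    -- A weak limit integrates `g ∘ T - g` to `0`, because coboundaries average to zero at every
    -- point; hence it is invariant.
    refine tendsto_averageDirac fun U hU π hπ hlim => huniq π hπ ⟨hTc.measurable, ?_⟩
    have := Measure.isProbabilityMeasure_map (μ := π) hTc.measurable.aemeasurable
    refine ext_of_forall_integral_eq_of_IsFiniteMeasure fun g => ?_
    rw [integral_map hTc.measurable.aemeasurable g.continuous.aestronglyMeasurable]
    have h1 := (hlim (g.compContinuous ⟨T, hTc⟩)).sub (hlim g)
    have h2 := (tendsto_average_coboundary_of_classT ha hadm (h := fun z => (g z : ℂ)) (C := ‖g‖)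
      (fun z => by rw [Complex.norm_real]; exact g.norm_coe_le_norm z) x).mono_left hU
    have h3 := (Complex.continuous_re.tendsto _).comp h2
    have h4 := tendsto_nhds_unique h1 (h3.congr fun N => ?_)
    · rw [Complex.zero_re] at h4
      exact sub_eq_zero.1 h4
    · simp only [Function.comp_apply]
      rw [← mul_sub, ← Finset.sum_sub_distrib]
      have e : ((N : ℂ)⁻¹ * ∑ n ∈ Finset.range N,
          ((g (T (iter T ⌊a n⌋ x)) : ℂ) - (g (iter T ⌊a n⌋ x) : ℂ))) =
        (((N : ℝ)⁻¹ * ∑ n ∈ Finset.range N,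
          (g (T (iter T ⌊a n⌋ x)) - g (iter T ⌊a n⌋ x)) : ℝ) : ℂ) := by push_cast; rfl
      rw [e, Complex.ofReal_re]
      rfl
  have h1 := (FiniteMeasure.tendsto_iff_forall_integral_rclike_tendsto ℂ).1 key
    (BoundedContinuousFunction.mkOfCompact f)
  refine h1.congr fun N => ?_
  rw [integral_averageDirac _ _ (BoundedContinuousFunction.continuous _).stronglyMeasurable,
    Complex.real_smul]
  push_cast
  rfl

/-! ### Comparison of growth rates -/

theorem GrowsSlower.isLittleO {a b : ℝ → ℝ} (h : GrowsSlower b a) (ha : ∀ᶠ t in atTop, a t ≠ 0) :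
    b =o[atTop] a :=
  (Asymptotics.isLittleO_iff_tendsto' (ha.mono fun _ ht h0 => absurd h0 ht)).2 h

theorem GrowsSlower.isLittleO_abs_natCast {a b : ℝ → ℝ} (h : GrowsSlower b a)
    (ha : ∀ᶠ t in atTop, a t ≠ 0) :
    (fun n : ℕ => |b n|) =o[atTop] fun n : ℕ => |a n| :=
  ((h.isLittleO ha).comp_tendsto tendsto_natCast_atTop_atTop).norm_norm

theorem eventually_ne_zero_of_mem {a : ℝ → ℝ} (ha : a ∈ ClassT ∪ ClassL) :
    ∀ᶠ t in atTop, a t ≠ 0 := by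
  rcases ha with ha | ⟨γ, ℓ, hγ, rfl⟩
  · exact ha.1.2.1.mono fun t ht => ht.1
  · filter_upwards [eventually_ne_atTop (-ℓ / γ)] with t ht h0
    exact ht (by field_simp; linarith)

theorem isBigO_id_of_mem {a : ℝ → ℝ} (ha : a ∈ ClassT ∪ ClassL) :
    a =O[atTop] fun x : ℝ => x := by
  rcases ha with ha | ⟨γ, ℓ, -, rfl⟩
  · rcases regularGrowth_of_classT ha with h | h
    · exact h.isBigO_id
    · exact (h.isBigO_id.neg_left).congr_left fun x => neg_neg _
  · exact ((Asymptotics.isBigO_refl _ _).const_mul_left γ).add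
      (Asymptotics.isLittleO_const_id_atTop ℓ).isBigO

theorem id_isBigO_linear {γ : ℝ} (hγ : γ ≠ 0) (ℓ : ℝ) :
    (fun x : ℝ => x) =O[atTop] fun x => γ * x + ℓ := by
  have h1 : (fun x : ℝ => x) =O[atTop] fun x => γ * x :=
    (Asymptotics.isBigO_const_mul_self γ⁻¹ (fun x => γ * x) atTop).congr_left fun x => by
      field_simp
  refine h1.trans (Asymptotics.IsEquivalent.isBigO_symm ?_)
  refine Asymptotics.IsEquivalent.add_isLittleO .refl ?_
  exact (Asymptotics.isLittleO_const_id_atTop ℓ).trans_isBigO h1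

/-- Every function of the two classes is `O(x)`, while a linear `b` dominates `x`; so a linear `b`
slower than `a` would be `o` of itself. -/
theorem mem_classT_of_growsSlower {a b : ℝ → ℝ} (h : GrowsSlower b a) (ha : a ∈ ClassT ∪ ClassL)
    (hb : b ∈ ClassT ∪ ClassL) : b ∈ ClassT := by
  refine hb.resolve_right ?_
  have hb0 := eventually_ne_zero_of_mem hb
  rintro ⟨γ, ℓ, hγ, rfl⟩
  have h1 := ((h.isLittleO (eventually_ne_zero_of_mem ha)).trans_isBigO
    (isBigO_id_of_mem ha)).trans_isBigO (id_isBigO_linear hγ ℓ)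
  exact Asymptotics.isLittleO_irrefl hb0.frequently h1

theorem Admissible.pos_of_linear {X : Type*} {T : X → X} {a : ℝ → ℝ} (h : Admissible T a)
    {γ ℓ : ℝ} (ha : a = fun t => γ * t + ℓ) (hγ : γ ≠ 0) : Function.Bijective T ∨ 0 < γ := by
  refine h.imp id fun h => hγ.lt_or_gt.resolve_left fun hneg => ?_
  have h1 : Tendsto a atTop atBot := by
    rw [ha]
    exact tendsto_atBot_add_const_right _ _ (tendsto_id.const_mul_atTop_of_neg hneg)
  obtain ⟨t, h2, h3⟩ := (h.and (h1.eventually_lt_atBot 0)).exists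
  exact h2.not_gt h3

theorem AlmostCoboundary.slowLimit_linear {u : ℕ → ℂ} {L : ℂ}
    (h : AlmostCoboundary fun n => u n - L) (γ ℓ : ℝ) :
    SlowLimit u L fun n => |γ * n + ℓ| := by
  refine h.slowLimit.congr_growth ?_
  have h1 : (fun x : ℝ => γ * x + ℓ) =O[atTop] fun x : ℝ => x :=
    ((Asymptotics.isBigO_refl _ _).const_mul_left γ).add
      (Asymptotics.isLittleO_const_id_atTop ℓ).isBigO
  exact (h1.comp_tendsto tendsto_natCast_atTop_atTop).norm_left

/-! ### Multiple averages -/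

theorem tendsto_multAvg {d : ℕ} [NeZero d] {a : Fin d → ℝ → ℝ}
    (ha : ∀ i j : Fin d, i < j → GrowsSlower (a j) (a i))
    (hmem : ∀ i, a i ∈ ClassT ∪ ClassL) {X : Fin d → Type*} {T : ∀ i, X i → X i}
    (hTa : ∀ i, Admissible (T i) (a i)) {f : ∀ i, X i → ℂ} {x : ∀ i, X i} {L : Fin d → ℂ}
    (hS : ∀ i, SlowLimit (fun n => f i (iter (T i) ⌊a i n⌋ (x i))) (L i) fun n => |a i n|)
    (hb : ∀ i, ∃ C, ∀ k : ℤ, ‖f i (iter (T i) k (x i))‖ ≤ C) :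
    Tendsto (fun N => multAvg a T f x N) atTop (𝓝 (∏ i, L i)) := by
  refine tendsto_average_of_isLittleO (isLittleO_sum_prod_sub hS
    (fun i => (hb i).imp fun C hC n => hC _) fun i j hij => ?_)
  obtain ⟨C, hC⟩ := hb j
  exact (totalVar_orbit_isBigO (mem_classT_of_growsSlower (ha i j hij) (hmem i) (hmem j))
    (hTa j) hC).trans_isLittleO
    ((ha i j hij).isLittleO_abs_natCast (eventually_ne_zero_of_mem (hmem i)))

section AE

variable {d : ℕ} [NeZero d] {a : Fin d → ℝ → ℝ} {X : Fin d → Type*}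
  [∀ i, MeasurableSpace (X i)] [∀ i, StandardBorelSpace (X i)] {μ : ∀ i, Measure (X i)}
  {T : ∀ i, X i → X i} {Ω : Type*} [MeasurableSpace Ω] {ν : Measure Ω} {π : ∀ i, Ω → X i} {f : ∀ i, X i → ℂ}

theorem ae_tendsto_multAvg (ha : ∀ i j : Fin d, i < j → GrowsSlower (a j) (a i))
    (hmem : ∀ i, a i ∈ ClassT ∪ ClassL) (hT : ∀ i, MeasurePreserving (T i) (μ i) (μ i))
    (hTa : ∀ i, Admissible (T i) (a i)) (hπ : ∀ i, MeasurePreserving (π i) ν (μ i))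
    (hf : ∀ i, MemLp (f i) ∞ (μ i)) {G : ∀ i, X i → ℂ}
    (hG : ∀ i, ∀ᵐ y ∂μ i, SlowLimit (fun n => f i (iter (T i) ⌊a i n⌋ y)) (G i y)
      fun n => |a i n|) :
    ∀ᵐ ω ∂ν, Tendsto (fun N => multAvg a T f (fun i => π i ω) N) atTop
      (𝓝 (∏ i, G i (π i ω))) := by
  have h1 : ∀ᵐ ω ∂ν, ∀ i, SlowLimit (fun n => f i (iter (T i) ⌊a i n⌋ (π i ω))) (G i (π i ω))
      fun n => |a i n| :=
    ae_all_iff.2 fun i => (hπ i).quasiMeasurePreserving.ae (hG i)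
  have h2 : ∀ᵐ ω ∂ν, ∀ i, ∃ C, ∀ k : ℤ, ‖f i (iter (T i) k (π i ω))‖ ≤ C := by
    refine ae_all_iff.2 fun i => ?_
    obtain ⟨C, hC⟩ := exists_ae_forall_iter_norm_le (hT i) (hf i)
    exact ((hπ i).quasiMeasurePreserving.ae hC).mono fun ω h => ⟨C, h⟩
  filter_upwards [h1, h2] with ω h1 h2
  exact tendsto_multAvg ha hmem hTa h1 h2

variable [∀ i, IsProbabilityMeasure (μ i)]

theorem ae_tendsto_multAvg_of_classT (ha : ∀ i j : Fin d, i < j → GrowsSlower (a j) (a i))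
    (hmem : ∀ i, a i ∈ ClassT) (hT : ∀ i, MeasurePreserving (T i) (μ i) (μ i))
    (hTa : ∀ i, Admissible (T i) (a i)) (hπ : ∀ i, MeasurePreserving (π i) ν (μ i))
    (hf : ∀ i, MemLp (f i) ∞ (μ i)) :
    ∀ᵐ ω ∂ν, Tendsto (fun N => multAvg a T f (fun i => π i ω) N) atTop
      (𝓝 (∏ i, ((μ i)[f i | MeasurableSpace.invariants (T i)]) (π i ω))) :=
  ae_tendsto_multAvg ha (fun i => Or.inl (hmem i)) hT hTa hπ hf
    (G := fun i => (μ i)[f i | MeasurableSpace.invariants (T i)])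
    fun i => ae_slowLimit_of_classT (hT i) (hmem i) (hTa i) (hf i)

theorem ae_tendsto_multAvg_of_linear (ha : ∀ i j : Fin d, i < j → GrowsSlower (a j) (a i))
    (hmem : ∀ i, a i ∈ ClassT ∪ ClassL) (hT : ∀ i, MeasurePreserving (T i) (μ i) (μ i))
    (hTa : ∀ i, Admissible (T i) (a i)) (hπ : ∀ i, MeasurePreserving (π i) ν (μ i))
    (hf : ∀ i, MemLp (f i) ∞ (μ i)) {γ ℓ : ℝ} (ha0 : a 0 = fun t => γ * t + ℓ) {G : X 0 → ℂ}
    (hG : ∀ᵐ y ∂μ 0, AlmostCoboundary fun n : ℕ => f 0 (iter (T 0) ⌊γ * n + ℓ⌋ y) - G y) :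
    ∀ᵐ ω ∂ν, Tendsto (fun N => multAvg a T f (fun i => π i ω) N) atTop
      (𝓝 (G (π 0 ω) * ∏ i ∈ Finset.univ.erase (0 : Fin d),
        ((μ i)[f i | MeasurableSpace.invariants (T i)]) (π i ω))) := by
  classical
  set H : ∀ i, X i → ℂ :=
    Function.update (fun i => (μ i)[f i | MeasurableSpace.invariants (T i)]) 0 G with hH
  have h := ae_tendsto_multAvg ha hmem hT hTa hπ hf (G := H) fun i => by
    rcases eq_or_ne i 0 with rfl | hi
    · rw [hH, Function.update_self]
      filter_upwards [hG] with y hy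
      have := hy.slowLimit_linear γ ℓ
      simpa only [ha0] using this
    · rw [hH, Function.update_of_ne hi]
      exact ae_slowLimit_of_classT (hT i)
        (mem_classT_of_growsSlower (ha 0 i ((Fin.pos_iff_ne_zero' i).2 hi)) (hmem 0) (hmem i))
        (hTa i) (hf i)
  filter_upwards [h] with ω hω
  rw [← Finset.mul_prod_erase _ _ (Finset.mem_univ (0 : Fin d)), hH, Function.update_self] at hω
  convert hω using 3
  refine Finset.prod_congr rfl fun i hi => ?_
  rw [Function.update_of_ne (Finset.ne_of_mem_erase hi)]

theorem ae_exists_tendsto_multAvg (ha : ∀ i j : Fin d, i < j → GrowsSlower (a j) (a i))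
    (hmem : ∀ i, a i ∈ ClassT ∪ ClassL) (hT : ∀ i, MeasurePreserving (T i) (μ i) (μ i))
    (hTa : ∀ i, Admissible (T i) (a i)) (hπ : ∀ i, MeasurePreserving (π i) ν (μ i))
    (hf : ∀ i, MemLp (f i) ∞ (μ i)) :
    ∀ᵐ ω ∂ν, ∃ L : ℂ, Tendsto (fun N => multAvg a T f (fun i => π i ω) N) atTop (𝓝 L) := by
  rcases hmem 0 with h0 | ⟨γ, ℓ, hγ, h0⟩
  · have hall : ∀ i, a i ∈ ClassT := fun i => by
      rcases eq_or_ne i 0 with rfl | hi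
      · exact h0
      · exact mem_classT_of_growsSlower (ha 0 i ((Fin.pos_iff_ne_zero' i).2 hi)) (hmem 0) (hmem i)
    exact (ae_tendsto_multAvg_of_classT ha hall hT hTa hπ hf).mono fun ω h => ⟨_, h⟩
  · have hadm := (hTa 0).pos_of_linear h0 hγ
    have hG : ∀ᵐ y ∂μ 0, ∃ G : ℂ,
        AlmostCoboundary fun n : ℕ => f 0 (iter (T 0) ⌊γ * n + ℓ⌋ y) - G := by
      by_cases hirr : Irrational γ
      · obtain ⟨F, -, hF⟩ := exists_hasSum_ae_almostCoboundary_iter (hT 0) (hf 0) hirr ℓ hadm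
        exact hF.mono fun y h => ⟨_, h⟩
      · obtain ⟨r, hr⟩ : ∃ r : ℚ, (r : ℝ) = γ := by simpa [Irrational] using hirr
        have h1 := ae_exists_almostCoboundary_rational (hT 0) (hf 0) (p := r.num) r.den_nz (ℓ := ℓ)
          (hadm.imp id fun h => by
            rw [Rat.num_pos]
            exact_mod_cast hr ▸ h)
        have e : (r.num : ℝ) / (r.den : ℝ) = γ := by rw [← hr]; exact (Rat.cast_def r).symm
        simpa only [e] using h1
    -- The limits are chosen point by point; measurability of `G` plays no role.
    obtain ⟨G, hG⟩ := skolem.1 hG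
    exact (ae_tendsto_multAvg_of_linear ha hmem hT hTa hπ hf h0 hG).mono fun ω h => ⟨_, h⟩

end AE

/-! ### Topological systems -/

theorem SlowLimit.tendsto_average {u : ℕ → ℂ} {L : ℂ} {ρ : ℕ → ℝ} (h : SlowLimit u L ρ) :
    Tendsto (fun N : ℕ => (N : ℂ)⁻¹ * ∑ n ∈ Finset.range N, u n) atTop (𝓝 L) := by
  refine tendsto_average_of_isLittleO ?_
  have e : totalVar (fun _ => (1 : ℂ)) = fun _ => 0 := by ext N; simp [totalVar]
  simpa using h (fun _ => 1) ⟨1, by simp⟩ (by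
    rw [e]; exact Asymptotics.isLittleO_zero _ _)

theorem IsCoupling.measurePreserving {d : ℕ} {X : Fin d → Type*} [∀ i, MeasurableSpace (X i)]
    {μ : ∀ i, Measure (X i)} {ν : Measure (∀ i, X i)} (hν : IsCoupling μ ν) (i : Fin d) :
    MeasurePreserving (fun x : ∀ i, X i => x i) ν (μ i) :=
  ⟨measurable_pi_apply i, hν.2 i⟩

section Topological

variable {d : ℕ} [NeZero d] {a : Fin d → ℝ → ℝ} {X : Fin d → Type*}
  [∀ i, MetricSpace (X i)] [∀ i, CompactSpace (X i)] [∀ i, MeasurableSpace (X i)]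
  [∀ i, BorelSpace (X i)] {μ : ∀ i, Measure (X i)} [∀ i, IsProbabilityMeasure (μ i)]
  {T : ∀ i, X i → X i} {ν : Measure (∀ i, X i)}

theorem ae_tendsto_empirical (ha : ∀ i j : Fin d, i < j → GrowsSlower (a j) (a i))
    (hmem : ∀ i, a i ∈ ClassT) (hT : ∀ i, MeasurePreserving (T i) (μ i) (μ i))
    (hTa : ∀ i, Admissible (T i) (a i)) (hν : IsCoupling μ ν) :
    ∀ᵐ x ∂ν, Tendsto (fun N => empirical a T x N) atTop (𝓝 (prodErgodicFibre μ T x)) := by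
  -- Countability of `D` leaves a single null set for all test functions; density makes them
  -- sufficient.
  obtain ⟨D, hDc, hD⟩ := TopologicalSpace.exists_countable_dense (∀ i, C(X i, ℝ))
  have hint : ∀ (g : ∀ i, C(X i, ℝ)) (i : Fin d), MemLp (fun y => (g i y : ℂ)) ∞ (μ i) :=
    fun g i => memLp_top_of_bound
      (Complex.continuous_ofReal.comp (g i).continuous).aestronglyMeasurable ‖g i‖
      (Eventually.of_forall fun y => by
        rw [Complex.norm_real]; exact (g i).norm_coe_le_norm y)
  have h1 : ∀ᵐ x ∂ν, ∀ g ∈ D, Tendsto (fun N => multAvg a T (fun i y => (g i y : ℂ)) x N) atTop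
      (𝓝 (∏ i, ((μ i)[fun y => (g i y : ℂ) | MeasurableSpace.invariants (T i)]) (x i))) :=
    (ae_ball_iff hDc).2 fun g _ =>
      ae_tendsto_multAvg_of_classT ha hmem hT hTa hν.measurePreserving (hint g)
  have h2 : ∀ᵐ x ∂ν, ∀ g ∈ D, ∀ i,
      ((μ i)[fun y => (g i y : ℂ) | MeasurableSpace.invariants (T i)]) (x i) =
        ∫ y, (g i y : ℂ) ∂ergodicFibre (μ i) (T i) (x i) :=
    (ae_ball_iff hDc).2 fun g _ => ae_all_iff.2 fun i =>
      (hν.measurePreserving i).quasiMeasurePreserving.ae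
        (condExp_ae_eq_integral_condExpKernel (MeasurableSpace.invariants_le (T i))
          ((hint g i).integrable le_top))
  filter_upwards [h1, h2] with x h1 h2
  refine tendsto_averageDirac_pi (y := fun n i => iter (T i) ⌊a i n⌋ (x i))
    (m := fun i => ergodicFibre (μ i) (T i) (x i)) hD fun g hg => ?_
  have h3 := h1 g hg
  simp only [h2 g hg, integral_complex_ofReal] at h3
  have h4 := (Complex.continuous_re.tendsto _).comp h3
  rw [← Complex.ofReal_prod, Complex.ofReal_re] at h4
  refine h4.congr fun N => ?_
  simp only [Function.comp_apply, multAvg]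
  rw [← Complex.ofReal_re ((N : ℝ)⁻¹ * _)]
  push_cast
  rfl

theorem ae_tendsto_multAvg_of_isUniquelyErgodic
    (ha : ∀ i j : Fin d, i < j → GrowsSlower (a j) (a i)) (hmem : ∀ i, a i ∈ ClassT)
    (hTa : ∀ i, Admissible (T i) (a i)) (hν : IsCoupling μ ν)
    (h : ∀ i, IsUniquelyErgodic (T i) (μ i)) (f : ∀ i, C(X i, ℂ)) :
    ∀ᵐ x ∂ν, Tendsto (fun N => multAvg a T (fun i => ⇑(f i)) x N) atTop
      (𝓝 (∏ i, ∫ y, f i y ∂μ i)) := by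
  have hT : ∀ i, MeasurePreserving (T i) (μ i) (μ i) := fun i => (h i).2.2.1
  have hf : ∀ i, MemLp (f i) ∞ (μ i) := fun i =>
    memLp_top_of_bound (f i).continuous.aestronglyMeasurable ‖f i‖
      (Eventually.of_forall fun y => (f i).norm_coe_le_norm y)
  have h1 : ∀ᵐ x ∂ν, ∀ i,
      ((μ i)[f i | MeasurableSpace.invariants (T i)]) (x i) = ∫ y, f i y ∂μ i := by
    refine ae_all_iff.2 fun i => (hν.measurePreserving i).quasiMeasurePreserving.ae
      (p := fun y => ((μ i)[f i | MeasurableSpace.invariants (T i)]) y = ∫ y, f i y ∂μ i) ?_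
    -- The conditional expectation is constant because it and the integral are limits of the same
    -- averages.
    filter_upwards [ae_slowLimit_of_classT (hT i) (hmem i) (hTa i) (hf i)] with y hy
    exact tendsto_nhds_unique hy.tendsto_average ((h i).tendsto_average (hmem i) (hTa i) (f i) y)
  filter_upwards [h1, ae_tendsto_multAvg_of_classT ha hmem hT hTa hν.measurePreserving hf]
    with x h1 h2
  simpa only [h1] using h2

end Topological

/-! ### The main theorem -/

theorem corollary4p2 {d : ℕ} [NeZero d] (a : Fin d → ℝ → ℝ)
    (ha : ∀ i j : Fin d, i < j → GrowsSlower (a j) (a i))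
    {X : Fin d → Type*} [∀ i, MetricSpace (X i)] [∀ i, CompactSpace (X i)]
    [∀ i, MeasurableSpace (X i)] [∀ i, BorelSpace (X i)]
    (μ : ∀ i, Measure (X i)) [∀ i, IsProbabilityMeasure (μ i)]
    (T : ∀ i, X i → X i) (hT : ∀ i, MeasurePreserving (T i) (μ i) (μ i))
    (hTa : ∀ i, Admissible (T i) (a i))
    (ν : Measure (∀ i, X i)) (hν : IsCoupling μ ν) :
    ((∀ i, a i ∈ ClassT) →
      -- weak convergence of the empirical measures
      (∀ᵐ x ∂ν, Tendsto (fun N => empirical a T x N) atTop (𝓝 (prodErgodicFibre μ T x))) ∧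
      -- pointwise convergence of the multiple averages
      (∀ f : ∀ i, X i → ℂ, (∀ i, MemLp (f i) ∞ (μ i)) →
        ∀ᵐ x ∂ν, Tendsto (fun N => multAvg a T f x N) atTop
          (𝓝 (∏ i, ((μ i)[f i | MeasurableSpace.invariants (T i)]) (x i)))) ∧
      -- several transformations of one space
      (∀ (Y : Type*) [MetricSpace Y] [CompactSpace Y] [MeasurableSpace Y] [BorelSpace Y]
        (m : Measure Y) [IsProbabilityMeasure m] (S : Fin d → Y → Y),
        (∀ i, MeasurePreserving (S i) m m) → (∀ i, Admissible (S i) (a i)) →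
        ∀ f : Fin d → Y → ℂ, (∀ i, MemLp (f i) ∞ m) →
          ∀ᵐ y ∂m, Tendsto (fun N => multAvg a S f (fun _ => y) N) atTop
            (𝓝 (∏ i, (m[f i | MeasurableSpace.invariants (S i)]) y))) ∧
      -- single averages on a uniquely ergodic system, at every point
      (∀ i, IsUniquelyErgodic (T i) (μ i) → ∀ (f : C(X i, ℂ)) (x : X i),
        Tendsto (fun N : ℕ => (N : ℂ)⁻¹ *
            ∑ n ∈ Finset.range N, f (iter (T i) ⌊a i (n : ℝ)⌋ x)) atTop
          (𝓝 (∫ y, f y ∂(μ i)))) ∧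
      -- multiple averages on uniquely ergodic systems
      ((∀ i, IsUniquelyErgodic (T i) (μ i)) → ∀ f : ∀ i, C(X i, ℂ),
        ∀ᵐ x ∂ν, Tendsto (fun N => multAvg a T (fun i => ⇑(f i)) x N) atTop
          (𝓝 (∏ i, ∫ y, f i y ∂(μ i))))) ∧
    -- the fastest function may also be linear
    ((∀ i, a i ∈ ClassT ∪ ClassL) →
      ∀ (f : ∀ i, X i → ℂ) (hf : ∀ i, MemLp (f i) ∞ (μ i)),
        (∀ᵐ x ∂ν, ∃ L : ℂ, Tendsto (fun N => multAvg a T f x N) atTop (𝓝 L)) ∧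
        -- rational leading coefficient
        (∀ (p : ℤ) (q : ℕ) (ℓ : ℝ), p ≠ 0 → q ≠ 0 →
          a 0 = (fun t => (p : ℝ) / (q : ℝ) * t + ℓ) →
          (Function.Bijective (T 0) ∨ 0 ≤ ℓ) →
          ∀ᵐ x ∂ν, Tendsto (fun N => multAvg a T f x N) atTop
            (𝓝 (((q : ℂ)⁻¹ * ∑ j ∈ Finset.range q,
                ((μ 0)[fun y => f 0 (iter (T 0) ⌊(p : ℝ) * (j : ℝ) / (q : ℝ) + ℓ⌋ y) |
                  MeasurableSpace.invariants (iter (T 0) p)]) (x 0)) *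
              ∏ i ∈ Finset.univ.erase (0 : Fin d),
                ((μ i)[f i | MeasurableSpace.invariants (T i)]) (x i)))) ∧
        -- irrational leading coefficient
        (∀ γ ℓ : ℝ, Irrational γ → a 0 = (fun t => γ * t + ℓ) →
          ∃ F : Lp ℂ 2 (μ 0),
            HasSum (fun m : ℤ => irrCoeff γ ℓ m •
              (koopmanEigenspace (hT 0) ((m : ℝ) / γ)).starProjection
                (((hf 0).mono_exponent le_top).toLp (f 0))) F ∧
            ∀ᵐ x ∂ν, Tendsto (fun N => multAvg a T f x N) atTop
              (𝓝 (F (x 0) * ∏ i ∈ Finset.univ.erase (0 : Fin d),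
                ((μ i)[f i | MeasurableSpace.invariants (T i)]) (x i))))) := by

  have hπ := hν.measurePreserving
  refine ⟨fun hmem => ⟨ae_tendsto_empirical ha hmem hT hTa hν,
    fun f hf => ae_tendsto_multAvg_of_classT ha hmem hT hTa hπ hf,
    fun Y _ _ _ _ m _ S hS hSa f hf =>
      ae_tendsto_multAvg_of_classT (π := fun _ y => y) ha hmem hS hSa
        (fun _ => MeasurePreserving.id m) hf,
    fun i h f x => h.tendsto_average (hmem i) (hTa i) f x,
    fun h f => ae_tendsto_multAvg_of_isUniquelyErgodic ha hmem hTa hν h f⟩,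
    fun hmem f hf => ⟨ae_exists_tendsto_multAvg ha hmem hT hTa hπ hf, ?_, ?_⟩⟩
  · intro p q ℓ hp hq h0 hadm
    -- If `T 0` is not invertible, admissibility of the sampling function forces a positive slope,
    -- hence `p > 0`.
    have hpos := (hTa 0).pos_of_linear h0
      (div_ne_zero (by exact_mod_cast hp) (by exact_mod_cast hq))
    have hadm' : Function.Bijective (T 0) ∨ (0 ≤ p ∧ 0 ≤ ℓ) := by
      rcases hadm with h | h
      · exact Or.inl h
      · refine hpos.imp id fun h' => ⟨?_, h⟩
        have hq0 : (0 : ℝ) < q := by exact_mod_cast Nat.pos_of_ne_zero hq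
        exact_mod_cast ((div_pos_iff_of_pos_right hq0).1 h').le
    exact ae_tendsto_multAvg_of_linear ha hmem hT hTa hπ hf h0
      (ae_almostCoboundary_rational (hT 0) (hf 0) hq hadm')
  · intro γ ℓ hirr h0
    obtain ⟨F, hF, hae⟩ := exists_hasSum_ae_almostCoboundary_iter (hT 0) (hf 0) hirr ℓ
      ((hTa 0).pos_of_linear h0 hirr.ne_zero)
    exact ⟨F, hF, ae_tendsto_multAvg_of_linear ha hmem hT hTa hπ hf h0 hae⟩

end
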